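/- Let $(\Omega,\mathcal A,\mathbb P)$ be a probability space, $Y\in\mathbb R^d$ and $Z\in\mathbb R^q$ independent random variables, $(Z^{(k)})_{k\ge1}$ iid copies of $Z$ independent of $Y$, $\varphi:\mathbb R^d\times\mathbb R^q\to\mathbb R$ measurable with $\varphi(Y,Z)\in L^2(\mathbb P)$, and $\alpha\in(0,1)$. Let $\mathcal H=\{1/K: K\in\mathbb N,\ K\ge1\}$ and $\overline{\mathcal H}=\mathcal H\cup\{0\}$. Put $X_0=\mathbb E[\varphi(Y,Z)\mid Y]$ and, for $h=1/K\in\mathcal H$, $X_h=\frac1K\sum_{k=1}^K\varphi(Y,Z^{(k)})$. For $h\in\overline{\mathcal H}$ let $F_{X_h}$ be the cdf of $X_h$, let $V_h(\xi)=\xi+\frac1{1-\alpha}\mathbb E[(X_h-\xi)^+]$, let $\xi^h_\star$ be a minimizer of $V_h$ and $\chi^h_\star=V_h(\xi^h_\star)=\min V_h$. Write $\|\cdot\|_\infty$ for the supremum norm, $[\cdot]_{\rm Lip}$ for the best Lipschitz constant, and $k_\alpha=1\vee\frac\alpha{1-\alpha}$. Assume: (a) there are $v,w(\cdot,h):\mathbb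 R\to\mathbb R$ with $F_{X_h}(\xi)-F_{X_0}(\xi)=v(\xi)h+w(\xi,h)h$ for all $\xi\in\mathbb R$, $h\in\mathcal H$, such that for every minimizer $\xi_0$ of $V_0$, $v$ is integrable on $(\xi_0,\infty)$ and $w(\xi_0,h)\to0$, $\int_{\xi_0}^\infty w(\xi,h)\,d\xi\to0$ as $\mathcal H\ni h\downarrow0$; (b) for every $h\in\overline{\mathcal H}$ the law of $X_h$ has a continuous density $f_{X_h}$, and $f_{X_h}\to f_{X_0}$ locally uniformly as $\mathcal H\ni h\downarrow0$; (c) for every $R>0$, $\inf\{f_{X_h}(\xi): h\in\overline{\mathcal H},\ |\xi-\xi^0_\star|<R\}>0$, and $\sup_{h\in\overline{\mathcal H}}(\|f_{X_h}\|_\infty+[f_{X_h}]_{\rm Lip})<\infty$. (Then $V_h$ is twice continuously differentiable with $V_h''=f_{X_h}/(1-\alpha)$.) For a positive integer $p$ let $$\bar\lambda_p=\inf_{h\in\overline{\mathcal H}}\Big(\tfrac38\,p\,V_h''(\xi^h_\star)\ \wedge\ p^2\|V_h''\|_\infty\frac{V_h''(\xi^h_\star)^4}{4[V_h'']_{\rm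 Lip}^2}\Big).$$ Let $\gamma_n=\gamma_1n^{-\beta}$, $n\ge1$, with $\gamma_1>0$ and $\beta\in(0,1]$. For $h\in\mathcal H$ let $(X_h^{(n)})_{n\ge1}$ be iid copies of $X_h$, let $(\xi^h_0,\chi^h_0)$ be an $\mathbb R^2$-valued random vector independent of $(X_h^{(n)})_{n\ge1}$, and define the nested stochastic approximation scheme $$\xi^h_{n+1}=\xi^h_n-\gamma_{n+1}\Big(1-\tfrac1{1-\alpha}\mathbf 1_{X_h^{(n+1)}\ge\xi^h_n}\Big),\qquad \chi^h_{n+1}=\chi^h_n-\tfrac1{n+1}\Big(\chi^h_n-\xi^h_n-\tfrac1{1-\alpha}(X_h^{(n+1)}-\xi^h_n)^+\Big),\qquad n\ge0.$$ Let also $(\xi^0_0,\chi^0_0)$ be a random vector, and set $M=\sup_{h\in\overline{\mathcal H}}\|f_{X_h}\|_\infty$. Assume $$\sup_{h\in\overline{\mathcal H}}\mathbb E\Big[|\xi^h_0|^2\exp\Big(\tfrac{4}{1-\alpha}k_\alpha M|\xi^h_0|\Big)\Big]+\sup_{h\in\overline{\mathcal H}}\mathbb E[|\chi^h_0|]<\infty.$$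 (i) If $\bar\lambda_1\gamma_1>1$ in the case $\beta=1$, then there are constants $(\bar K_h)_{h\in\mathcal H}$, $(C_h)_{h\in\mathcal H}$ with $\sup_{h\in\mathcal H}\bar K_h<\infty$, $\sup_{h\in\mathcal H}C_h<\infty$ such that, for all $h\in\mathcal H$ and $n\ge1$, $$\mathbb E[(\xi^h_n-\xi^h_\star)^2]\le\bar K_h\gamma_n,\qquad \mathbb E[|\chi^h_n-\chi^h_\star|]\le\frac{C_h}{n^{\frac12\wedge\beta}}.$$ (ii) Assume further that $$\sup_{h\in\overline{\mathcal H}}\mathbb E\Big[|\xi^h_0|^4\exp\Big(\tfrac{16}{1-\alpha}k_\alpha M|\xi^h_0|\Big)\Big]+\sup_{h\in\overline{\mathcal H}}\mathbb E[(\chi^h_0)^2]<\infty.$$ If $\bar\lambda_2\gamma_1>2$ in the case $\beta=1$, then there are constants $(\bar K'_h)_{h\in\mathcal H}$, $(\bar C_h)_{h\in\mathcal H}$ with $\sup_{h\in\mathcal H}\bar K'_h<\infty$, $\sup_{h\in\mathcal H}\bar C_h<\infty$ such that, for all $h\in\mathcal H$ and $n\ge1$, $$\mathbb E[(\xi^h_n-\xi^h_\star)^4]\le\bar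 K'_h\gamma_n^2,\qquad \mathbb E[(\chi^h_n-\chi^h_\star)^2]\le\frac{\bar C_h}{n^{1\wedge2\beta}}.$$ -/

import Mathlib

open MeasureTheory ProbabilityTheory Filter Topology

noncomputable section

namespace NestedSA

/- Bias parameters: the set of all `h = 1 / K` with `K ≥ 1`, together with `h = 0`, is indexed by
`K : ℕ`. The index `K ≥ 1` stands for `h = 1 / K`, and the index `K = 0` stands for `h = 0`
(the unbiased problem). Letting `h ↓ 0` along the positive bias parameters is `K → ∞`. -/

section Model

variable {Ω E F : Type*} [MeasurableSpace Ω] [MeasurableSpace E] [MeasurableSpace F]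

/-- The exact loss `X_0 = 𝔼[φ(Y, Z) | Y]`. -/
def exactLoss (P : Measure Ω) (φ : E × F → ℝ) (Y : Ω → E) (Z : Ω → F) : Ω → ℝ :=
  P[fun ω => φ (Y ω, Z ω) | MeasurableSpace.comap Y inferInstance]

/-- The inner Monte Carlo average `X_h = (1/K) ∑_{k=1}^K φ(Y, Z^{(k)})`, `h = 1/K`; the copy
`Z^{(k)}` is `Zs (k - 1)`. -/
def mcLoss (φ : E × F → ℝ) (Y : Ω → E) (Zs : ℕ → Ω → F) (K : ℕ) (ω : Ω) : ℝ :=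
  1 / (K : ℝ) * ∑ k ∈ Finset.range K, φ (Y ω, Zs k ω)

/-- The family `(X_h)`: index `0` is the exact loss, index `K ≥ 1` is `X_{1/K}`. -/
def loss (P : Measure Ω) (φ : E × F → ℝ) (Y : Ω → E) (Z : Ω → F) (Zs : ℕ → Ω → F) :
    ℕ → Ω → ℝ
  | 0 => exactLoss P φ Y Z
  | K + 1 => mcLoss φ Y Zs (K + 1)

/-- `Y` and `Z` are independent, and `(Z^{(k)})` are iid copies of `Z`, independent of `Y`. -/
structure IsModel (P : Measure Ω) (φ : E × F → ℝ) (Y : Ω → E) (Z : Ω → F)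
    (Zs : ℕ → Ω → F) : Prop where
  measurable_φ : Measurable φ
  measurable_Y : Measurable Y
  measurable_Z : Measurable Z
  measurable_Zs : ∀ k, Measurable (Zs k)
  indep_Y_Z : IndepFun Y Z P
  iIndep_Zs : iIndepFun Zs P
  copies_Zs : ∀ k, IdentDistrib (Zs k) Z P P
  indep_Y_Zs : IndepFun Y (fun ω k => Zs k ω) P

end Model

section Problem

variable {Ω : Type*} [MeasurableSpace Ω]

/-- `V(ξ) = ξ + (1 - α)⁻¹ 𝔼[(X - ξ)⁺]`. -/
def V (P : Measure Ω) (α : ℝ) (X : Ω → ℝ) (ξ : ℝ) : ℝ :=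
  ξ + 1 / (1 - α) * ∫ ω, max (X ω - ξ) 0 ∂P

/-- `Θ = Argmin V`. -/
def argminV (P : Measure Ω) (α : ℝ) (X : Ω → ℝ) : Set ℝ :=
  {ξ | ∀ x, V P α X ξ ≤ V P α X x}

/-- The second derivative `V''`. -/
def V'' (P : Measure Ω) (α : ℝ) (X : Ω → ℝ) : ℝ → ℝ :=
  deriv (deriv (V P α X))

/-- `‖g‖_∞` (used for bounded functions). -/
def supNorm (g : ℝ → ℝ) : ℝ := ⨆ x, |g x|

/-- `[g]_Lip`, the best Lipschitz constant (used for Lipschitz functions); pairs on the diagonal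
contribute `0 / 0 = 0`. -/
def lipConst (g : ℝ → ℝ) : ℝ := ⨆ p : ℝ × ℝ, |g p.1 - g p.2| / |p.1 - p.2|

/-- `k_α = 1 ∨ α / (1 - α)`. -/
def kConst (α : ℝ) : ℝ := max 1 (α / (1 - α))

/-- `λ̄_{h,q} = (3/8) q V_h''(ξ⋆) ∧ μ_{h,q} V_h''(ξ⋆)⁴ / (4 [V_h'']_Lip²)`, where
`μ_{h,q} = q² ‖V_h''‖_∞`. -/
def lamBarAt (P : Measure Ω) (α : ℝ) (X : Ω → ℝ) (ξstar : ℝ) (q : ℕ) : ℝ :=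
  min (3 / 8 * (q : ℝ) * V'' P α X ξstar)
    ((q : ℝ) ^ 2 * supNorm (V'' P α X)
      * (V'' P α X ξstar ^ 4 / (4 * lipConst (V'' P α X) ^ 2)))

/-- `λ̄_q = inf_h λ̄_{h,q}`, the infimum running over all `h`, including `h = 0`. -/
def lamBar (P : Measure Ω) (α : ℝ) (X : ℕ → Ω → ℝ) (ξstar : ℕ → ℝ) (q : ℕ) : ℝ :=
  ⨅ K : ℕ, lamBarAt P α (X K) (ξstar K) q

/-- First order expansion of the cdfs:
`F_{X_h}(ξ) - F_{X_0}(ξ) = v(ξ) h + w(ξ, h) h`, with `v` integrable on `(ξ⋆, ∞)` and both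
`w(ξ⋆, h)` and `∫_{ξ⋆}^∞ w(ξ, h) dξ` tending to `0` as `h ↓ 0`, for every `ξ⋆ ∈ Argmin V_0`. -/
def CdfExpansion (P : Measure Ω) (α : ℝ) (X : ℕ → Ω → ℝ) : Prop :=
  ∃ (v : ℝ → ℝ) (w : ℝ → ℕ → ℝ),
    (∀ K : ℕ, 1 ≤ K → ∀ ξ : ℝ,
      cdf (P.map (X K)) ξ - cdf (P.map (X 0)) ξ = v ξ * (1 / (K : ℝ)) + w ξ K * (1 / (K : ℝ))) ∧
    ∀ ξ₀ ∈ argminV P α (X 0),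
      IntegrableOn v (Set.Ioi ξ₀) ∧
      Tendsto (fun K => w ξ₀ K) atTop (𝓝 0) ∧
      Tendsto (fun K => ∫ ξ in Set.Ioi ξ₀, w ξ K) atTop (𝓝 0)

/-- For every `h` (including `0`), `f_h` is a continuous pdf of `X_h`, and `f_h → f_0` locally
uniformly as `h ↓ 0`. -/
structure HasPdfs (P : Measure Ω) (X : ℕ → Ω → ℝ) (f : ℕ → ℝ → ℝ) : Prop where
  continuous : ∀ K, Continuous (f K)
  nonneg : ∀ K x, 0 ≤ f K x
  law : ∀ K, P.map (X K) = volume.withDensity (fun x => ENNReal.ofReal (f K x))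
  tendsto : TendstoLocallyUniformly f (f 0) atTop

/-- `inf_{h, ξ ∈ B(ξ₀, R)} f_h(ξ) > 0` for every `R > 0`, and
`sup_h (‖f_h‖_∞ + [f_h]_Lip) < ∞`, where `h = 0` is included. -/
structure PdfRegularity (f : ℕ → ℝ → ℝ) (ξ₀ : ℝ) : Prop where
  lower : ∀ R > 0, ∃ c > 0, ∀ K, ∀ ξ ∈ Metric.ball ξ₀ R, c ≤ f K ξ
  upper : ∃ M, ∀ K, (∀ x, |f K x| ≤ M) ∧ ∀ x y, |f K x - f K y| ≤ M * |x - y|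

/-- `sup_h 𝔼[W_h] < ∞` for nonnegative random variables `W_h`, where `h = 0` is included. -/
def UnifFiniteMean (P : Measure Ω) (W : ℕ → Ω → ℝ) : Prop :=
  ∃ C, ∀ K, Integrable (W K) P ∧ ∫ ω, W K ω ∂P ≤ C

end Problem

section Algorithm

/-- `H₁(ξ, x) = 1 - (1 - α)⁻¹ 1_{x ≥ ξ}`. -/
def H₁ (α ξ x : ℝ) : ℝ := 1 - 1 / (1 - α) * (Set.Ici ξ).indicator 1 x

/-- `H₂(ξ, χ, x) = χ - (ξ + (1 - α)⁻¹ (x - ξ)⁺)`. -/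
def H₂ (α ξ χ x : ℝ) : ℝ := χ - (ξ + 1 / (1 - α) * max (x - ξ) 0)

/-- The step sequence `γ_n = γ₁ n^{-β}`, `n ≥ 1`. -/
def step (γ₁ β : ℝ) (n : ℕ) : ℝ := γ₁ * (n : ℝ) ^ (-β)

/-- The stochastic approximation recursion for `(ξ_n, χ_n)` along a sequence of samples; the
`(n+1)`-st sample is `x n`. -/
def iter (α : ℝ) (γ : ℕ → ℝ) (init : ℝ × ℝ) (x : ℕ → ℝ) : ℕ → ℝ × ℝ
  | 0 => init
  | n + 1 =>
    let p := iter α γ init x n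
    (p.1 - γ (n + 1) * H₁ α p.1 (x n),
     p.2 - 1 / ((n : ℝ) + 1) * H₂ α p.1 p.2 (x n))

variable {Ω : Type*} [MeasurableSpace Ω]

/-- The random iterate `ξ^h_n` with `h = 1/K`; `Xs K n` is the sample `X_h^{(n+1)}`. -/
def xiIter (α : ℝ) (γ : ℕ → ℝ) (ξ₀ χ₀ : ℕ → Ω → ℝ) (Xs : ℕ → ℕ → Ω → ℝ) (K n : ℕ) (ω : Ω) : ℝ :=
  (iter α γ (ξ₀ K ω, χ₀ K ω) (fun m => Xs K m ω) n).1

/-- The random iterate `χ^h_n` with `h = 1/K`. -/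
def chiIter (α : ℝ) (γ : ℕ → ℝ) (ξ₀ χ₀ : ℕ → Ω → ℝ) (Xs : ℕ → ℕ → Ω → ℝ) (K n : ℕ) (ω : Ω) : ℝ :=
  (iter α γ (ξ₀ K ω, χ₀ K ω) (fun m => Xs K m ω) n).2

/-- For each `h = 1/K`, `K ≥ 1`, the samples are iid copies of `X_h`, and the initial vector is a
random vector independent of the samples. -/
structure IsSampling (P : Measure Ω) (X : ℕ → Ω → ℝ) (ξ₀ χ₀ : ℕ → Ω → ℝ)
    (Xs : ℕ → ℕ → Ω → ℝ) : Prop where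
  measurable_ξ₀ : ∀ K, Measurable (ξ₀ K)
  measurable_χ₀ : ∀ K, Measurable (χ₀ K)
  measurable_Xs : ∀ K, 1 ≤ K → ∀ n, Measurable (Xs K n)
  iIndep_Xs : ∀ K, 1 ≤ K → iIndepFun (Xs K) P
  copies_Xs : ∀ K, 1 ≤ K → ∀ n, IdentDistrib (Xs K n) (X K) P P
  indep_init : ∀ K, 1 ≤ K → IndepFun (fun ω => (ξ₀ K ω, χ₀ K ω)) (fun ω n => Xs K n ω) P

/-- There are constants `C_h`, `h = 1/K`, with `sup_h C_h < ∞`, such that `W_{h,n}` is integrable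
and `𝔼[W_{h,n}] ≤ C_h r_n` for all `K ≥ 1` and `n ≥ 1`. -/
def UnifRate (P : Measure Ω) (W : ℕ → ℕ → Ω → ℝ) (r : ℕ → ℝ) : Prop :=
  ∃ C : ℕ → ℝ, BddAbove (C '' Set.Ici 1) ∧
    ∀ K, 1 ≤ K → ∀ n, 1 ≤ n → Integrable (W K n) P ∧ ∫ ω, W K n ω ∂P ≤ C K * r n

end Algorithm

end NestedSA

end

open NestedSA

open NestedSA

noncomputable section

namespace NestedSA

/-! ### Convex profiles: two-sided control of a function by its second derivative. -/

section Profile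

/-! Write `v = V_h - min V_h` and `g = V_h'`. The iterate `ξ` is stochastic gradient descent on `v`:
the direction `H₁` is bounded and has mean `g`. One would like `λ v ≤ g²`, but `v` grows linearly
while `g` stays bounded, so this fails far from the minimizer. The remedy is the Lyapunov function
`L = v^q exp(μ v)` with `μ = q² M / (1 - α)`. Its derivative times `g` is at least `λ L` as soon as
`λ v ≤ g² (q + μ v)`, and this weaker inequality holds globally (`IsProfile.drift`): near the
minimizer the quadratic lower bound on `g` gives it, farther away monotonicity of `g` does. The two
regimes give the two terms of `λ̄_q`.

A Taylor estimate of `L` along one step (`lyap_step`), averaged using independence of the new sample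
from the past (`lyap_moment_step`), yields `a_{n+1} ≤ (1 - λ γ + C γ²) a_n + C γ^{q+1}` for `a_n =
𝔼[L(ξ_n)]`. Hence `a_n = O(γ_n^q)` (`StepRec.rate`). For `β < 1` any `λ > 0` suffices; for `β = 1`
the decay must beat that of `γ_n^q`, which is the condition `q < λ̄_q γ₁`. Since `(ξ - ξ⋆)² ≤ c₁ v +
c₂ v²` and the exponential absorbs additional powers of `v`, this bounds the moments of order `2q`
of the error.

The step `1/(n+1)` makes `χ_n` the plain average of `n` samples of `V`. Its error is a martingale of
variance `O(n)` divided by `n`, plus the average of `V(ξ_i) - χ⋆`, already controlled by `a_i`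
(`chi_rate_one`, `chi_rate_two`).

Uniformity in `h` comes from fixing every constant before the problem is chosen. The cdf expansion
and the lower bound on the densities keep the minimizers in a bounded set
(`exists_abs_argmin_sub_lt`), where the densities are bounded below by one constant. -/

/-- Derivative inequalities below are integrated by applying this to the difference of the two
sides. -/
lemma le_of_hasDerivAt_nonneg {ψ ψ' : ℝ → ℝ} {x y : ℝ} (hψ : ∀ z, HasDerivAt ψ (ψ' z) z)
    (hxy : x ≤ y) (h : ∀ z, x < z → z < y → 0 ≤ ψ' z) : ψ x ≤ ψ y := by
  rcases hxy.eq_or_lt with rfl | hlt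
  · exact le_rfl
  obtain ⟨z, hz, hz'⟩ := exists_hasDerivAt_eq_slope ψ ψ' hlt
    (fun z _ => (hψ z).continuousAt.continuousWithinAt) (fun z _ => hψ z)
  have h0 := h z hz.1 hz.2
  rw [hz', le_div_iff₀ (sub_pos.2 hlt)] at h0
  linarith

/-- A nonnegative function `v` with bounded first derivative `g` and second derivative `h`, with
`0 ≤ h ≤ B` and `|g| ≤ k`, vanishing to first order at `c`. -/
structure IsProfile (v g h : ℝ → ℝ) (c B k : ℝ) : Prop where
  deriv_v : ∀ x, HasDerivAt v (g x) x
  deriv_g : ∀ x, HasDerivAt g (h x) x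
  v_nonneg : ∀ x, 0 ≤ v x
  v_min : v c = 0
  g_min : g c = 0
  h_nonneg : ∀ x, 0 ≤ h x
  h_le : ∀ x, h x ≤ B
  g_le : ∀ x, |g x| ≤ k

namespace IsProfile

variable {v g h : ℝ → ℝ} {c B k : ℝ}

/-- Lets each estimate be proved only to the right of `c`. -/
lemma reflect (hp : IsProfile v g h c B k) :
    IsProfile (fun x => v (-x)) (fun x => -g (-x)) (fun x => h (-x)) (-c) B k where
  deriv_v x := ((hp.deriv_v (-x)).comp x (hasDerivAt_neg x)).congr_deriv (by ring)
  deriv_g x := ((hp.deriv_g (-x)).comp x (hasDerivAt_neg x)).neg.congr_deriv (by ring)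
  v_nonneg x := hp.v_nonneg _
  v_min := by simp [hp.v_min]
  g_min := by simp [hp.g_min]
  h_nonneg x := hp.h_nonneg _
  h_le x := hp.h_le _
  g_le x := by simpa using hp.g_le (-x)

lemma B_nonneg (hp : IsProfile v g h c B k) : 0 ≤ B := (hp.h_nonneg 0).trans (hp.h_le 0)

lemma k_nonneg (hp : IsProfile v g h c B k) : 0 ≤ k := (abs_nonneg _).trans (hp.g_le 0)

lemma monotone_g (hp : IsProfile v g h c B k) : Monotone g := fun _ _ hxy =>
  le_of_hasDerivAt_nonneg hp.deriv_g hxy fun z _ _ => hp.h_nonneg z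

lemma g_sub_le (hp : IsProfile v g h c B k) {x y : ℝ} (hxy : x ≤ y) :
    g y - g x ≤ B * (y - x) := by
  have := le_of_hasDerivAt_nonneg (ψ := fun z => B * z - g z) (ψ' := fun z => B * 1 - h z)
    (fun z => ((hasDerivAt_id z).const_mul B).sub (hp.deriv_g z)) hxy
    (fun z _ _ => by linarith [hp.h_le z])
  beta_reduce at this
  linarith

lemma descent_right (hp : IsProfile v g h c B k) {x y : ℝ} (hxy : x ≤ y) :
    v y ≤ v x + g x * (y - x) + B / 2 * (y - x) ^ 2 := by
  have := le_of_hasDerivAt_nonneg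
    (ψ := fun z => g x * (z - x) + B / 2 * (z - x) ^ 2 - v z)
    (ψ' := fun z => g x + B * (z - x) - g z)
    (fun z => by
      have h1 : HasDerivAt (fun z => z - x) 1 z := (hasDerivAt_id z).sub_const x
      exact HasDerivAt.congr_deriv
        (((h1.const_mul (g x)).add ((h1.pow 2).const_mul (B / 2))).sub (hp.deriv_v z))
        (by push_cast; ring)) hxy
    (fun z hz _ => by linarith [hp.g_sub_le hz.le])
  simp only [sub_self] at this
  linarith

lemma descent (hp : IsProfile v g h c B k) (x y : ℝ) :
    v y ≤ v x + g x * (y - x) + B / 2 * (y - x) ^ 2 := by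
  rcases le_total x y with hxy | hxy
  · exact hp.descent_right hxy
  · have := hp.reflect.descent_right (neg_le_neg hxy)
    simp only [neg_neg] at this
    linarith

/-- The gradient step `x - g x / B` minimizes the quadratic upper bound of `descent`; the value
reached there cannot be negative. -/
lemma sq_g_le (hp : IsProfile v g h c B k) (hB : 0 < B) (x : ℝ) : g x ^ 2 ≤ 2 * B * v x := by
  have h1 := hp.descent x (x - g x / B)
  have h2 := hp.v_nonneg (x - g x / B)
  have h3 : v x + g x * (x - g x / B - x) + B / 2 * (x - g x / B - x) ^ 2
      = v x - g x ^ 2 / (2 * B) := by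
    field_simp
    ring
  rw [h3] at h1
  have h4 : g x ^ 2 / (2 * B) ≤ v x := by linarith
  rw [div_le_iff₀ (by positivity)] at h4
  linarith

lemma v_le (hp : IsProfile v g h c B k) (x : ℝ) : v x ≤ k * |x - c| := by
  have hk : LipschitzWith ⟨k, hp.k_nonneg⟩ v :=
    lipschitzWith_of_nnnorm_deriv_le (fun x => (hp.deriv_v x).differentiableAt)
      (fun x => by
        rw [(hp.deriv_v x).deriv]
        exact hp.g_le x)
  have := hk.dist_le_mul x c
  rw [Real.dist_eq, Real.dist_eq, hp.v_min, sub_zero] at this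
  exact (le_abs_self _).trans this

section Local

variable {a l : ℝ}

/-- The second derivative stays within `l (z - c)` of `a`; integrating once and twice from `c`,
where `g` and `v` vanish, gives the three bounds. -/
lemma local_bounds (hp : IsProfile v g h c B k) (ha : h c = a)
    (hl : ∀ x, |h x - h c| ≤ l * |x - c|) {x : ℝ} (hx : c ≤ x) :
    a * (x - c) - l / 2 * (x - c) ^ 2 ≤ g x ∧
    v x ≤ a / 2 * (x - c) ^ 2 + l / 6 * (x - c) ^ 3 ∧
    a / 2 * (x - c) ^ 2 - l / 6 * (x - c) ^ 3 ≤ v x := by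
  have h1 : ∀ z, HasDerivAt (fun z => z - c) 1 z := fun z => (hasDerivAt_id z).sub_const c
  have hh : ∀ z, c ≤ z → a - l * (z - c) ≤ h z ∧ h z ≤ a + l * (z - c) := fun z hz => by
    have := abs_le.1 (hl z)
    rw [abs_of_nonneg (sub_nonneg.2 hz), ha] at this
    constructor <;> linarith
  have hg : ∀ z, c ≤ z → a * (z - c) - l / 2 * (z - c) ^ 2 ≤ g z := fun z hz => by
    have := le_of_hasDerivAt_nonneg
      (ψ := fun z => g z - (a * (z - c) - l / 2 * (z - c) ^ 2))
      (ψ' := fun z => h z - (a - l * (z - c)))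
      (fun z => by
        exact HasDerivAt.congr_deriv
          ((hp.deriv_g z).sub (((h1 z).const_mul a).sub (((h1 z).pow 2).const_mul (l / 2))))
          (by push_cast; ring)) hz
      (fun z hz _ => by linarith [(hh z hz.le).1])
    simp only [sub_self, hp.g_min] at this
    linarith
  have hg' : ∀ z, c ≤ z → g z ≤ a * (z - c) + l / 2 * (z - c) ^ 2 := fun z hz => by
    have := le_of_hasDerivAt_nonneg
      (ψ := fun z => (a * (z - c) + l / 2 * (z - c) ^ 2) - g z)
      (ψ' := fun z => (a + l * (z - c)) - h z)
      (fun z => by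
        exact HasDerivAt.congr_deriv
          ((((h1 z).const_mul a).add (((h1 z).pow 2).const_mul (l / 2))).sub (hp.deriv_g z))
          (by push_cast; ring)) hz
      (fun z hz _ => by linarith [(hh z hz.le).2])
    simp only [sub_self, hp.g_min] at this
    linarith
  refine ⟨hg x hx, ?_, ?_⟩
  · have := le_of_hasDerivAt_nonneg
      (ψ := fun z => (a / 2 * (z - c) ^ 2 + l / 6 * (z - c) ^ 3) - v z)
      (ψ' := fun z => (a * (z - c) + l / 2 * (z - c) ^ 2) - g z)
      (fun z => by
        exact HasDerivAt.congr_deriv (((((h1 z).pow 2).const_mul (a / 2)).add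
          (((h1 z).pow 3).const_mul (l / 6))).sub (hp.deriv_v z))
          (by push_cast; ring)) hx
      (fun z hz _ => by linarith [hg' z hz.le])
    simp only [sub_self, hp.v_min] at this
    linarith
  · have := le_of_hasDerivAt_nonneg
      (ψ := fun z => v z - (a / 2 * (z - c) ^ 2 - l / 6 * (z - c) ^ 3))
      (ψ' := fun z => g z - (a * (z - c) - l / 2 * (z - c) ^ 2))
      (fun z => by
        exact HasDerivAt.congr_deriv ((hp.deriv_v z).sub ((((h1 z).pow 2).const_mul (a / 2)).sub
          (((h1 z).pow 3).const_mul (l / 6))))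
          (by push_cast; ring)) hx
      (fun z hz _ => by linarith [hg z hz.le])
    simp only [sub_self, hp.v_min] at this
    linarith

/-- The line is split at distance `a / l` from `c`. Nearer, `g ≥ a t / 2` and `v ≤ (2/3) a t²`, so
`g² ≥ (3/8) a v` and the term `q g²` suffices. Farther, `g ≥ a² / (2 l)`, so the term `μ g² v`
suffices. -/
lemma drift_right (hp : IsProfile v g h c B k) (ha : h c = a) (ha0 : 0 < a) (hl0 : 0 < l)
    (hl : ∀ x, |h x - h c| ≤ l * |x - c|) {q μ lam : ℝ} (hq : 0 ≤ q) (hμ : 0 ≤ μ)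
    (h1 : lam ≤ 3 / 8 * q * a) (h2 : lam ≤ μ * (a ^ 4 / (4 * l ^ 2))) {x : ℝ} (hx : c ≤ x) :
    lam * v x ≤ g x ^ 2 * (q + μ * v x) := by
  have hv := hp.v_nonneg x
  rcases le_total (l * (x - c)) a with hs | hs
  · obtain ⟨b1, b2, -⟩ := hp.local_bounds ha hl hx
    set t := x - c with ht
    have ht0 : 0 ≤ t := sub_nonneg.2 hx
    have hg : a / 2 * t ≤ g x := by nlinarith
    have hv3 : v x ≤ t ^ 2 * (2 / 3 * a) := by nlinarith [mul_nonneg (sq_nonneg t) (sub_nonneg.2 hs)]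
    have key : 3 / 8 * a * v x ≤ g x ^ 2 := by
      have : (a / 2 * t) ^ 2 ≤ g x ^ 2 := pow_le_pow_left₀ (by positivity) hg 2
      nlinarith
    have := mul_le_mul_of_nonneg_left key hq
    have h3 : lam * v x ≤ 3 / 8 * q * a * v x := mul_le_mul_of_nonneg_right h1 hv
    have h4 : 0 ≤ g x ^ 2 * (μ * v x) := by positivity
    linarith
  -- The lower bound `a t - l t² / 2` for `g` is largest at `t = a / l`, with value `a² / (2 l)`;
  -- monotonicity of `g` carries it to `x`.
  · have hr : c ≤ c + a / l := by linarith [div_pos ha0 hl0]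
    obtain ⟨b1, -, -⟩ := hp.local_bounds ha hl hr
    have hxr : c + a / l ≤ x := by
      have : a / l ≤ x - c := by rw [div_le_iff₀ hl0]; linarith
      linarith
    have hg : a ^ 2 / (2 * l) ≤ g x := by
      refine le_trans (le_trans (le_of_eq ?_) b1) (hp.monotone_g hxr)
      field_simp
      ring
    have hg2 : a ^ 4 / (4 * l ^ 2) ≤ g x ^ 2 := by
      have := pow_le_pow_left₀ (by positivity) hg 2
      refine le_trans (le_of_eq ?_) this
      field_simp
      ring
    have h3 : μ * (a ^ 4 / (4 * l ^ 2)) ≤ μ * g x ^ 2 := mul_le_mul_of_nonneg_left hg2 hμ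
    have h4 : lam * v x ≤ μ * g x ^ 2 * v x := mul_le_mul_of_nonneg_right (h2.trans h3) hv
    have h5 : 0 ≤ g x ^ 2 * q := by positivity
    linarith

lemma reflect_lip {l : ℝ} (hl : ∀ x, |h x - h c| ≤ l * |x - c|) (x : ℝ) :
    |h (-x) - h (- -c)| ≤ l * |x - -c| := by
  have := hl (-x)
  rw [show -x - c = -(x + c) by ring, abs_neg] at this
  simpa using this

lemma drift (hp : IsProfile v g h c B k) (ha : h c = a) (ha0 : 0 < a) (hl0 : 0 < l)
    (hl : ∀ x, |h x - h c| ≤ l * |x - c|) {q μ lam : ℝ} (hq : 0 ≤ q) (hμ : 0 ≤ μ)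
    (h1 : lam ≤ 3 / 8 * q * a) (h2 : lam ≤ μ * (a ^ 4 / (4 * l ^ 2))) (x : ℝ) :
    lam * v x ≤ g x ^ 2 * (q + μ * v x) := by
  rcases le_total c x with hx | hx
  · exact hp.drift_right ha ha0 hl0 hl hq hμ h1 h2 hx
  · simpa using hp.reflect.drift_right (by simpa using ha) ha0 hl0 (reflect_lip hl) hq hμ h1 h2
      (neg_le_neg hx)

/-- Within distance `a / l`, `v ≥ (a/3) t²`; beyond it, `v` has slope at least `a² / (2 l)`, so `v ≥
a² t / (3 l)`. The sum on the right covers both regimes. -/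
lemma sq_le_right (hp : IsProfile v g h c B k) (ha : h c = a) (ha0 : 0 < a) (hl0 : 0 < l)
    (hl : ∀ x, |h x - h c| ≤ l * |x - c|) {x : ℝ} (hx : c ≤ x) :
    (x - c) ^ 2 ≤ 3 / a * v x + (3 * l / a ^ 2 * v x) ^ 2 := by
  have hv := hp.v_nonneg x
  rcases le_total (l * (x - c)) a with hs | hs
  · obtain ⟨-, -, b3⟩ := hp.local_bounds ha hl hx
    set t := x - c with ht
    have hv3 : a / 3 * t ^ 2 ≤ v x := by nlinarith [mul_nonneg (sq_nonneg t) (sub_nonneg.2 hs)]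
    have h6 : t ^ 2 ≤ 3 / a * v x := by
      rw [div_mul_eq_mul_div, le_div_iff₀ ha0]
      linarith
    linarith [sq_nonneg (3 * l / a ^ 2 * v x)]
  · have hr : c ≤ c + a / l := by linarith [div_pos ha0 hl0]
    obtain ⟨b1, -, b3⟩ := hp.local_bounds ha hl hr
    have hxr : c + a / l ≤ x := by
      have : a / l ≤ x - c := by rw [div_le_iff₀ hl0]; linarith
      linarith
    set r := c + a / l with hrdef
    have hrc : r - c = a / l := by simp [hrdef]
    have hgr : a ^ 2 / (2 * l) ≤ g r := by
      refine le_trans (le_of_eq ?_) b1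
      rw [hrc]
      field_simp
      ring
    have hvr : a ^ 3 / (3 * l ^ 2) ≤ v r := by
      refine le_trans (le_of_eq ?_) b3
      rw [hrc]
      field_simp
      ring
    have hvx : v r + a ^ 2 / (2 * l) * (x - r) ≤ v x := by
      have := le_of_hasDerivAt_nonneg
        (ψ := fun z => v z - a ^ 2 / (2 * l) * z) (ψ' := fun z => g z - a ^ 2 / (2 * l) * 1)
        (fun z => (hp.deriv_v z).sub ((hasDerivAt_id z).const_mul _)) hxr
        (fun z hz _ => by linarith [hp.monotone_g hz.le])
      beta_reduce at this
      linarith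
    have h7 : a ^ 2 / (3 * l) * (x - c) ≤ v x := by
      have e1 : a ^ 3 / (3 * l ^ 2) = a ^ 2 / (3 * l) * (r - c) := by
        rw [hrc]
        field_simp
      have e2 : a ^ 2 / (3 * l) * (x - r) ≤ a ^ 2 / (2 * l) * (x - r) := by
        apply mul_le_mul_of_nonneg_right _ (sub_nonneg.2 hxr)
        apply div_le_div_of_nonneg_left (by positivity) (by positivity)
        linarith
      have e3 : a ^ 2 / (3 * l) * (x - c)
        = a ^ 2 / (3 * l) * (r - c) + a ^ 2 / (3 * l) * (x - r) := by ring
      linarith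
    have h8 : x - c ≤ 3 * l / a ^ 2 * v x := by
      rw [div_mul_eq_mul_div, le_div_iff₀ (by positivity)]
      rw [div_mul_eq_mul_div, div_le_iff₀ (by positivity)] at h7
      linarith
    have h9 := pow_le_pow_left₀ (sub_nonneg.2 hx) h8 2
    have : 0 ≤ 3 / a * v x := by positivity
    linarith

lemma sq_le (hp : IsProfile v g h c B k) (ha : h c = a) (ha0 : 0 < a) (hl0 : 0 < l)
    (hl : ∀ x, |h x - h c| ≤ l * |x - c|) (x : ℝ) :
    (x - c) ^ 2 ≤ 3 / a * v x + (3 * l / a ^ 2 * v x) ^ 2 := by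
  rcases le_total c x with hx | hx
  · exact hp.sq_le_right ha ha0 hl0 hl hx
  · have := hp.reflect.sq_le_right (by simpa using ha) ha0 hl0 (reflect_lip hl) (neg_le_neg hx)
    rw [show -x - -c = -(x - c) by ring, neg_sq] at this
    simpa using this

end Local

end IsProfile

end Profile

/-! ### One-step inequality for the Lyapunov function `v^q exp(μ v)`. -/

section Lyapunov

lemma exp_le_quadratic {y D : ℝ} (hy : |y| ≤ D) :
    Real.exp y ≤ 1 + y + Real.exp D * y ^ 2 := by
  have h := Complex.norm_exp_sub_sum_le_norm_mul_exp (y : ℂ) 2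
  have h2 : Complex.exp (y : ℂ) - ∑ m ∈ Finset.range 2, (y : ℂ) ^ m / (m.factorial : ℂ)
      = ((Real.exp y - (1 + y) : ℝ) : ℂ) := by
    simp [Finset.sum_range_succ]
  rw [h2, Complex.norm_real, Complex.norm_real, Real.norm_eq_abs, Real.norm_eq_abs, sq_abs] at h
  have h3 := (le_abs_self _).trans h
  have h4 : y ^ 2 * Real.exp |y| ≤ y ^ 2 * Real.exp D :=
    mul_le_mul_of_nonneg_left (Real.exp_le_exp.2 hy) (sq_nonneg y)
  linarith

/-- The Lyapunov function `v^q exp(μ v)`. -/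
def lyap (v : ℝ → ℝ) (q : ℕ) (μ x : ℝ) : ℝ := v x ^ q * Real.exp (μ * v x)

/-- The derivative `(q v^(q-1) + μ v^q) exp(μ v) g` of the Lyapunov function. -/
def lyapDeriv (v g : ℝ → ℝ) (q : ℕ) (μ x : ℝ) : ℝ :=
  (q * v x ^ (q - 1) + μ * v x ^ q) * Real.exp (μ * v x) * g x

/-- Monotonicity of `w exp(μ w)` replaces `w` by `v + δ`, then the exponential is expanded to second
order. The first-order term keeps its exact coefficient, since its mean is what produces the drift.
-/
lemma mul_exp_le {v w δ D μ : ℝ} (hv : 0 ≤ v) (hw : 0 ≤ w) (hwv : w ≤ v + δ) (hδ : |δ| ≤ D)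
    (hμ : 0 ≤ μ) :
    w * Real.exp (μ * w) ≤ Real.exp (μ * v) * (v + (1 + μ * v) * δ
      + (μ + Real.exp (μ * D) * μ ^ 2 * (D + 1)) * ((1 + v) * δ ^ 2)) := by
  have hD : 0 ≤ D := (abs_nonneg _).trans hδ
  set K := Real.exp (μ * D) * μ ^ 2 with hK
  have hK0 : 0 ≤ K := by positivity
  have he : Real.exp (μ * δ) ≤ 1 + μ * δ + K * δ ^ 2 := by
    have := exp_le_quadratic (y := μ * δ) (D := μ * D)
      (by rw [abs_mul, abs_of_nonneg hμ]; exact mul_le_mul_of_nonneg_left hδ hμ)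
    linarith [this, show Real.exp (μ * D) * (μ * δ) ^ 2 = K * δ ^ 2 by rw [hK]; ring]
  have h1 : w * Real.exp (μ * w) ≤ (v + δ) * Real.exp (μ * (v + δ)) := by
    apply mul_le_mul hwv _ (Real.exp_pos _).le (hw.trans hwv)
    exact Real.exp_le_exp.2 (mul_le_mul_of_nonneg_left hwv hμ)
  rw [mul_add, Real.exp_add] at h1
  refine h1.trans ?_
  rw [show (v + δ) * (Real.exp (μ * v) * Real.exp (μ * δ))
    = Real.exp (μ * v) * ((v + δ) * Real.exp (μ * δ)) by ring]
  apply mul_le_mul_of_nonneg_left _ (Real.exp_pos _).le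
  refine (mul_le_mul_of_nonneg_left he (hw.trans hwv)).trans ?_
  have h2 : K * (v + δ) ≤ K * (D + 1) * (1 + v) := by
    rw [mul_assoc K]
    apply mul_le_mul_of_nonneg_left _ hK0
    nlinarith [le_of_abs_le hδ, mul_nonneg hD hv]
  have h3 : μ + K * (v + δ) ≤ (μ + K * (D + 1)) * (1 + v) := by nlinarith [mul_nonneg hμ hv]
  nlinarith [mul_le_mul_of_nonneg_right h3 (sq_nonneg δ)]

lemma sq_mul_exp_le {v w δ D μ : ℝ} (hw : 0 ≤ w) (hwv : w ≤ v + δ) (hδ : |δ| ≤ D)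
    (hμ : 0 ≤ μ) :
    w ^ 2 * Real.exp (μ * w) ≤ Real.exp (μ * v) * (v ^ 2 + (2 * v + μ * v ^ 2) * δ
      + (1 + 2 * μ + μ * D + 2 * (Real.exp (μ * D) * μ ^ 2) * (D ^ 2 + 1))
        * ((1 + v ^ 2) * δ ^ 2)) := by
  have hD : 0 ≤ D := (abs_nonneg _).trans hδ
  set K := Real.exp (μ * D) * μ ^ 2 with hK
  have hK0 : 0 ≤ K := by positivity
  have he : Real.exp (μ * δ) ≤ 1 + μ * δ + K * δ ^ 2 := by
    have := exp_le_quadratic (y := μ * δ) (D := μ * D)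
      (by rw [abs_mul, abs_of_nonneg hμ]; exact mul_le_mul_of_nonneg_left hδ hμ)
    linarith [this, show Real.exp (μ * D) * (μ * δ) ^ 2 = K * δ ^ 2 by rw [hK]; ring]
  have h1 : w ^ 2 * Real.exp (μ * w) ≤ (v + δ) ^ 2 * Real.exp (μ * (v + δ)) := by
    apply mul_le_mul (pow_le_pow_left₀ hw hwv 2) _ (Real.exp_pos _).le (sq_nonneg _)
    exact Real.exp_le_exp.2 (mul_le_mul_of_nonneg_left hwv hμ)
  rw [mul_add, Real.exp_add] at h1
  refine h1.trans ?_
  rw [show (v + δ) ^ 2 * (Real.exp (μ * v) * Real.exp (μ * δ))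
    = Real.exp (μ * v) * ((v + δ) ^ 2 * Real.exp (μ * δ)) by ring]
  apply mul_le_mul_of_nonneg_left _ (Real.exp_pos _).le
  refine (mul_le_mul_of_nonneg_left he (sq_nonneg _)).trans ?_
  have hδ2 : δ ^ 2 ≤ D ^ 2 := sq_le_sq' (abs_le.1 hδ).1 (abs_le.1 hδ).2
  have h2 : K * (v + δ) ^ 2 ≤ 2 * K * (D ^ 2 + 1) * (1 + v ^ 2) := by
    rw [show 2 * K * (D ^ 2 + 1) * (1 + v ^ 2) = K * (2 * (D ^ 2 + 1) * (1 + v ^ 2)) by ring]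
    apply mul_le_mul_of_nonneg_left _ hK0
    nlinarith [sq_nonneg (v - δ), mul_nonneg (sq_nonneg D) (sq_nonneg v)]
  have h4 : μ * (2 * v) ≤ μ * (1 + v ^ 2) :=
    mul_le_mul_of_nonneg_left (by nlinarith [sq_nonneg (v - 1)]) hμ
  have h5 : μ * δ ≤ μ * D := mul_le_mul_of_nonneg_left (le_of_abs_le hδ) hμ
  have h3 : 1 + 2 * μ * v + μ * δ + K * (v + δ) ^ 2
      ≤ (1 + 2 * μ + μ * D + 2 * K * (D ^ 2 + 1)) * (1 + v ^ 2) := by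
    nlinarith [mul_nonneg hμ (sq_nonneg v), mul_nonneg (mul_nonneg hμ hD) (sq_nonneg v),
      sq_nonneg v]
  nlinarith [mul_le_mul_of_nonneg_right h3 (sq_nonneg δ)]

/-- Converts an exponential without a factor `v^q` into a constant plus the Lyapunov function. -/
lemma exp_le_add_pow_mul_exp {v μ : ℝ} (hv : 0 ≤ v) (hμ : 0 ≤ μ) (q : ℕ) :
    Real.exp (μ * v) ≤ Real.exp μ + v ^ q * Real.exp (μ * v) := by
  rcases le_total v 1 with h | h
  · have : Real.exp (μ * v) ≤ Real.exp μ := Real.exp_le_exp.2 (by nlinarith)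
    have : 0 ≤ v ^ q * Real.exp (μ * v) := by positivity
    linarith
  · have : 1 * Real.exp (μ * v) ≤ v ^ q * Real.exp (μ * v) :=
      mul_le_mul_of_nonneg_right (one_le_pow₀ h) (Real.exp_pos _).le
    linarith [Real.exp_pos μ]

lemma sq_step_le {B k y H γ : ℝ} (hH : |H| ≤ k) :
    (-(γ * H * y) + B * k ^ 2 / 2 * γ ^ 2) ^ 2
      ≤ 2 * γ ^ 2 * k ^ 2 * y ^ 2 + B ^ 2 * k ^ 4 * γ ^ 4 := by
  have h2 : H ^ 2 ≤ k ^ 2 := sq_le_sq' (abs_le.1 hH).1 (abs_le.1 hH).2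
  have h3 := mul_le_mul_of_nonneg_left h2 (sq_nonneg (γ * y))
  nlinarith [sq_nonneg (-(γ * H * y) - B * k ^ 2 / 2 * γ ^ 2), sq_nonneg (B * k ^ 2 * γ ^ 2)]

/-- The bound `y² ≤ 2 B u` makes the `γ²` part vanish with `u`. This is what allows a residual of
order `γ³`, rather than `γ²`, when `q = 2`. -/
lemma one_add_sq_mul_sq_step_le {B k y H γ u : ℝ} (hB : 0 ≤ B) (hu : 0 ≤ u) (hH : |H| ≤ k)
    (hy : |y| ≤ k) (hyu : y ^ 2 ≤ 2 * B * u) :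
    (1 + u ^ 2) * (-(γ * H * y) + B * k ^ 2 / 2 * γ ^ 2) ^ 2
      ≤ 2 * k ^ 2 * (2 * B + k ^ 2) * (γ ^ 2 * (u + u ^ 2))
        + B ^ 2 * k ^ 4 * (γ ^ 4 * (1 + u ^ 2)) := by
  have e0 := mul_le_mul_of_nonneg_left (sq_step_le hH (B := B) (y := y) (γ := γ))
    (by positivity : 0 ≤ 1 + u ^ 2)
  have e1 : y ^ 2 ≤ k ^ 2 := sq_le_sq' (abs_le.1 hy).1 (abs_le.1 hy).2
  have e3 : y ^ 2 * (1 + u ^ 2) ≤ (2 * B + k ^ 2) * (u + u ^ 2) := by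
    linarith [mul_le_mul_of_nonneg_right e1 (sq_nonneg u),
      mul_nonneg hB (sq_nonneg u), mul_nonneg (sq_nonneg k) hu]
  have e4 := mul_le_mul_of_nonneg_left e3 (by positivity : 0 ≤ 2 * γ ^ 2 * k ^ 2)
  refine e0.trans ?_
  linarith

/-- The deterministic part of the one-step bound for `v² exp(μ v)`, with `δ = -m + κ γ²`. -/
lemma two_step_bound {u m κ μ γ Γ ε C₁ A A' s δ : ℝ} (hu : 0 ≤ u) (hμ : 0 ≤ μ) (hκ : 0 ≤ κ)
    (hγ : 0 ≤ γ) (hγΓ : γ ≤ Γ) (hε : 0 < ε) (hC₁ : 0 ≤ C₁) (hA : 0 ≤ A) (hA' : 0 ≤ A')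
    (hδ : δ = -m + κ * γ ^ 2)
    (hs : s ≤ A * (γ ^ 2 * (u + u ^ 2)) + A' * (γ ^ 4 * (1 + u ^ 2))) (C : ℝ)
    (hC : C = κ * (2 + μ) + C₁ * A + C₁ * A') :
    u ^ 2 + (2 * u + μ * u ^ 2) * δ + C₁ * s
      ≤ u ^ 2 - m * (2 * u + μ * u ^ 2) + ε * γ * u ^ 2
        + (C + C * Γ ^ 2) * γ ^ 2 * u ^ 2 + (C ^ 2 / ε + C * Γ) * γ ^ 3 := by
  have hC0 : 0 ≤ C := by rw [hC]; positivity
  have h1 : 0 ≤ γ ^ 2 * (u + u ^ 2) := by positivity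
  have h2 : 0 ≤ γ ^ 4 * (1 + u ^ 2) := by positivity
  have h3 : (2 * u + μ * u ^ 2) * (κ * γ ^ 2) ≤ κ * (2 + μ) * (γ ^ 2 * (u + u ^ 2)) := by
    have : 2 * u + μ * u ^ 2 ≤ (2 + μ) * (u + u ^ 2) := by
      linarith [mul_nonneg hμ hu, sq_nonneg u]
    have := mul_le_mul_of_nonneg_right this (by positivity : 0 ≤ κ * γ ^ 2)
    linarith
  have h4 : C₁ * s ≤ C₁ * A * (γ ^ 2 * (u + u ^ 2)) + C₁ * A' * (γ ^ 4 * (1 + u ^ 2)) := by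
    have := mul_le_mul_of_nonneg_left hs hC₁
    linarith
  have e1 : C₁ * A + κ * (2 + μ) ≤ C := by
    rw [hC]
    linarith [mul_nonneg hC₁ hA']
  have e2 : C₁ * A' ≤ C := by
    rw [hC]
    linarith [mul_nonneg hC₁ hA, show 0 ≤ κ * (2 + μ) by positivity]
  have e3 := mul_le_mul_of_nonneg_right e1 h1
  have e4 := mul_le_mul_of_nonneg_right e2 h2
  have h5 : (2 * u + μ * u ^ 2) * (κ * γ ^ 2) + C₁ * s
      ≤ C * (γ ^ 2 * (u + u ^ 2)) + C * (γ ^ 4 * (1 + u ^ 2)) := by linarith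
  -- Young's inequality: the term linear in `u` is traded for a small multiple of `γ u²` and a
  -- residual `γ³`. This is the origin of `ε`.
  have h6 : C * (γ ^ 2 * u) ≤ ε * γ * u ^ 2 + C ^ 2 / ε * γ ^ 3 := by
    have e1 : 0 ≤ γ / ε * ((ε * u - C * γ) ^ 2 + ε * u * (C * γ)) := by positivity
    have e2 : γ / ε * ((ε * u - C * γ) ^ 2 + ε * u * (C * γ))
        = ε * γ * u ^ 2 + C ^ 2 / ε * γ ^ 3 - C * (γ ^ 2 * u) := by
      field_simp
      ring
    linarith
  have h7 : C * γ ^ 4 ≤ C * Γ * γ ^ 3 := by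
    have := mul_le_mul_of_nonneg_left hγΓ (by positivity : 0 ≤ C * γ ^ 3)
    linarith
  have h8 : C * (γ ^ 4 * u ^ 2) ≤ C * Γ ^ 2 * γ ^ 2 * u ^ 2 := by
    have := mul_le_mul_of_nonneg_left (pow_le_pow_left₀ hγ hγΓ 2)
      (by positivity : 0 ≤ C * γ ^ 2 * u ^ 2)
    linarith
  have h9 : (2 * u + μ * u ^ 2) * δ
      = -(m * (2 * u + μ * u ^ 2)) + (2 * u + μ * u ^ 2) * (κ * γ ^ 2) := by
    rw [hδ]
    ring
  rw [h9]
  linarith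

variable {v g h : ℝ → ℝ} {c B k : ℝ}

namespace IsProfile

/-- The increment bound `-γ H g + (B k² / 2) γ²`. -/
lemma v_step (hp : IsProfile v g h c B k) {x H γ : ℝ} (hH : |H| ≤ k) :
    v (x - γ * H) ≤ v x + (-(γ * H * g x) + B * k ^ 2 / 2 * γ ^ 2) := by
  have h1 := hp.descent x (x - γ * H)
  have h2 : H ^ 2 ≤ k ^ 2 := sq_le_sq' (abs_le.1 hH).1 (abs_le.1 hH).2
  have h3 : B / 2 * γ ^ 2 * H ^ 2 ≤ B / 2 * γ ^ 2 * k ^ 2 :=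
    mul_le_mul_of_nonneg_left h2 (mul_nonneg (by linarith [hp.B_nonneg]) (sq_nonneg _))
  linarith [h1, h3, show g x * (x - γ * H - x) = -(γ * H * g x) by ring,
    show B / 2 * (x - γ * H - x) ^ 2 = B / 2 * γ ^ 2 * H ^ 2 by ring]

lemma abs_step_le (hp : IsProfile v g h c B k) {x H γ Γ : ℝ} (hH : |H| ≤ k) (hγ : 0 ≤ γ)
    (hγΓ : γ ≤ Γ) :
    |-(γ * H * g x) + B * k ^ 2 / 2 * γ ^ 2| ≤ Γ * k * k + B * k ^ 2 / 2 * Γ ^ 2 := by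
  have hB := hp.B_nonneg
  have hk := hp.k_nonneg
  refine (abs_add_le _ _).trans ?_
  rw [abs_neg, abs_mul, abs_mul, abs_of_nonneg hγ,
    abs_of_nonneg (by positivity : 0 ≤ B * k ^ 2 / 2 * γ ^ 2)]
  have := hp.g_le x
  have hΓ : 0 ≤ Γ := hγ.trans hγΓ
  gcongr

end IsProfile

/-- The squared increment is bounded crudely by a multiple of `γ²`, which is already the residual
needed for `q = 1`. -/
theorem lyap_one_step {B k μ Γ : ℝ} (hμ : 0 ≤ μ) :
    ∃ C, 0 ≤ C ∧ ∀ (v g h : ℝ → ℝ) (c : ℝ), IsProfile v g h c B k → ∀ x H γ : ℝ, |H| ≤ k →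
      0 ≤ γ → γ ≤ Γ → lyap v 1 μ (x - γ * H)
        ≤ lyap v 1 μ x - γ * (H * lyapDeriv v g 1 μ x) + C * γ ^ 2 * lyap v 1 μ x + C * γ ^ 2 := by
  set D := Γ * k * k + B * k ^ 2 / 2 * Γ ^ 2 with hDdef
  set C₁ := μ + Real.exp (μ * D) * μ ^ 2 * (D + 1) with hC₁
  set C₂ := |B * k ^ 2 / 2 * (1 + μ)| + |C₁| * (2 * k ^ 4 + B ^ 2 * k ^ 4 * Γ ^ 2) with hC₂
  have hC₂0 : 0 ≤ C₂ := by positivity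
  refine ⟨C₂ * (2 + Real.exp μ), by positivity, fun v g h c hp x H γ hH hγ hγΓ => ?_⟩
  have hv := hp.v_nonneg x
  have hB := hp.B_nonneg
  have hk := hp.k_nonneg
  set δ := -(γ * H * g x) + B * k ^ 2 / 2 * γ ^ 2 with hδdef
  have hδ : |δ| ≤ D := hp.abs_step_le hH hγ hγΓ
  have h1 := mul_exp_le hv (hp.v_nonneg (x - γ * H)) (hp.v_step hH) hδ hμ
  rw [← hC₁, ← hδdef] at h1
  have hδ2 : δ ^ 2 ≤ (2 * k ^ 4 + B ^ 2 * k ^ 4 * Γ ^ 2) * γ ^ 2 := by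
    refine (sq_step_le hH).trans ?_
    have e1 : g x ^ 2 ≤ k ^ 2 := sq_le_sq' (abs_le.1 (hp.g_le x)).1 (abs_le.1 (hp.g_le x)).2
    have e2 : γ ^ 2 ≤ Γ ^ 2 := pow_le_pow_left₀ hγ hγΓ 2
    have e3 := mul_le_mul_of_nonneg_left e1 (by positivity : 0 ≤ 2 * γ ^ 2 * k ^ 2)
    have e4 := mul_le_mul_of_nonneg_left e2 (by positivity : 0 ≤ B ^ 2 * k ^ 4 * γ ^ 2)
    linarith
  have h2 : C₁ * ((1 + v x) * δ ^ 2)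
      ≤ |C₁| * (2 * k ^ 4 + B ^ 2 * k ^ 4 * Γ ^ 2) * γ ^ 2 * (1 + v x) := by
    have e1 := mul_le_mul_of_nonneg_right (le_abs_self C₁)
      (by positivity : 0 ≤ (1 + v x) * δ ^ 2)
    have e2 := mul_le_mul_of_nonneg_left hδ2 (by positivity : 0 ≤ |C₁| * (1 + v x))
    linarith
  have h3 : (1 + μ * v x) * (B * k ^ 2 / 2 * γ ^ 2)
      ≤ |B * k ^ 2 / 2 * (1 + μ)| * γ ^ 2 * (1 + v x) := by
    rw [abs_of_nonneg (by positivity)]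
    have : 1 + μ * v x ≤ (1 + μ) * (1 + v x) := by nlinarith
    have := mul_le_mul_of_nonneg_right this (by positivity : 0 ≤ B * k ^ 2 / 2 * γ ^ 2)
    linarith
  have h4 : v x + (1 + μ * v x) * δ + C₁ * ((1 + v x) * δ ^ 2)
      ≤ v x - γ * H * g x * (1 + μ * v x) + C₂ * γ ^ 2 * (1 + v x) := by
    have : (1 + μ * v x) * δ
      = -(γ * H * g x * (1 + μ * v x)) + (1 + μ * v x) * (B * k ^ 2 / 2 * γ ^ 2) := by
      rw [hδdef]; ring
    rw [this, hC₂]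
    linarith
  have h5 := mul_le_mul_of_nonneg_left h4 (Real.exp_pos (μ * v x)).le
  have h6 := exp_le_add_pow_mul_exp hv hμ 1
  have h7 := mul_le_mul_of_nonneg_left h6 (by positivity : 0 ≤ C₂ * γ ^ 2)
  have h8 : 0 ≤ C₂ * γ ^ 2 * Real.exp μ * (v x * Real.exp (μ * v x)) := by positivity
  have h9 : 0 ≤ C₂ * γ ^ 2 := by positivity
  simp only [lyap, lyapDeriv, pow_one, Nat.sub_self, pow_zero, Nat.cast_one, mul_one] at h1 h6 h7 h8 ⊢
  linarith

theorem lyap_two_step {B k μ Γ ε : ℝ} (hB : 0 < B) (hμ : 0 ≤ μ) (hε : 0 < ε) :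
    ∃ C, 0 ≤ C ∧ ∀ (v g h : ℝ → ℝ) (c : ℝ), IsProfile v g h c B k → ∀ x H γ : ℝ, |H| ≤ k →
      0 ≤ γ → γ ≤ Γ → lyap v 2 μ (x - γ * H)
        ≤ lyap v 2 μ x - γ * (H * lyapDeriv v g 2 μ x) + ε * γ * lyap v 2 μ x
          + C * γ ^ 2 * lyap v 2 μ x + C * γ ^ 3 := by
  obtain ⟨D, hD⟩ : ∃ D, D = Γ * k * k + B * k ^ 2 / 2 * Γ ^ 2 := ⟨_, rfl⟩
  obtain ⟨C₁, hC₁⟩ : ∃ C₁, C₁ = |1 + 2 * μ + μ * D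
    + 2 * (Real.exp (μ * D) * μ ^ 2) * (D ^ 2 + 1)| := ⟨_, rfl⟩
  have hC₁0 : 0 ≤ C₁ := by rw [hC₁]; exact abs_nonneg _
  obtain ⟨C₂, hC₂⟩ : ∃ C₂, C₂ = B * k ^ 2 / 2 * (2 + μ) + C₁ * (2 * k ^ 2 * (2 * B + k ^ 2))
    + C₁ * (B ^ 2 * k ^ 4) := ⟨_, rfl⟩
  have hC₂0 : 0 ≤ C₂ := by rw [hC₂]; positivity
  -- The absolute value keeps the constant nonnegative: `0 ≤ Γ` is known only once some `γ` in `[0,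
  -- Γ]` is given.
  refine ⟨C₂ + C₂ * Γ ^ 2 + (C₂ ^ 2 / ε + C₂ * |Γ|) * (|Γ| + Real.exp μ), by positivity,
    fun v g h c hp x H γ hH hγ hγΓ => ?_⟩
  have hΓ0 : 0 ≤ Γ := hγ.trans hγΓ
  rw [abs_of_nonneg hΓ0]
  have hv := hp.v_nonneg x
  have hδ := hp.abs_step_le (x := x) hH hγ hγΓ
  rw [← hD] at hδ
  have hs := one_add_sq_mul_sq_step_le (γ := γ) hB.le hv hH (hp.g_le x) (hp.sq_g_le hB x)
  have h1 := sq_mul_exp_le (hp.v_nonneg (x - γ * H)) (hp.v_step hH) hδ hμ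
  have h2 := two_step_bound (m := γ * H * g x) hv hμ (by positivity : 0 ≤ B * k ^ 2 / 2) hγ hγΓ hε hC₁0
    (by positivity) (by positivity) rfl hs C₂ hC₂
  obtain ⟨δ, hδ'⟩ : ∃ δ, δ = -(γ * H * g x) + B * k ^ 2 / 2 * γ ^ 2 := ⟨_, rfl⟩
  rw [← hδ'] at h1 h2
  have h3 : (1 + 2 * μ + μ * D + 2 * (Real.exp (μ * D) * μ ^ 2) * (D ^ 2 + 1))
      * ((1 + v x ^ 2) * δ ^ 2) ≤ C₁ * ((1 + v x ^ 2) * δ ^ 2) :=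
    mul_le_mul_of_nonneg_right (hC₁ ▸ le_abs_self _) (by positivity)
  obtain ⟨C₃, hC₃⟩ : ∃ C₃, C₃ = C₂ ^ 2 / ε + C₂ * Γ := ⟨_, rfl⟩
  have hC₃0 : 0 ≤ C₃ := by rw [hC₃]; positivity
  rw [← hC₃] at h2 ⊢
  have h4 := h1.trans (mul_le_mul_of_nonneg_left ((add_le_add_right h3 _).trans h2)
    (Real.exp_pos (μ * v x)).le)
  have h6 := exp_le_add_pow_mul_exp hv hμ 2
  have h7 := mul_le_mul_of_nonneg_left h6 (by positivity : 0 ≤ C₃ * γ ^ 3)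
  have hL : 0 ≤ v x ^ 2 * Real.exp (μ * v x) := by positivity
  have h8 : C₃ * γ ^ 3 * (v x ^ 2 * Real.exp (μ * v x))
      ≤ C₃ * Γ * γ ^ 2 * (v x ^ 2 * Real.exp (μ * v x)) := by
    have := mul_le_mul_of_nonneg_left hγΓ
      (by positivity : 0 ≤ C₃ * γ ^ 2 * (v x ^ 2 * Real.exp (μ * v x)))
    linarith
  have h9 : 0 ≤ C₃ * Real.exp μ * γ ^ 2 * (v x ^ 2 * Real.exp (μ * v x)) := by positivity
  have h10 : 0 ≤ C₂ * γ ^ 3 + C₂ * Γ ^ 2 * γ ^ 3 + C₃ * Γ * γ ^ 3 := by positivity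
  clear h1 h2 h3 hs hδ h6 hC₁ hC₂ hD hC₃ hL
  simp only [lyap, lyapDeriv, Nat.add_one_sub_one, pow_one, Nat.cast_ofNat]
  linarith

theorem lyap_step {B k μ Γ ε : ℝ} {q : ℕ} (hq : q = 1 ∨ q = 2) (hB : 0 < B) (hμ : 0 ≤ μ)
    (hε : 0 < ε) :
    ∃ C, 0 ≤ C ∧ ∀ (v g h : ℝ → ℝ) (c : ℝ), IsProfile v g h c B k → ∀ x H γ : ℝ, |H| ≤ k →
      0 ≤ γ → γ ≤ Γ → lyap v q μ (x - γ * H)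
        ≤ lyap v q μ x - γ * (H * lyapDeriv v g q μ x) + ε * γ * lyap v q μ x
          + C * γ ^ 2 * lyap v q μ x + C * γ ^ (q + 1) := by
  rcases hq with rfl | rfl
  · obtain ⟨C, hC, hstep⟩ := lyap_one_step (B := B) (k := k) (Γ := Γ) hμ
    refine ⟨C, hC, fun v g h c hp x H γ hH hγ hγΓ => ?_⟩
    have h1 := hstep v g h c hp x H γ hH hγ hγΓ
    have h2 : 0 ≤ ε * γ * lyap v 1 μ x :=
      mul_nonneg (mul_nonneg hε.le hγ) (mul_nonneg (pow_nonneg (hp.v_nonneg x) _) (Real.exp_pos _).le)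
    simp only [Nat.reduceAdd]
    linarith
  · exact lyap_two_step hB hμ hε

end Lyapunov

/-! ### Step sizes and the deterministic recursion. -/

section Steps

lemma step_pos {γ₁ β : ℝ} (hγ₁ : 0 < γ₁) {n : ℕ} (hn : 1 ≤ n) : 0 < step γ₁ β n :=
  mul_pos hγ₁ (Real.rpow_pos_of_pos (by exact_mod_cast hn) _)

lemma step_le {γ₁ β : ℝ} (hγ₁ : 0 < γ₁) (hβ : 0 < β) {n : ℕ} (hn : 1 ≤ n) :
    step γ₁ β n ≤ γ₁ := by
  have : (n : ℝ) ^ (-β) ≤ 1 :=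
    Real.rpow_le_one_of_one_le_of_nonpos (by exact_mod_cast hn) (by linarith)
  calc step γ₁ β n ≤ γ₁ * 1 := mul_le_mul_of_nonneg_left this hγ₁.le
    _ = γ₁ := mul_one _

/-- From `1 + 1/m ≤ exp(1/m)`, raised to the power `β`. It measures how fast the target rate itself
decays. -/
lemma step_le_exp_mul_step {γ₁ β : ℝ} (hγ₁ : 0 < γ₁) (hβ : 0 < β) {m : ℕ} (hm : 1 ≤ m) :
    step γ₁ β m ≤ Real.exp (β / m) * step γ₁ β (m + 1) := by
  have hm0 : (0 : ℝ) < m := by exact_mod_cast hm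
  have h1 : (m : ℝ) + 1 ≤ m * Real.exp (1 / m) := by
    have := Real.add_one_le_exp (1 / (m : ℝ))
    have h2 := mul_le_mul_of_nonneg_left this hm0.le
    rw [mul_add, mul_one_div_cancel hm0.ne'] at h2
    linarith
  have h2 : ((m : ℝ) + 1) ^ β ≤ (m : ℝ) ^ β * Real.exp (β / m) := by
    refine (Real.rpow_le_rpow (by positivity) h1 hβ.le).trans (le_of_eq ?_)
    rw [Real.mul_rpow hm0.le (Real.exp_pos _).le, ← Real.exp_mul]
    congr 2
    ring
  unfold step
  push_cast
  rw [Real.rpow_neg hm0.le, Real.rpow_neg (by positivity), ← div_eq_mul_inv, ← div_eq_mul_inv,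
    ← mul_div_assoc, div_le_div_iff₀ (by positivity) (by positivity)]
  have := mul_le_mul_of_nonneg_left h2 hγ₁.le
  linarith

lemma step_tendsto_zero {γ₁ β : ℝ} (hβ : 0 < β) :
    Tendsto (fun n => step γ₁ β n) atTop (𝓝 0) := by
  have := ((tendsto_rpow_neg_atTop hβ).comp tendsto_natCast_atTop_atTop).const_mul γ₁
  simpa [step] using this

/-- The relative decay `q β / m` of `γ^q` must lie below `λ γ_m` with a margin. For `β < 1` this
holds eventually because `1/m = o(γ_m)`; for `β = 1` both are multiples of `1/m` and the strict
inequality `q < λ γ₁` is needed. -/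
lemma exists_step_threshold {γ₁ β lam : ℝ} {q : ℕ} (hγ₁ : 0 < γ₁) (hβ₀ : 0 < β)
    (hβ₁ : β ≤ 1) (hlam : 0 < lam) (hq : β = 1 → (q : ℝ) < lam * γ₁) {C : ℝ} :
    ∃ θ > 0, ∃ N : ℕ, ∀ m, N ≤ m → 1 ≤ m → q * (β / m) ≤ (lam - 2 * θ) * step γ₁ β m ∧
      C * step γ₁ β m ≤ θ ∧ θ * step γ₁ β m ≤ 1 := by
  have h1 : ∃ θ > 0, ∀ᶠ m : ℕ in atTop, 1 ≤ m →
      q * (β / m) ≤ (lam - 2 * θ) * step γ₁ β m := by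
    rcases hβ₁.eq_or_lt with rfl | hlt
    · have h2 : (q : ℝ) / γ₁ < lam := by
        rw [div_lt_iff₀ hγ₁]
        exact hq rfl
      -- With this `θ`, `lam - 2 θ = q / γ₁`, so the required inequality is an equality.
      refine ⟨(lam - q / γ₁) / 2, by linarith, Eventually.of_forall fun m hm => le_of_eq ?_⟩
      unfold step
      rw [Real.rpow_neg_one]
      field_simp
      ring
    · refine ⟨lam / 4, by linarith, ?_⟩
      have h3 : Tendsto (fun m : ℕ => (q : ℝ) * β * (m : ℝ) ^ (-(1 - β))) atTop (𝓝 0) := by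
        have := ((tendsto_rpow_neg_atTop (sub_pos.2 hlt)).comp
          tendsto_natCast_atTop_atTop).const_mul ((q : ℝ) * β)
        simpa using this
      have h4 : 0 < lam / 2 * γ₁ := by positivity
      filter_upwards [h3.eventually (eventually_le_nhds h4)] with m hm hm1
      have hm0 : (0 : ℝ) < m := by exact_mod_cast hm1
      have h5 := mul_le_mul_of_nonneg_right hm (Real.rpow_nonneg hm0.le (-β))
      rw [mul_assoc ((q : ℝ) * β), ← Real.rpow_add hm0] at h5
      rw [show -(1 - β) + -β = -1 by ring, Real.rpow_neg_one] at h5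
      unfold step
      rw [div_eq_mul_inv]
      linarith
  obtain ⟨θ, hθ, hev⟩ := h1
  refine ⟨θ, hθ, ?_⟩
  have h2 : ∀ᶠ m : ℕ in atTop, C * step γ₁ β m ≤ θ := by
    have := (step_tendsto_zero (γ₁ := γ₁) hβ₀).const_mul C
    rw [mul_zero] at this
    exact this.eventually (eventually_le_nhds hθ)
  have h3 : ∀ᶠ m : ℕ in atTop, θ * step γ₁ β m ≤ 1 := by
    have := (step_tendsto_zero (γ₁ := γ₁) hβ₀).const_mul θ
    rw [mul_zero] at this
    exact this.eventually (eventually_le_nhds one_pos)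
  obtain ⟨N, hN⟩ := eventually_atTop.1 (hev.and (h2.and h3))
  exact ⟨N, fun m hm hm1 => ⟨(hN m hm).1 hm1, (hN m hm).2.1, (hN m hm).2.2⟩⟩

lemma exp_neg_le_one_sub_half {y : ℝ} (h0 : 0 ≤ y) (h1 : y ≤ 1) :
    Real.exp (-y) ≤ 1 - y / 2 := by
  have h2 := Real.add_one_le_exp y
  rw [Real.exp_neg, inv_le_comm₀ (Real.exp_pos _) (by linarith)]
  refine le_trans ?_ h2
  rw [inv_le_comm₀ (by linarith) (by linarith), inv_le_comm₀ (by linarith) (by linarith),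
    inv_le_iff_one_le_mul₀ (by linarith)]
  nlinarith

/-- The one-step inequality for the moments of the Lyapunov function. -/
def StepRec (γ₁ β lam C : ℝ) (q : ℕ) (a : ℕ → ℝ) : Prop :=
  ∀ n, a (n + 1) ≤ (1 - lam * step γ₁ β (n + 1) + C * step γ₁ β (n + 1) ^ 2) * a n
    + C * step γ₁ β (n + 1) ^ (q + 1)

/-- Before the threshold the factor need not contract; finitely many indices are absorbed in a
constant that depends on `A` but not on the sequence. -/
lemma StepRec.initial_bound {γ₁ β lam C A : ℝ} {q : ℕ} (hγ₁ : 0 < γ₁) (hlam : 0 ≤ lam)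
    (hC : 0 ≤ C) (hA : 0 ≤ A) (N : ℕ) :
    ∃ U, 0 ≤ U ∧ ∀ a : ℕ → ℝ, (∀ n, 0 ≤ a n) → a 0 ≤ A → StepRec γ₁ β lam C q a →
      ∀ n ≤ N, a n ≤ U * step γ₁ β (n + 1) ^ q := by
  induction N with
  | zero =>
    have h0 : 0 < step γ₁ β (0 + 1) ^ q := pow_pos (step_pos hγ₁ le_rfl) q
    refine ⟨A / step γ₁ β (0 + 1) ^ q, by positivity, fun a _ h _ n hn => ?_⟩
    obtain rfl : n = 0 := by omega
    rwa [div_mul_cancel₀ _ h0.ne']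
  | succ N ih =>
    obtain ⟨U, hU, ih⟩ := ih
    have h1 : 0 < step γ₁ β (N + 1) := step_pos hγ₁ (by omega)
    have h2 : 0 < step γ₁ β (N + 1 + 1) ^ q := pow_pos (step_pos hγ₁ (by omega)) q
    obtain ⟨R, hR⟩ : ∃ R, R = (1 + C * step γ₁ β (N + 1) ^ 2) * (U * step γ₁ β (N + 1) ^ q)
      + C * step γ₁ β (N + 1) ^ (q + 1) := ⟨_, rfl⟩
    refine ⟨max U (R / step γ₁ β (N + 1 + 1) ^ q), le_max_of_le_left hU,
      fun a ha h0 hrec n hn => ?_⟩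
    rcases Nat.lt_or_ge n (N + 1) with hlt | hge
    · refine (ih a ha h0 hrec n (by omega)).trans ?_
      exact mul_le_mul_of_nonneg_right (le_max_left _ _) (pow_pos (step_pos hγ₁ (by omega)) q).le
    · obtain rfl : n = N + 1 := by omega
      have h3 : a (N + 1) ≤ R := by
        refine (hrec N).trans ?_
        rw [hR]
        gcongr ?_ + _
        refine mul_le_mul ?_ (ih a ha h0 hrec N le_rfl) (ha N) (by positivity)
        nlinarith
      refine h3.trans ?_
      rw [← div_le_iff₀ h2]
      exact le_max_right _ _

/-- Past the threshold, the contraction `exp(-λ γ + C γ²)` beats the ratio `exp(q β / m)` of target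
rates by a factor `1 - θ γ / 2`. The resulting gain `U (θ/2) γ γ'^q` pays for the residual `C
γ^{q+1}`, which fixes the size of `U`. -/
theorem StepRec.rate {γ₁ β lam C A : ℝ} {q : ℕ} (hγ₁ : 0 < γ₁) (hβ₀ : 0 < β) (hβ₁ : β ≤ 1)
    (hlam : 0 < lam) (hq : β = 1 → (q : ℝ) < lam * γ₁) (hC : 0 ≤ C) (hA : 0 ≤ A) :
    ∃ U, 0 ≤ U ∧ ∀ a : ℕ → ℝ, (∀ n, 0 ≤ a n) → a 0 ≤ A → StepRec γ₁ β lam C q a →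
      ∀ n, a n ≤ U * step γ₁ β (n + 1) ^ q := by
  obtain ⟨θ, hθ, N, hN⟩ := exists_step_threshold hγ₁ hβ₀ hβ₁ hlam hq (C := C)
  obtain ⟨U₀, hU₀, hinit⟩ := StepRec.initial_bound (q := q) (β := β) hγ₁ hlam.le hC hA N
  refine ⟨max U₀ (2 * C * Real.exp q / θ), le_max_of_le_left hU₀, fun a ha h0 hrec n => ?_⟩
  obtain ⟨U, hU⟩ : ∃ U, U = max U₀ (2 * C * Real.exp q / θ) := ⟨_, rfl⟩
  have hU0 : 0 ≤ U := hU ▸ le_max_of_le_left hU₀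
  have hUθ : C * Real.exp q ≤ U * (θ / 2) := by
    have : 2 * C * Real.exp q / θ ≤ U := hU ▸ le_max_right _ _
    rw [div_le_iff₀ hθ] at this
    linarith
  rw [← hU]
  induction n with
  | zero =>
    refine (hinit a ha h0 hrec 0 (Nat.zero_le _)).trans ?_
    exact mul_le_mul_of_nonneg_right (hU ▸ le_max_left _ _) (pow_pos (step_pos hγ₁ le_rfl) q).le
  | succ n ih =>
    rcases Nat.lt_or_ge n N with hlt | hge
    · refine (hinit a ha h0 hrec (n + 1) (by omega)).trans ?_
      exact mul_le_mul_of_nonneg_right (hU ▸ le_max_left _ _)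
        (pow_pos (step_pos hγ₁ (by omega)) q).le
    · obtain ⟨hm1, hm2, hm3⟩ := hN (n + 1) (by omega) (by omega)
      have hratio := step_le_exp_mul_step hγ₁ hβ₀ (show 1 ≤ n + 1 by omega)
      have hrec' := hrec n
      have hγ0 : 0 < step γ₁ β (n + 1) := step_pos hγ₁ (by omega)
      have hγ'0 : 0 < step γ₁ β (n + 1 + 1) := step_pos hγ₁ (by omega)
      have hm : (1 : ℝ) ≤ ((n + 1 : ℕ) : ℝ) := by push_cast; linarith [n.cast_nonneg (α := ℝ)]
      obtain ⟨m, hmdef⟩ : ∃ m : ℝ, m = ((n + 1 : ℕ) : ℝ) := ⟨_, rfl⟩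
      rw [← hmdef] at hm1 hratio hm
      obtain ⟨γ, hγdef⟩ : ∃ γ, γ = step γ₁ β (n + 1) := ⟨_, rfl⟩
      obtain ⟨γ', hγ'def⟩ : ∃ γ', γ' = step γ₁ β (n + 1 + 1) := ⟨_, rfl⟩
      rw [← hγdef] at hm1 hm2 hm3 hratio hrec' hγ0 ih
      rw [← hγ'def] at hratio hγ'0 ⊢
      have hG : γ ^ q ≤ Real.exp (q * (β / m)) * γ' ^ q := by
        have := pow_le_pow_left₀ hγ0.le hratio q
        rwa [mul_pow, ← Real.exp_nat_mul] at this
      have hG' : 0 < γ' ^ q := pow_pos hγ'0 q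
      have hexpq : Real.exp (q * (β / m)) ≤ Real.exp q := by
        apply Real.exp_le_exp.2
        have : β / m ≤ 1 := by
          rw [div_le_one (by linarith)]
          linarith
        exact mul_le_of_le_one_right q.cast_nonneg this
      have h1 : 1 - lam * γ + C * γ ^ 2 ≤ Real.exp (-(lam * γ) + C * γ ^ 2) := by
        have := Real.add_one_le_exp (-(lam * γ) + C * γ ^ 2)
        linarith
      have h2 : (1 - lam * γ + C * γ ^ 2) * a n
          ≤ Real.exp (-(lam * γ) + C * γ ^ 2) * (U * γ ^ q) :=
        mul_le_mul h1 ih (ha n) (Real.exp_pos _).le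
      have h3 : Real.exp (-(lam * γ) + C * γ ^ 2) * γ ^ q ≤ (1 - θ * γ / 2) * γ' ^ q := by
        calc Real.exp (-(lam * γ) + C * γ ^ 2) * γ ^ q
            ≤ Real.exp (-(lam * γ) + C * γ ^ 2) * (Real.exp (q * (β / m)) * γ' ^ q) :=
              mul_le_mul_of_nonneg_left hG (Real.exp_pos _).le
          _ = Real.exp (-(lam * γ) + C * γ ^ 2 + q * (β / m)) * γ' ^ q := by
              rw [Real.exp_add _ (q * (β / m))]
              ring
          _ ≤ Real.exp (-(θ * γ)) * γ' ^ q := by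
              apply mul_le_mul_of_nonneg_right _ hG'.le
              apply Real.exp_le_exp.2
              have := mul_le_mul_of_nonneg_right hm2 hγ0.le
              linarith
          _ ≤ (1 - θ * γ / 2) * γ' ^ q := by
              apply mul_le_mul_of_nonneg_right _ hG'.le
              exact exp_neg_le_one_sub_half (by positivity) hm3
      have h4 : C * γ ^ (q + 1) ≤ U * (θ / 2) * (γ * γ' ^ q) := by
        have h5 : γ ^ q ≤ Real.exp q * γ' ^ q :=
          hG.trans (mul_le_mul_of_nonneg_right hexpq hG'.le)
        calc C * γ ^ (q + 1) = C * γ * γ ^ q := by ring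
          _ ≤ C * γ * (Real.exp q * γ' ^ q) := mul_le_mul_of_nonneg_left h5 (by positivity)
          _ = C * Real.exp q * (γ * γ' ^ q) := by ring
          _ ≤ U * (θ / 2) * (γ * γ' ^ q) := mul_le_mul_of_nonneg_right hUθ (by positivity)
      have h6 := mul_le_mul_of_nonneg_left h3 hU0
      linarith

end Steps

/-! ### Differentiation of `V` for a law with a continuous density. -/

section Law

variable {Ω : Type*} [MeasurableSpace Ω] {P : Measure Ω} {X : Ω → ℝ} {f : ℝ → ℝ} {α : ℝ}

/-- The derivative `(F(ξ) - α) / (1 - α)` of `V`, for the law `ν` with cdf `F`. -/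
def derivV (ν : Measure ℝ) (α ξ : ℝ) : ℝ := (cdf ν ξ - α) / (1 - α)

lemma abs_derivV_le (ν : Measure ℝ) (hα₁ : α < 1) (ξ : ℝ) :
    |derivV ν α ξ| ≤ kConst α := by
  have h1 : 0 < 1 - α := by linarith
  have h2 : derivV ν α ξ ≤ 1 := by
    unfold derivV
    rw [div_le_one h1]
    linarith [cdf_le_one ν ξ]
  have h3 : -(α / (1 - α)) ≤ derivV ν α ξ := by
    unfold derivV
    rw [← neg_div]
    apply div_le_div_of_nonneg_right _ h1.le
    linarith [cdf_nonneg ν ξ]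
  rw [abs_le]
  exact ⟨by linarith [le_max_right 1 (α / (1 - α)), show kConst α = max 1 (α / (1 - α)) from rfl],
    h2.trans (le_max_left _ _)⟩

lemma abs_H₁_le (hα₀ : 0 < α) (hα₁ : α < 1) (ξ x : ℝ) : |H₁ α ξ x| ≤ kConst α := by
  have h1 : 0 < 1 - α := by linarith
  by_cases hx : x ∈ Set.Ici ξ
  · have : H₁ α ξ x = -(α / (1 - α)) := by
      simp only [H₁, Set.indicator_of_mem hx, Pi.one_apply]
      field_simp
      ring
    rw [this, abs_neg, abs_of_nonneg (by positivity)]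
    exact le_max_right _ _
  · have : H₁ α ξ x = 1 := by simp [H₁, Set.indicator_of_notMem hx]
    rw [this, abs_one]
    exact le_max_left _ _

lemma measurable_H₁ (α : ℝ) : Measurable (fun p : ℝ × ℝ => H₁ α p.1 p.2) := by
  have h : (fun p : ℝ × ℝ => H₁ α p.1 p.2)
      = fun p => 1 - 1 / (1 - α) * ({p : ℝ × ℝ | p.1 ≤ p.2}.indicator 1 p) := by
    funext p
    simp [H₁, Set.indicator_apply]
  rw [h]
  exact measurable_const.sub (measurable_const.mul
    (measurable_one.indicator (measurableSet_le measurable_fst measurable_snd)))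

/-- Without atoms, `{x ≥ ξ}` has mass `1 - F(ξ)`; thus `H₁` is an unbiased estimate of `V'`. -/
lemma integral_H₁ (ν : Measure ℝ) [IsProbabilityMeasure ν] [NullSingletonClass ν] (hα₁ : α < 1) (ξ : ℝ) :
    ∫ x, H₁ α ξ x ∂ν = derivV ν α ξ := by
  have h1 : 1 - α ≠ 0 := by linarith
  have hind : Integrable ((Set.Ici ξ).indicator (1 : ℝ → ℝ)) ν :=
    (integrable_const (1 : ℝ)).indicator measurableSet_Ici
  have h2 : ν.real (Set.Ici ξ) = 1 - cdf ν ξ := by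
    rw [cdf_eq_real, ← measureReal_congr Iio_ae_eq_Iic, ← Set.compl_Iio,
      measureReal_compl measurableSet_Iio, probReal_univ]
  unfold H₁ derivV
  rw [integral_sub (integrable_const _) (hind.const_mul _), integral_const_mul,
    integral_indicator_one measurableSet_Ici, h2]
  simp only [integral_const, probReal_univ, smul_eq_mul, mul_one]
  field_simp
  ring

lemma nullSingletonClass_of_pdf
    (hlaw : P.map X = volume.withDensity (fun x => ENNReal.ofReal (f x))) : NullSingletonClass (P.map X) := by
  rw [hlaw]
  infer_instance

section Density

variable [IsProbabilityMeasure P]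

lemma integrable_pdf
    (hlaw : P.map X = volume.withDensity (fun x => ENNReal.ofReal (f x)))
    (hX : AEMeasurable X P) (hf : Continuous f) (hf0 : ∀ x, 0 ≤ f x) :
    Integrable f := by
  have h1 : (P.map X) Set.univ = 1 := by
    rw [Measure.map_apply_of_aemeasurable hX MeasurableSet.univ]
    simp
  rw [hlaw, withDensity_apply _ MeasurableSet.univ, Measure.restrict_univ] at h1
  refine ⟨hf.aestronglyMeasurable, ?_⟩
  rw [hasFiniteIntegral_iff_ofReal (ae_of_all _ hf0), h1]
  exact ENNReal.one_lt_top

lemma cdf_eq_integral_pdf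
    (hlaw : P.map X = volume.withDensity (fun x => ENNReal.ofReal (f x)))
    (hX : AEMeasurable X P) (hf : Continuous f) (hf0 : ∀ x, 0 ≤ f x)
    (x : ℝ) : cdf (P.map X) x = ∫ y in Set.Iic x, f y := by
  have : IsProbabilityMeasure (P.map X) := Measure.isProbabilityMeasure_map hX
  rw [cdf_eq_real, measureReal_def, hlaw, withDensity_apply _ measurableSet_Iic,
    integral_eq_lintegral_of_nonneg_ae (ae_of_all _ hf0) hf.aestronglyMeasurable]

lemma cdf_sub_eq_integral_pdf
    (hlaw : P.map X = volume.withDensity (fun x => ENNReal.ofReal (f x)))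
    (hX : AEMeasurable X P) (hf : Continuous f) (hf0 : ∀ x, 0 ≤ f x)
    (x y : ℝ) : cdf (P.map X) y - cdf (P.map X) x = ∫ z in x..y, f z := by
  have hint := integrable_pdf hlaw hX hf hf0
  rw [cdf_eq_integral_pdf hlaw hX hf hf0, cdf_eq_integral_pdf hlaw hX hf hf0,
    intervalIntegral.integral_Iic_sub_Iic hint.integrableOn hint.integrableOn]

lemma hasDerivAt_cdf
    (hlaw : P.map X = volume.withDensity (fun x => ENNReal.ofReal (f x)))
    (hX : AEMeasurable X P) (hf : Continuous f) (hf0 : ∀ x, 0 ≤ f x) (x : ℝ) :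
    HasDerivAt (fun y => cdf (P.map X) y) (f x) x := by
  have h1 : (fun y => cdf (P.map X) y) = fun y => cdf (P.map X) 0 + ∫ z in (0 : ℝ)..y, f z := by
    funext y
    rw [← cdf_sub_eq_integral_pdf hlaw hX hf hf0]
    ring
  rw [h1]
  exact (intervalIntegral.integral_hasDerivAt_right (hf.intervalIntegrable _ _)
    (hf.stronglyMeasurableAtFilter _ _) hf.continuousAt).const_add _

lemma hasDerivAt_derivV
    (hlaw : P.map X = volume.withDensity (fun x => ENNReal.ofReal (f x)))
    (hX : AEMeasurable X P) (hf : Continuous f) (hf0 : ∀ x, 0 ≤ f x)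
    (x : ℝ) : HasDerivAt (derivV (P.map X) α) (f x / (1 - α)) x :=
  ((hasDerivAt_cdf hlaw hX hf hf0 x).sub_const α).div_const (1 - α)

lemma abs_posPart_sub_le (x ξ ξ' : ℝ) : |max (x - ξ) 0 - max (x - ξ') 0| ≤ |ξ - ξ'| := by
  refine (abs_max_sub_max_le_abs _ _ _).trans (le_of_eq ?_)
  rw [show x - ξ - (x - ξ') = -(ξ - ξ') by ring, abs_neg]

lemma integrable_posPart (hX : Integrable X P) (ξ : ℝ) :
    Integrable (fun ω => max (X ω - ξ) 0) P :=
  (hX.sub (integrable_const ξ)).pos_part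

/-- Differentiation under the integral: `ξ ↦ (X - ξ)⁺` is 1-Lipschitz and is differentiable at the
given `ξ` unless `X = ξ`, an event of probability zero. -/
lemma hasDerivAt_V
    (hlaw : P.map X = volume.withDensity (fun x => ENNReal.ofReal (f x)))
    (hX : Integrable X P) (hα₁ : α < 1) (ξ : ℝ) :
    HasDerivAt (V P α X) (derivV (P.map X) α ξ) ξ := by
  have h1 : 1 - α ≠ 0 := by linarith
  have hXm : AEMeasurable X P := hX.1.aemeasurable
  have : IsProbabilityMeasure (P.map X) := Measure.isProbabilityMeasure_map hXm
  have := nullSingletonClass_of_pdf hlaw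
  have hne : ∀ᵐ ω ∂P, X ω ≠ ξ := by
    have h2 : (P.map X) {ξ} = 0 := measure_singleton ξ
    rw [Measure.map_apply_of_aemeasurable hXm (measurableSet_singleton ξ)] at h2
    rw [ae_iff]
    simpa [Set.preimage] using h2
  have hcompl : (Set.Ioi ξ : Set ℝ) = (Set.Iic ξ)ᶜ := by simp
  have hInd : Measurable ((Set.Ioi ξ).indicator (fun _ => (-1 : ℝ))) :=
    measurable_const.indicator measurableSet_Ioi
  have key := (hasDerivAt_integral_of_dominated_loc_of_lip (μ := P) (x₀ := ξ) (s := Set.univ)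
    (F := fun ξ ω => max (X ω - ξ) 0) (F' := fun ω => (Set.Ioi ξ).indicator (fun _ => (-1 : ℝ)) (X ω))
    (bound := fun _ => 1) univ_mem
    (Eventually.of_forall fun ξ => (integrable_posPart hX ξ).1) (integrable_posPart hX ξ)
    (hInd.comp_aemeasurable hXm).aestronglyMeasurable
    (ae_of_all _ fun ω => by
      refine LipschitzOnWith.of_dist_le_mul fun a _ b _ => ?_
      rw [Real.dist_eq, Real.dist_eq]
      simpa using abs_posPart_sub_le (X ω) a b)
    (integrable_const 1)
    (by
      filter_upwards [hne] with ω hω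
      rcases lt_or_gt_of_ne hω with hlt | hgt
      · rw [Set.indicator_of_notMem (by simpa using hlt.le)]
        refine (hasDerivAt_const ξ (0 : ℝ)).congr_of_eventuallyEq ?_
        filter_upwards [Ioi_mem_nhds hlt] with z hz
        exact max_eq_right (by linarith [Set.mem_Ioi.1 hz])
      · rw [Set.indicator_of_mem (by simpa using hgt)]
        refine ((hasDerivAt_id ξ).const_sub (X ω)).congr_of_eventuallyEq ?_
        filter_upwards [Iio_mem_nhds hgt] with z hz
        exact max_eq_left (by linarith [Set.mem_Iio.1 hz]))).2
  have hval : ∫ ω, (Set.Ioi ξ).indicator (fun _ => (-1 : ℝ)) (X ω) ∂P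
      = cdf (P.map X) ξ - 1 := by
    rw [← integral_map hXm hInd.aestronglyMeasurable, integral_indicator measurableSet_Ioi,
      setIntegral_const, smul_eq_mul, hcompl, measureReal_compl measurableSet_Iic, probReal_univ,
      cdf_eq_real]
    ring
  rw [hval] at key
  refine ((hasDerivAt_id ξ).add (key.const_mul (1 / (1 - α)))).congr_deriv ?_
  unfold derivV
  field_simp
  ring

lemma V''_eq
    (hlaw : P.map X = volume.withDensity (fun x => ENNReal.ofReal (f x)))
    (hX : Integrable X P) (hf : Continuous f) (hf0 : ∀ x, 0 ≤ f x) (hα₁ : α < 1) :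
    V'' P α X = fun x => f x / (1 - α) := by
  have h1 : deriv (V P α X) = derivV (P.map X) α :=
    funext fun ξ => (hasDerivAt_V hlaw hX hα₁ ξ).deriv
  unfold V''
  rw [h1]
  exact funext fun ξ => (hasDerivAt_derivV hlaw hX.1.aemeasurable hf hf0 ξ).deriv

lemma derivV_argmin
    (hlaw : P.map X = volume.withDensity (fun x => ENNReal.ofReal (f x)))
    (hX : Integrable X P) (hα₁ : α < 1) {ξ : ℝ} (hξ : ξ ∈ argminV P α X) :
    derivV (P.map X) α ξ = 0 :=
  IsLocalMin.hasDerivAt_eq_zero (Eventually.of_forall fun x => hξ x) (hasDerivAt_V hlaw hX hα₁ ξ)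

theorem isProfile_V
    (hlaw : P.map X = volume.withDensity (fun x => ENNReal.ofReal (f x)))
    (hX : Integrable X P) (hf : Continuous f) (hf0 : ∀ x, 0 ≤ f x)
    (hα₁ : α < 1) {ξ M : ℝ} (hξ : ξ ∈ argminV P α X) (hM : ∀ x, f x ≤ M) :
    IsProfile (fun x => V P α X x - V P α X ξ) (derivV (P.map X) α) (fun x => f x / (1 - α)) ξ
      (M / (1 - α)) (kConst α) where
  deriv_v x := (hasDerivAt_V hlaw hX hα₁ x).sub_const _
  deriv_g x := hasDerivAt_derivV hlaw hX.1.aemeasurable hf hf0 x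
  v_nonneg x := sub_nonneg.2 (hξ x)
  v_min := sub_self _
  g_min := derivV_argmin hlaw hX hα₁ hξ
  h_nonneg x := div_nonneg (hf0 x) (by linarith)
  h_le x := div_le_div_of_nonneg_right (hM x) (by linarith)
  g_le := abs_derivV_le _ hα₁

end Density

end Law

/-! ### The past of the recursion. -/

section Past

variable {Ω : Type*} {init : Ω → ℝ × ℝ} {Xs : ℕ → Ω → ℝ}

/-- The information carried by the initial vector and the first `n` samples. -/
abbrev past (init : Ω → ℝ × ℝ) (Xs : ℕ → Ω → ℝ) (n : ℕ) : MeasurableSpace Ω :=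
  MeasurableSpace.comap (fun ω => (init ω, fun i : Finset.range n => Xs i ω)) inferInstance

lemma measurable_past_init (n : ℕ) : Measurable[past init Xs n] init :=
  measurable_fst.comp (comap_measurable _)

lemma measurable_past_sample {i n : ℕ} (hi : i < n) : Measurable[past init Xs n] (Xs i) := by
  have h : Measurable (fun p : (ℝ × ℝ) × (Finset.range n → ℝ) =>
      p.2 ⟨i, Finset.mem_range.2 hi⟩) :=
    (measurable_pi_apply _).comp measurable_snd
  exact h.comp (comap_measurable (fun ω => (init ω, fun i : Finset.range n => Xs i ω)))

lemma past_mono {m n : ℕ} (hmn : m ≤ n) : past init Xs m ≤ past init Xs n := by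
  let _ : MeasurableSpace Ω := past init Xs n
  refine Measurable.comap_le ?_
  refine Measurable.prodMk (measurable_past_init n) ?_
  exact measurable_pi_lambda _ fun i =>
    measurable_past_sample ((Finset.mem_range.1 i.2).trans_le hmn)

lemma measurable_iter {α : ℝ} {γ : ℕ → ℝ} (n : ℕ) :
    Measurable[past init Xs n] (fun ω => iter α γ (init ω) (fun m => Xs m ω) n) := by
  induction n with
  | zero => exact measurable_past_init 0
  | succ n ih =>
    have h1 := ih.mono (past_mono (init := init) (Xs := Xs) n.le_succ) le_rfl
    have h2 := measurable_past_sample (init := init) (Xs := Xs) n.lt_succ_self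
    have h3 : Measurable (fun p : (ℝ × ℝ) × ℝ =>
        (p.1.1 - γ (n + 1) * H₁ α p.1.1 p.2, p.1.2 - 1 / ((n : ℝ) + 1) * H₂ α p.1.1 p.1.2 p.2)) := by
      have h4 : Measurable (fun p : (ℝ × ℝ) × ℝ => H₁ α p.1.1 p.2) :=
        (measurable_H₁ α).comp (measurable_fst.fst.prodMk measurable_snd)
      unfold H₂
      fun_prop
    exact h3.comp (h1.prodMk h2)

end Past

/-! ### Independence of the new sample from the past. -/

section Independence

variable {Ω : Type*} [MeasurableSpace Ω] {P : Measure Ω}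

lemma indepFun_prodMk_left_of_prodMk_right {A B C : Type*} [MeasurableSpace A]
    [MeasurableSpace B] [MeasurableSpace C] [IsProbabilityMeasure P] {a : Ω → A} {b : Ω → B}
    {c : Ω → C} (ha : Measurable a) (hb : Measurable b) (hc : Measurable c)
    (h1 : IndepFun a (fun ω => (b ω, c ω)) P) (h2 : IndepFun b c P) :
    IndepFun (fun ω => (a ω, b ω)) c P := by
  have : IsProbabilityMeasure (P.map a) := Measure.isProbabilityMeasure_map ha.aemeasurable
  have : IsProbabilityMeasure (P.map b) := Measure.isProbabilityMeasure_map hb.aemeasurable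
  have : IsProbabilityMeasure (P.map c) := Measure.isProbabilityMeasure_map hc.aemeasurable
  have h3 : IndepFun a b P := h1.comp measurable_id measurable_fst
  have e1 := (indepFun_iff_map_prod_eq_prod_map_map ha.aemeasurable
    (hb.prodMk hc).aemeasurable).1 h1
  have e2 := (indepFun_iff_map_prod_eq_prod_map_map hb.aemeasurable hc.aemeasurable).1 h2
  have e3 := (indepFun_iff_map_prod_eq_prod_map_map ha.aemeasurable hb.aemeasurable).1 h3
  rw [indepFun_iff_map_prod_eq_prod_map_map (ha.prodMk hb).aemeasurable hc.aemeasurable, e3]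
  apply (MeasurableEquiv.prodAssoc (α := A) (β := B) (γ := C)).map_measurableEquiv_injective
  rw [Measure.prodAssoc_prod, Measure.map_map MeasurableEquiv.prodAssoc.measurable
    ((ha.prodMk hb).prodMk hc), ← e2, ← e1]
  rfl

/-- Fubini on the product law. It stands in for conditional expectation given the past: freeze `U`
and average over the new sample. -/
lemma IndepFun.integral_eq_zero {E : Type*} [MeasurableSpace E] [IsProbabilityMeasure P]
    {U : Ω → E} {X : Ω → ℝ} (hU : Measurable U) (hX : Measurable X) (hUX : IndepFun U X P)
    {φ : E × ℝ → ℝ} (hφ : Measurable φ) (hint : Integrable (fun ω => φ (U ω, X ω)) P)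
    (h0 : ∀ u, ∫ x, φ (u, x) ∂(P.map X) = 0) : ∫ ω, φ (U ω, X ω) ∂P = 0 := by
  have : IsProbabilityMeasure (P.map U) := Measure.isProbabilityMeasure_map hU.aemeasurable
  have : IsProbabilityMeasure (P.map X) := Measure.isProbabilityMeasure_map hX.aemeasurable
  have hm : AEMeasurable (fun ω => (U ω, X ω)) P := (hU.prodMk hX).aemeasurable
  have e := (indepFun_iff_map_prod_eq_prod_map_map hU.aemeasurable hX.aemeasurable).1 hUX
  have hint' : Integrable φ ((P.map U).prod (P.map X)) := by
    rw [← e, integrable_map_measure hφ.aestronglyMeasurable hm]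
    exact hint
  rw [← integral_map (φ := fun ω => (U ω, X ω)) hm hφ.aestronglyMeasurable, e,
    integral_prod _ hint']
  simp [h0]

/-- `(X_n)` are iid with law `ν`, independent of the initial vector. -/
structure IsSample (P : Measure Ω) (ν : Measure ℝ) (init : Ω → ℝ × ℝ) (Xs : ℕ → Ω → ℝ) :
    Prop where
  measurable_init : Measurable init
  measurable_Xs : ∀ n, Measurable (Xs n)
  iIndep_Xs : iIndepFun Xs P
  law_Xs : ∀ n, P.map (Xs n) = ν
  indep_init : IndepFun init (fun ω n => Xs n ω) P

variable {ν : Measure ℝ} {init : Ω → ℝ × ℝ} {Xs : ℕ → Ω → ℝ}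

namespace IsSample

lemma past_le (hs : IsSample P ν init Xs) (n : ℕ) : past init Xs n ≤ ‹MeasurableSpace Ω› :=
  Measurable.comap_le (hs.measurable_init.prodMk
    (measurable_pi_lambda _ fun i => hs.measurable_Xs i))

lemma indepFun_past [IsProbabilityMeasure P] (hs : IsSample P ν init Xs) {E : Type*}
    [MeasurableSpace E] {n : ℕ} {U : Ω → E} (hU : Measurable[past init Xs n] U) :
    IndepFun U (Xs n) P := by
  have hm : Measurable (fun ω (i : Finset.range n) => Xs i ω) :=
    measurable_pi_lambda _ fun i => hs.measurable_Xs i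
  have h1 : IndepFun init (fun ω => ((fun i : Finset.range n => Xs i ω), Xs n ω)) P := by
    refine hs.indep_init.comp (ψ := fun x : ℕ → ℝ => ((fun i : Finset.range n => x i), x n))
      measurable_id ?_
    exact (measurable_pi_lambda _ fun i => measurable_pi_apply _).prodMk (measurable_pi_apply _)
  have h2 : IndepFun (fun ω (i : Finset.range n) => Xs i ω) (Xs n) P := by
    have := hs.iIndep_Xs.indepFun_finset (Finset.range n) {n} (by simp) hs.measurable_Xs
    exact this.comp measurable_id
      (measurable_pi_apply (⟨n, Finset.mem_singleton_self n⟩ : ({n} : Finset ℕ)))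
  have h3 := indepFun_prodMk_left_of_prodMk_right hs.measurable_init hm (hs.measurable_Xs n) h1 h2
  rw [IndepFun_iff_Indep] at h3 ⊢
  exact indep_of_indep_of_le_left h3 (Measurable.comap_le hU)

end IsSample

end Independence

/-! ### Moment bounds for the Lyapunov function along the recursion. -/

section Rate

variable {v g h : ℝ → ℝ} {c B k : ℝ}

namespace IsProfile

lemma continuous_v (hp : IsProfile v g h c B k) : Continuous v :=
  continuous_iff_continuousAt.2 fun x => (hp.deriv_v x).continuousAt

lemma continuous_g (hp : IsProfile v g h c B k) : Continuous g :=
  continuous_iff_continuousAt.2 fun x => (hp.deriv_g x).continuousAt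

lemma measurable_lyap (hp : IsProfile v g h c B k) (q : ℕ) (μ : ℝ) : Measurable (lyap v q μ) := by
  have := hp.continuous_v.measurable
  unfold lyap
  fun_prop

lemma measurable_lyapDeriv (hp : IsProfile v g h c B k) (q : ℕ) (μ : ℝ) :
    Measurable (lyapDeriv v g q μ) := by
  have := hp.continuous_v.measurable
  have := hp.continuous_g.measurable
  unfold lyapDeriv
  fun_prop

lemma lyap_nonneg (hp : IsProfile v g h c B k) (q : ℕ) (μ x : ℝ) : 0 ≤ lyap v q μ x :=
  mul_nonneg (pow_nonneg (hp.v_nonneg x) _) (Real.exp_pos _).le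

/-- Makes the drift term integrable as soon as the Lyapunov function is. -/
lemma abs_lyapDeriv_le (hp : IsProfile v g h c B k) {q : ℕ} {μ : ℝ} (hμ : 0 ≤ μ) (x : ℝ) :
    |lyapDeriv v g q μ x| ≤ k * (q * Real.exp μ + (2 * q + μ) * lyap v q μ x) := by
  have hv := hp.v_nonneg x
  have hE := Real.exp_pos (μ * v x)
  have h1 : v x ^ (q - 1) ≤ 1 + v x ^ q := by
    rcases le_total (v x) 1 with h | h
    · linarith [pow_le_one₀ hv h (n := q - 1), pow_nonneg hv q]
    · linarith [pow_le_pow_right₀ h (Nat.sub_le q 1)]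
  have h2 : (q * v x ^ (q - 1) + μ * v x ^ q) * Real.exp (μ * v x)
      ≤ q * Real.exp μ + (2 * q + μ) * lyap v q μ x := by
    have e1 := exp_le_add_pow_mul_exp hv hμ q
    have e2 := mul_le_mul_of_nonneg_left e1 (Nat.cast_nonneg q : (0 : ℝ) ≤ q)
    have e3 := mul_le_mul_of_nonneg_right
      (mul_le_mul_of_nonneg_left h1 (Nat.cast_nonneg q : (0 : ℝ) ≤ q)) hE.le
    unfold lyap
    linarith
  unfold lyapDeriv
  rw [abs_mul, abs_of_nonneg (by positivity), mul_comm]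
  exact mul_le_mul (hp.g_le x) h2 (by positivity) hp.k_nonneg

lemma le_g_mul_lyapDeriv (hp : IsProfile v g h c B k) {q : ℕ} (hq : 1 ≤ q) {μ lam x : ℝ}
    (hd : lam * v x ≤ g x ^ 2 * (q + μ * v x)) :
    lam * lyap v q μ x ≤ g x * lyapDeriv v g q μ x := by
  obtain ⟨r, rfl⟩ : ∃ r, q = r + 1 := ⟨q - 1, by omega⟩
  have := mul_le_mul_of_nonneg_right hd
    (mul_nonneg (pow_nonneg (hp.v_nonneg x) r) (Real.exp_pos (μ * v x)).le)
  simp only [lyap, lyapDeriv, Nat.add_sub_cancel]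
  refine le_trans (le_of_eq ?_) (this.trans (le_of_eq ?_)) <;> ring

end IsProfile

variable {Ω : Type*} [MeasurableSpace Ω] {P : Measure Ω} [IsProbabilityMeasure P]
  {ν : Measure ℝ} {init : Ω → ℝ × ℝ} {Xs : ℕ → Ω → ℝ} {α : ℝ}

/-- Moments of the Lyapunov function along the recursion satisfy the one-step inequality. -/
lemma lyap_moment_step (hα₀ : 0 < α) (hα₁ : α < 1)
    (hp : IsProfile v g h c B (kConst α)) (hg : ∀ ξ, ∫ x, H₁ α ξ x ∂ν = g ξ)
    (hs : IsSample P ν init Xs) {q : ℕ} (hq : 1 ≤ q) {μ lam ε C Γ : ℝ} (hμ : 0 ≤ μ)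
    (hd : ∀ x, lam * v x ≤ g x ^ 2 * (q + μ * v x))
    (hstep : ∀ x H γ : ℝ, |H| ≤ kConst α →
      0 ≤ γ → γ ≤ Γ → lyap v q μ (x - γ * H)
        ≤ lyap v q μ x - γ * (H * lyapDeriv v g q μ x) + ε * γ * lyap v q μ x
          + C * γ ^ 2 * lyap v q μ x + C * γ ^ (q + 1))
    {γ : ℕ → ℝ} (n : ℕ) (hγ0 : 0 ≤ γ (n + 1)) (hγΓ : γ (n + 1) ≤ Γ)
    (hint : Integrable (fun ω => lyap v q μ (iter α γ (init ω) (fun m => Xs m ω) n).1) P) :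
    Integrable (fun ω => lyap v q μ (iter α γ (init ω) (fun m => Xs m ω) (n + 1)).1) P ∧
    ∫ ω, lyap v q μ (iter α γ (init ω) (fun m => Xs m ω) (n + 1)).1 ∂P
      ≤ (1 - (lam - ε) * γ (n + 1) + C * γ (n + 1) ^ 2)
          * ∫ ω, lyap v q μ (iter α γ (init ω) (fun m => Xs m ω) n).1 ∂P
        + C * γ (n + 1) ^ (q + 1) := by
  obtain ⟨U, hU⟩ : ∃ U : Ω → ℝ, U = fun ω => (iter α γ (init ω) (fun m => Xs m ω) n).1 := ⟨_, rfl⟩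
  have hUm' : Measurable[past init Xs n] U := by
    rw [hU]
    exact measurable_fst.comp (measurable_iter n)
  have hUm : Measurable U := hUm'.mono (hs.past_le n) le_rfl
  have hXm := hs.measurable_Xs n
  have hL := hp.measurable_lyap q μ
  have hD := hp.measurable_lyapDeriv q μ
  have hHm : Measurable (fun ω => H₁ α (U ω) (Xs n ω)) :=
    (measurable_H₁ α).comp (hUm.prodMk hXm)
  replace hint : Integrable (fun ω => lyap v q μ (U ω)) P := by rw [hU]; exact hint
  have hiter : ∀ ω, (iter α γ (init ω) (fun m => Xs m ω) (n + 1)).1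
      = U ω - γ (n + 1) * H₁ α (U ω) (Xs n ω) := fun ω => by rw [hU]; rfl
  simp only [hiter]
  rw [show (fun ω => lyap v q μ (iter α γ (init ω) (fun m => Xs m ω) n).1)
    = fun ω => lyap v q μ (U ω) by rw [hU]]
  have hDint : Integrable (fun ω => lyapDeriv v g q μ (U ω)) P := by
    refine Integrable.mono' (((integrable_const (q * Real.exp μ)).add
      (hint.const_mul (2 * q + μ))).const_mul (kConst α))
      (hD.comp hUm).aestronglyMeasurable (ae_of_all _ fun ω => ?_)
    exact hp.abs_lyapDeriv_le hμ (U ω)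
  have hHD : Integrable (fun ω => H₁ α (U ω) (Xs n ω) * lyapDeriv v g q μ (U ω)) P :=
    hDint.bdd_mul (c := kConst α) hHm.aestronglyMeasurable
      (ae_of_all _ fun ω => abs_H₁_le hα₀ hα₁ _ _)
  have hgD : Integrable (fun ω => g (U ω) * lyapDeriv v g q μ (U ω)) P :=
    hDint.bdd_mul (c := kConst α) (hp.continuous_g.measurable.comp hUm).aestronglyMeasurable
      (ae_of_all _ fun ω => hp.g_le _)
  have hνp : IsProbabilityMeasure ν := by
    rw [← hs.law_Xs n]
    exact Measure.isProbabilityMeasure_map hXm.aemeasurable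
  -- The current iterate depends only on the past, so the random direction may be replaced by its
  -- mean `g`.
  have hmean : ∫ ω, H₁ α (U ω) (Xs n ω) * lyapDeriv v g q μ (U ω) ∂P
      = ∫ ω, g (U ω) * lyapDeriv v g q μ (U ω) ∂P := by
    rw [← sub_eq_zero, ← integral_sub hHD hgD]
    have hmeas : Measurable (fun p : ℝ × ℝ =>
        H₁ α p.1 p.2 * lyapDeriv v g q μ p.1 - g p.1 * lyapDeriv v g q μ p.1) :=
      ((measurable_H₁ α).mul (hD.comp measurable_fst)).sub
        ((hp.continuous_g.measurable.comp measurable_fst).mul (hD.comp measurable_fst))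
    refine IndepFun.integral_eq_zero hUm hXm (hs.indepFun_past hUm') hmeas (hHD.sub hgD)
      fun u => ?_
    rw [hs.law_Xs n]
    have hHint : Integrable (fun x => H₁ α u x) ν :=
      Integrable.mono' (integrable_const (kConst α))
        ((measurable_H₁ α).comp measurable_prodMk_left).aestronglyMeasurable
        (ae_of_all _ fun x => abs_H₁_le hα₀ hα₁ _ _)
    simp only
    rw [integral_sub (hHint.mul_const _) (integrable_const _), integral_mul_const, hg u]
    simp
  have hL1 : Integrable (fun ω => (1 + ε * γ (n + 1) + C * γ (n + 1) ^ 2) * lyap v q μ (U ω)) P :=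
    hint.const_mul _
  have hD1 : Integrable (fun ω => γ (n + 1) * (H₁ α (U ω) (Xs n ω) * lyapDeriv v g q μ (U ω))) P :=
    hHD.const_mul _
  have hLD : Integrable (fun ω => (1 + ε * γ (n + 1) + C * γ (n + 1) ^ 2) * lyap v q μ (U ω)
      - γ (n + 1) * (H₁ α (U ω) (Xs n ω) * lyapDeriv v g q μ (U ω))) P := hL1.sub hD1
  have hbound : Integrable (fun ω => (1 + ε * γ (n + 1) + C * γ (n + 1) ^ 2) * lyap v q μ (U ω)
      - γ (n + 1) * (H₁ α (U ω) (Xs n ω) * lyapDeriv v g q μ (U ω))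
      + C * γ (n + 1) ^ (q + 1)) P := hLD.add (integrable_const _)
  have hle : ∀ ω, lyap v q μ (U ω - γ (n + 1) * H₁ α (U ω) (Xs n ω))
      ≤ (1 + ε * γ (n + 1) + C * γ (n + 1) ^ 2) * lyap v q μ (U ω)
      - γ (n + 1) * (H₁ α (U ω) (Xs n ω) * lyapDeriv v g q μ (U ω))
      + C * γ (n + 1) ^ (q + 1) := fun ω => by
    have := hstep (U ω) _ _ (abs_H₁_le hα₀ hα₁ (U ω) (Xs n ω)) hγ0 hγΓ
    linarith
  have hint' : Integrable (fun ω => lyap v q μ (U ω - γ (n + 1) * H₁ α (U ω) (Xs n ω))) P := by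
    refine Integrable.mono' hbound
      (hL.comp (hUm.sub (measurable_const.mul hHm))).aestronglyMeasurable (ae_of_all _ fun ω => ?_)
    rw [Real.norm_of_nonneg (hp.lyap_nonneg _ _ _)]
    exact hle ω
  refine ⟨hint', (integral_mono hint' hbound hle).trans ?_⟩
  have hlow : lam * ∫ ω, lyap v q μ (U ω) ∂P ≤ ∫ ω, g (U ω) * lyapDeriv v g q μ (U ω) ∂P := by
    rw [← integral_const_mul]
    exact integral_mono (hint.const_mul _) hgD fun ω => hp.le_g_mul_lyapDeriv hq (hd _)
  rw [integral_add hLD (integrable_const _), integral_sub hL1 hD1]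
  simp only [integral_const_mul, integral_const, probReal_univ, smul_eq_mul, one_mul]
  rw [hmean]
  have := mul_le_mul_of_nonneg_left hlow hγ0
  linarith

/-- Uniform rate for the moments of the Lyapunov function. -/
theorem lyap_rate (P : Measure Ω) [IsProbabilityMeasure P] (hα₀ : 0 < α) (hα₁ : α < 1)
    {γ₁ β : ℝ} (hγ₁ : 0 < γ₁) (hβ₀ : 0 < β) (hβ₁ : β ≤ 1) {q : ℕ} (hq : q = 1 ∨ q = 2)
    {μ lam A : ℝ} (hB : 0 < B) (hμ : 0 ≤ μ) (hlam : 0 < lam)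
    (hlamq : β = 1 → (q : ℝ) < lam * γ₁) (hA : 0 ≤ A) :
    ∃ U, 0 ≤ U ∧ ∀ (v g h : ℝ → ℝ) (c : ℝ) (ν : Measure ℝ) (init : Ω → ℝ × ℝ) (Xs : ℕ → Ω → ℝ),
      IsProfile v g h c B (kConst α) → (∀ ξ, ∫ x, H₁ α ξ x ∂ν = g ξ) → IsSample P ν init Xs →
      (∀ x, lam * v x ≤ g x ^ 2 * (q + μ * v x)) →
      Integrable (fun ω => lyap v q μ (init ω).1) P → ∫ ω, lyap v q μ (init ω).1 ∂P ≤ A →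
      ∀ n, Integrable (fun ω => lyap v q μ
          (iter α (step γ₁ β) (init ω) (fun m => Xs m ω) n).1) P ∧
        ∫ ω, lyap v q μ (iter α (step γ₁ β) (init ω) (fun m => Xs m ω) n).1 ∂P
          ≤ U * step γ₁ β (n + 1) ^ q := by
  -- A small part `ε` of `lam` is sacrificed to the `ε γ L` term of `lyap_step`; when `β = 1` the
  -- strict inequality leaves room for it.
  obtain ⟨ε, hε, hlε, hqε⟩ : ∃ ε > 0, 0 < lam - ε ∧ (β = 1 → (q : ℝ) < (lam - ε) * γ₁) := by
    by_cases hβ : β = 1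
    · have h1 : (q : ℝ) / γ₁ < lam := by
        rw [div_lt_iff₀ hγ₁]
        exact hlamq hβ
      have h2 : 0 ≤ (q : ℝ) / γ₁ := by positivity
      refine ⟨(lam - q / γ₁) / 2, by linarith, by linarith, fun _ => ?_⟩
      rw [← div_lt_iff₀ hγ₁]
      linarith
    · exact ⟨lam / 2, by linarith, by linarith, fun h => absurd h hβ⟩
  -- `C` and then `U` are chosen before the profile, the law and the samples: this is the source of
  -- uniformity in `h`.
  obtain ⟨C, hC, hstep⟩ := lyap_step (B := B) (k := kConst α) (Γ := γ₁) hq hB hμ hε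
  obtain ⟨U, hU, hrate⟩ := StepRec.rate (q := q) hγ₁ hβ₀ hβ₁ hlε hqε hC hA
  have hq1 : 1 ≤ q := by omega
  refine ⟨U, hU, fun v g h c ν init Xs hp hg hs hd hint hle => ?_⟩
  have hmom := fun n hi => lyap_moment_step hα₀ hα₁ hp hg hs hq1 hμ hd (hstep v g h c hp)
    (γ := step γ₁ β) n (step_pos hγ₁ (by omega)).le (step_le hγ₁ hβ₀ (by omega)) hi
  have hI : ∀ n, Integrable (fun ω => lyap v q μ
      (iter α (step γ₁ β) (init ω) (fun m => Xs m ω) n).1) P := fun n => by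
    induction n with
    | zero => exact hint
    | succ n ih => exact (hmom n ih).1
  exact fun n => ⟨hI n, hrate (fun n => ∫ ω, lyap v q μ
    (iter α (step γ₁ β) (init ω) (fun m => Xs m ω) n).1 ∂P) (fun n => integral_nonneg fun ω => hp.lyap_nonneg _ _ _) hle
    (fun n => (hmom n (hI n)).2) n⟩

end Rate

/-! ### Rates for the averaged iterate `χ`. -/

section Averaging

lemma sum_inv_sqrt_le (n : ℕ) :
    ∑ i ∈ Finset.range n, (√((i : ℝ) + 1))⁻¹ ≤ 2 * √(n : ℝ) := by
  induction n with
  | zero => simp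
  | succ n ih =>
    rw [Finset.sum_range_succ]
    have h1 : (√((n : ℝ) + 1)) ^ 2 = (n : ℝ) + 1 := Real.sq_sqrt (by positivity)
    have h2 : (√(n : ℝ)) ^ 2 = n := Real.sq_sqrt (by positivity)
    have h3 : 0 < √((n : ℝ) + 1) := Real.sqrt_pos.2 (by positivity)
    have h4 : (√((n : ℝ) + 1))⁻¹ ≤ 2 * √((n : ℝ) + 1) - 2 * √(n : ℝ) := by
      rw [inv_le_iff_one_le_mul₀ h3]
      nlinarith [sq_nonneg (√((n : ℝ) + 1) - √(n : ℝ))]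
    push_cast
    linarith

/-- Each term is at most `n^{1/2 - b}` times `(i+1)^{-1/2}`, which reduces the sum to the exponent
`1/2`, with the same constant for all `b ≤ 1/2`. -/
lemma sum_rpow_neg_le {b : ℝ} (hb : b ≤ 1 / 2) {n : ℕ} (hn : 1 ≤ n) :
    ∑ i ∈ Finset.range n, ((i : ℝ) + 1) ^ (-b) ≤ 2 * (n : ℝ) * (n : ℝ) ^ (-b) := by
  have hn0 : (0 : ℝ) < n := by exact_mod_cast hn
  have h1 : ∀ i ∈ Finset.range n, ((i : ℝ) + 1) ^ (-b)
      ≤ (n : ℝ) ^ (1 / 2 - b) * (√((i : ℝ) + 1))⁻¹ := fun i hi => by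
    have hi0 : (0 : ℝ) < (i : ℝ) + 1 := by positivity
    have hin : (i : ℝ) + 1 ≤ n := by exact_mod_cast Finset.mem_range.1 hi
    rw [Real.sqrt_eq_rpow, ← Real.rpow_neg hi0.le]
    calc ((i : ℝ) + 1) ^ (-b) = ((i : ℝ) + 1) ^ (1 / 2 - b) * ((i : ℝ) + 1) ^ (-(1 / 2 : ℝ)) := by
          rw [← Real.rpow_add hi0]
          congr 1
          ring
      _ ≤ _ := mul_le_mul_of_nonneg_right (Real.rpow_le_rpow hi0.le hin (by linarith))
          (Real.rpow_nonneg hi0.le _)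
  refine (Finset.sum_le_sum h1).trans ?_
  rw [← Finset.mul_sum]
  refine (mul_le_mul_of_nonneg_left (sum_inv_sqrt_le n) (Real.rpow_nonneg hn0.le _)).trans
    (le_of_eq ?_)
  have h2 : (n : ℝ) ^ (1 / 2 - b) * √(n : ℝ) = n * (n : ℝ) ^ (-b) := by
    rw [Real.sqrt_eq_rpow, ← Real.rpow_add hn0, ← Real.rpow_one_add' hn0.le]
    · congr 1
      ring
    · linarith
  linarith

section Pathwise

variable {Ω : Type*} {init : Ω → ℝ × ℝ} {Xs : ℕ → Ω → ℝ} {α : ℝ} {W : ℝ → ℝ}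

/-- The integrand `ξ + (1 - α)⁻¹ (x - ξ)⁺` of `V`. -/
def valueSample (α ξ x : ℝ) : ℝ := ξ + 1 / (1 - α) * max (x - ξ) 0

lemma measurable_valueSample (α : ℝ) : Measurable (fun p : ℝ × ℝ => valueSample α p.1 p.2) := by
  unfold valueSample
  fun_prop

/-- The sum of the centred samples of `V` along the recursion. -/
def noiseSum (α : ℝ) (γ : ℕ → ℝ) (W : ℝ → ℝ) (init : Ω → ℝ × ℝ) (Xs : ℕ → Ω → ℝ) (n : ℕ)
    (ω : Ω) : ℝ :=
  ∑ i ∈ Finset.range n, (valueSample α (iter α γ (init ω) (fun m => Xs m ω) i).1 (Xs i ω)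
    - W (iter α γ (init ω) (fun m => Xs m ω) i).1)

/-- The factor `n` vanishes at `n = 0`, so the initial value of `χ` leaves no trace in later
iterates. -/
lemma mul_chi_eq (α : ℝ) (γ : ℕ → ℝ) (p : ℝ × ℝ) (x : ℕ → ℝ) (n : ℕ) :
    n * (iter α γ p x n).2 = ∑ i ∈ Finset.range n, valueSample α (iter α γ p x i).1 (x i) := by
  induction n with
  | zero => simp
  | succ n ih =>
    rw [Finset.sum_range_succ, ← ih]
    have h : (n : ℝ) + 1 ≠ 0 := by positivity
    simp only [iter, H₂, valueSample]
    push_cast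
    field_simp
    ring

lemma mul_chi_sub_eq (α : ℝ) (γ : ℕ → ℝ) (W : ℝ → ℝ) (χ : ℝ) (n : ℕ) (ω : Ω) :
    n * ((iter α γ (init ω) (fun m => Xs m ω) n).2 - χ) = noiseSum α γ W init Xs n ω
      + ∑ i ∈ Finset.range n, (W (iter α γ (init ω) (fun m => Xs m ω) i).1 - χ) := by
  unfold noiseSum
  rw [mul_sub, mul_chi_eq, ← Finset.sum_add_distrib, ← nsmul_eq_mul, ← Finset.card_range n,
    ← Finset.sum_const, Finset.card_range, ← Finset.sum_sub_distrib]
  exact Finset.sum_congr rfl fun i _ => by ring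

lemma measurable_past_noise {γ : ℕ → ℝ} (hWm : Measurable W) {i n : ℕ} (hi : i < n) :
    Measurable[past init Xs n] (fun ω =>
      valueSample α (iter α γ (init ω) (fun m => Xs m ω) i).1 (Xs i ω)
        - W (iter α γ (init ω) (fun m => Xs m ω) i).1) := by
  have h1 : Measurable[past init Xs n] (fun ω => (iter α γ (init ω) (fun m => Xs m ω) i).1) :=
    (measurable_fst.comp (measurable_iter i)).mono (past_mono hi.le) le_rfl
  have h2 := measurable_past_sample (init := init) (Xs := Xs) hi
  exact ((measurable_valueSample α).comp (h1.prodMk h2)).sub (hWm.comp h1)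

lemma measurable_past_noiseSum {γ : ℕ → ℝ} (hWm : Measurable W) (n : ℕ) :
    Measurable[past init Xs n] (noiseSum α γ W init Xs n) :=
  Finset.measurable_sum _ fun _ hi => measurable_past_noise hWm (Finset.mem_range.1 hi)

end Pathwise

variable {Ω : Type*} [MeasurableSpace Ω] {P : Measure Ω} {ν : Measure ℝ}
  {init : Ω → ℝ × ℝ} {Xs : ℕ → Ω → ℝ} {α : ℝ}

section Noise

variable {W : ℝ → ℝ} [IsProbabilityMeasure ν]

/-- Both terms are compared with the sample at `x = 0`. The bound is free of `ξ`, so the noise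
variance does not depend on where the iterate is. -/
lemma abs_valueSample_sub_le (hα₁ : α < 1) (hν : Integrable (fun x => x) ν)
    (hW : ∀ ξ, ∫ x, valueSample α ξ x ∂ν = W ξ) (ξ x : ℝ) :
    |valueSample α ξ x - W ξ| ≤ 1 / (1 - α) * (|x| + ∫ y, |y| ∂ν) := by
  have hκ : 0 ≤ 1 / (1 - α) := by
    apply div_nonneg zero_le_one
    linarith
  have h1 : ∀ y, |valueSample α ξ y - valueSample α ξ 0| ≤ 1 / (1 - α) * |y| := fun y => by
    unfold valueSample
    rw [show ξ + 1 / (1 - α) * max (y - ξ) 0 - (ξ + 1 / (1 - α) * max (0 - ξ) 0)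
      = 1 / (1 - α) * (max (y - ξ) 0 - max (0 - ξ) 0) by ring, abs_mul, abs_of_nonneg hκ]
    apply mul_le_mul_of_nonneg_left _ hκ
    refine (abs_max_sub_max_le_abs _ _ _).trans (le_of_eq ?_)
    rw [show y - ξ - (0 - ξ) = y by ring]
  have hint : Integrable (fun y => valueSample α ξ y) ν :=
    (integrable_const ξ).add (((hν.sub (integrable_const ξ)).pos_part).const_mul _)
  have h2 : |valueSample α ξ 0 - W ξ| ≤ 1 / (1 - α) * ∫ y, |y| ∂ν := by
    have e : valueSample α ξ 0 - W ξ = ∫ y, (valueSample α ξ 0 - valueSample α ξ y) ∂ν := by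
      rw [integral_sub (integrable_const _) hint, hW]
      simp
    rw [e, ← integral_const_mul]
    refine (abs_integral_le_integral_abs).trans (integral_mono_of_nonneg
      (ae_of_all _ fun y => abs_nonneg _) (hν.abs.const_mul _) (ae_of_all _ fun y => ?_))
    simpa [abs_sub_comm] using h1 y
  calc |valueSample α ξ x - W ξ|
      ≤ |valueSample α ξ x - valueSample α ξ 0| + |valueSample α ξ 0 - W ξ| :=
        abs_sub_le _ _ _
    _ ≤ _ := by rw [mul_add]; exact add_le_add (h1 x) h2

/-- Bound on the variance of one sample of `V`, for a law with second moment at most `s`. -/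
def noiseVar (α s : ℝ) : ℝ := 2 * (1 / (1 - α)) ^ 2 * (s + (1 + s) ^ 2)

variable [IsProbabilityMeasure P]

lemma memLp_noise (hα₁ : α < 1) (hs : IsSample P ν init Xs) {γ : ℕ → ℝ} (hWm : Measurable W)
    (hW : ∀ ξ, ∫ x, valueSample α ξ x ∂ν = W ξ) (hν : MemLp (fun x => x) 2 ν) {s : ℝ}
    (hνs : ∫ x, x ^ 2 ∂ν ≤ s) (i : ℕ) :
    MemLp (fun ω => valueSample α (iter α γ (init ω) (fun m => Xs m ω) i).1 (Xs i ω)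
        - W (iter α γ (init ω) (fun m => Xs m ω) i).1) 2 P ∧
    ∫ ω, (valueSample α (iter α γ (init ω) (fun m => Xs m ω) i).1 (Xs i ω)
        - W (iter α γ (init ω) (fun m => Xs m ω) i).1) ^ 2 ∂P ≤ noiseVar α s := by
  have hκ : 0 ≤ 1 / (1 - α) := by
    apply div_nonneg zero_le_one
    linarith
  have hν1 : Integrable (fun x => x) ν := hν.integrable (by norm_num)
  have hXi : AEMeasurable (Xs i) P := (hs.measurable_Xs i).aemeasurable
  have hX : MemLp (Xs i) 2 P := by
    rw [← hs.law_Xs i] at hν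
    exact (memLp_map_measure_iff (g := fun x => x) (by fun_prop) hXi).1 hν
  have hX2 : ∫ ω, Xs i ω ^ 2 ∂P ≤ s := by
    rw [← integral_map (φ := Xs i) (f := fun x => x ^ 2) hXi (by fun_prop), hs.law_Xs i]
    exact hνs
  obtain ⟨m, hm⟩ : ∃ m, m = ∫ y, |y| ∂ν := ⟨_, rfl⟩
  have hm0 : 0 ≤ m := hm ▸ integral_nonneg fun _ => abs_nonneg _
  have hms : m ≤ 1 + s := by
    have h1 : m ≤ ∫ y, (1 + y ^ 2) ∂ν := by
      rw [hm]
      refine integral_mono hν1.abs ((integrable_const 1).add hν.integrable_sq) fun y => ?_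
      simp only
      nlinarith [sq_nonneg (|y| - 1), sq_abs y, abs_nonneg y]
    rw [integral_add (integrable_const 1) hν.integrable_sq] at h1
    simp only [integral_const, probReal_univ, smul_eq_mul, mul_one] at h1
    linarith
  have hb : ∀ ω, |valueSample α (iter α γ (init ω) (fun m => Xs m ω) i).1 (Xs i ω)
      - W (iter α γ (init ω) (fun m => Xs m ω) i).1| ≤ 1 / (1 - α) * (|Xs i ω| + m) := fun ω => by
    rw [hm]
    exact abs_valueSample_sub_le hα₁ hν1 hW _ _
  have hmeas := (measurable_past_noise (init := init) (Xs := Xs) (α := α) (γ := γ) hWm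
    i.lt_succ_self).mono (hs.past_le _) le_rfl
  have hmem := MemLp.of_le (((hX.abs.add (memLp_const m)).const_mul (1 / (1 - α))))
    hmeas.aestronglyMeasurable (ae_of_all _ fun ω => by
      refine (hb ω).trans (le_abs_self _))
  refine ⟨hmem, ?_⟩
  have hi2 : Integrable (fun ω => 2 * (1 / (1 - α)) ^ 2 * (Xs i ω ^ 2 + m ^ 2)) P :=
    (hX.integrable_sq.add (integrable_const _)).const_mul _
  refine (integral_mono hmem.integrable_sq hi2 fun ω => ?_).trans ?_
  · have h1 := pow_le_pow_left₀ (abs_nonneg _) (hb ω) 2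
    rw [sq_abs] at h1
    refine h1.trans ?_
    rw [mul_pow]
    have h2 : (|Xs i ω| + m) ^ 2 ≤ 2 * (Xs i ω ^ 2 + m ^ 2) := by
      nlinarith [sq_nonneg (|Xs i ω| - m), sq_abs (Xs i ω)]
    have := mul_le_mul_of_nonneg_left h2 (sq_nonneg (1 / (1 - α)))
    linarith
  · rw [integral_const_mul, integral_add hX.integrable_sq (integrable_const _)]
    simp only [integral_const, probReal_univ, smul_eq_mul, one_mul]
    unfold noiseVar
    have : m ^ 2 ≤ (1 + s) ^ 2 := pow_le_pow_left₀ hm0 hms 2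
    gcongr

lemma memLp_noiseSum (hα₁ : α < 1) (hs : IsSample P ν init Xs) {γ : ℕ → ℝ} (hWm : Measurable W)
    (hW : ∀ ξ, ∫ x, valueSample α ξ x ∂ν = W ξ) (hν : MemLp (fun x => x) 2 ν) (n : ℕ) :
    MemLp (noiseSum α γ W init Xs n) 2 P :=
  memLp_finsetSum _ fun i _ => (memLp_noise hα₁ hs hWm hW hν le_rfl i).1

/-- Martingale orthogonality: each new increment is centred given the past, so cross terms vanish
and variances add. -/
lemma integral_sq_noiseSum_le (hα₁ : α < 1) (hs : IsSample P ν init Xs) {γ : ℕ → ℝ}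
    (hWm : Measurable W) (hW : ∀ ξ, ∫ x, valueSample α ξ x ∂ν = W ξ)
    (hν : MemLp (fun x => x) 2 ν) {s : ℝ} (hνs : ∫ x, x ^ 2 ∂ν ≤ s) (n : ℕ) :
    ∫ ω, noiseSum α γ W init Xs n ω ^ 2 ∂P ≤ n * noiseVar α s := by
  induction n with
  | zero => simp [noiseSum]
  | succ n ih =>
    obtain ⟨S, hS⟩ : ∃ S, S = noiseSum α γ W init Xs n := ⟨_, rfl⟩
    obtain ⟨U, hU⟩ : ∃ U : Ω → ℝ, U = fun ω => (iter α γ (init ω) (fun m => Xs m ω) n).1 :=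
      ⟨_, rfl⟩
    obtain ⟨hΔ, hΔ2⟩ := memLp_noise (γ := γ) hα₁ hs hWm hW hν hνs n
    have hU' : ∀ ω, (iter α γ (init ω) (fun m => Xs m ω) n).1 = U ω := fun ω => by rw [hU]
    simp only [hU'] at hΔ hΔ2
    have hSm := memLp_noiseSum (γ := γ) hα₁ hs hWm hW hν n
    rw [← hS] at ih hSm
    have hsucc : ∀ ω, noiseSum α γ W init Xs (n + 1) ω
        = S ω + (valueSample α (U ω) (Xs n ω) - W (U ω)) := fun ω => by
      rw [hS, hU]
      exact Finset.sum_range_succ _ _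
    have hcross : ∫ ω, S ω * (valueSample α (U ω) (Xs n ω) - W (U ω)) ∂P = 0 := by
      have hSp : Measurable[past init Xs n] S := hS ▸ measurable_past_noiseSum hWm n
      have hUp : Measurable[past init Xs n] U := by
        rw [hU]
        exact measurable_fst.comp (measurable_iter n)
      have hSU : Measurable[past init Xs n] (fun ω => (S ω, U ω)) := hSp.prodMk hUp
      have hφ : Measurable (fun p : (ℝ × ℝ) × ℝ =>
          p.1.1 * (valueSample α p.1.2 p.2 - W p.1.2)) :=
        measurable_fst.fst.mul (((measurable_valueSample α).comp
          (measurable_fst.snd.prodMk measurable_snd)).sub (hWm.comp measurable_fst.snd))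
      refine IndepFun.integral_eq_zero (hSU.mono (hs.past_le n) le_rfl) (hs.measurable_Xs n)
        (hs.indepFun_past hSU) hφ (hSm.integrable_mul hΔ) fun u => ?_
      rw [hs.law_Xs n]
      have hν1 : Integrable (fun x => x) ν := hν.integrable (by norm_num)
      have hint : Integrable (fun y => valueSample α u.2 y) ν :=
        (integrable_const u.2).add (((hν1.sub (integrable_const u.2)).pos_part).const_mul _)
      simp only
      rw [integral_const_mul, integral_sub hint (integrable_const _), hW]
      simp
    have hexp : ∀ ω, (S ω + (valueSample α (U ω) (Xs n ω) - W (U ω))) ^ 2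
        = S ω ^ 2 + 2 * (S ω * (valueSample α (U ω) (Xs n ω) - W (U ω)))
          + (valueSample α (U ω) (Xs n ω) - W (U ω)) ^ 2 := fun ω => by ring
    have hi1 : Integrable (fun ω => 2 * (S ω * (valueSample α (U ω) (Xs n ω) - W (U ω)))) P :=
      (hSm.integrable_mul hΔ).const_mul 2
    have hi2 : Integrable (fun ω => S ω ^ 2
      + 2 * (S ω * (valueSample α (U ω) (Xs n ω) - W (U ω)))) P := hSm.integrable_sq.add hi1
    simp only [hsucc, hexp]
    rw [integral_add hi2 hΔ.integrable_sq, integral_add hSm.integrable_sq hi1,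
      integral_const_mul, hcross]
    push_cast
    linarith

/-- `L¹` rate of the averaged iterates. -/
theorem chi_rate_one (hα₁ : α < 1) (hs : IsSample P ν init Xs) {γ : ℕ → ℝ}
    (hWm : Measurable W) (hW : ∀ ξ, ∫ x, valueSample α ξ x ∂ν = W ξ)
    (hν : MemLp (fun x => x) 2 ν) {s : ℝ} (hνs : ∫ x, x ^ 2 ∂ν ≤ s) {χ : ℝ}
    (hχ : ∀ ξ, χ ≤ W ξ) {U b : ℝ} (hb : b ≤ 1 / 2) (hU0 : 0 ≤ U)
    (hU : ∀ i : ℕ, Integrable (fun ω => W (iter α γ (init ω) (fun m => Xs m ω) i).1 - χ) P ∧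
      ∫ ω, (W (iter α γ (init ω) (fun m => Xs m ω) i).1 - χ) ∂P ≤ U * ((i : ℝ) + 1) ^ (-b))
    {n : ℕ} (hn : 1 ≤ n) :
    Integrable (fun ω => |(iter α γ (init ω) (fun m => Xs m ω) n).2 - χ|) P ∧
    ∫ ω, |(iter α γ (init ω) (fun m => Xs m ω) n).2 - χ| ∂P
      ≤ ((1 + noiseVar α s) / 2 + 2 * U) * (n : ℝ) ^ (-b) := by
  have hn0 : (0 : ℝ) < n := by exact_mod_cast hn
  have hsq : 0 < √(n : ℝ) := Real.sqrt_pos.2 hn0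
  have hsq2 : √(n : ℝ) * √(n : ℝ) = n := Real.mul_self_sqrt hn0.le
  have hSm := memLp_noiseSum (γ := γ) hα₁ hs hWm hW hν n
  have hS2 := integral_sq_noiseSum_le (γ := γ) hα₁ hs hWm hW hν hνs n
  obtain ⟨S, hS⟩ : ∃ S, S = noiseSum α γ W init Xs n := ⟨_, rfl⟩
  rw [← hS] at hSm hS2
  have hbound : ∀ ω, |(iter α γ (init ω) (fun m => Xs m ω) n).2 - χ|
      ≤ (n : ℝ)⁻¹ * ((√(n : ℝ) + (√(n : ℝ))⁻¹ * S ω ^ 2) / 2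
        + ∑ i ∈ Finset.range n, (W (iter α γ (init ω) (fun m => Xs m ω) i).1 - χ)) := fun ω => by
    have h1 := mul_chi_sub_eq (init := init) (Xs := Xs) α γ W χ n ω
    rw [← hS] at h1
    have h2 : |(n : ℝ) * ((iter α γ (init ω) (fun m => Xs m ω) n).2 - χ)|
        ≤ |S ω| + ∑ i ∈ Finset.range n, (W (iter α γ (init ω) (fun m => Xs m ω) i).1 - χ) := by
      rw [h1]
      refine (abs_add_le _ _).trans (add_le_add_right (le_of_eq (abs_of_nonneg ?_)) _)
      exact Finset.sum_nonneg fun i _ => sub_nonneg.2 (hχ _)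
    -- Weighted arithmetic-geometric inequality; since `𝔼[S²] = O(n)`, it yields `𝔼|S| = O(√n)`
    -- directly.
    have h3 : |S ω| ≤ (√(n : ℝ) + (√(n : ℝ))⁻¹ * S ω ^ 2) / 2 := by
      have e1 : 0 ≤ (√(n : ℝ))⁻¹ * (√(n : ℝ) - |S ω|) ^ 2 := by positivity
      have e2 : (√(n : ℝ))⁻¹ * (√(n : ℝ) - |S ω|) ^ 2
          = √(n : ℝ) - 2 * |S ω| + (√(n : ℝ))⁻¹ * S ω ^ 2 := by
        rw [← sq_abs (S ω)]
        field_simp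
        ring
      linarith
    rw [abs_mul, abs_of_pos hn0] at h2
    rw [le_inv_mul_iff₀ hn0]
    linarith
  have hsumint : Integrable (fun ω => ∑ i ∈ Finset.range n,
      (W (iter α γ (init ω) (fun m => Xs m ω) i).1 - χ)) P :=
    integrable_finsetSum _ fun i _ => (hU i).1
  have hSint : Integrable (fun ω => (√(n : ℝ) + (√(n : ℝ))⁻¹ * S ω ^ 2) / 2) P :=
    ((integrable_const _).add (hSm.integrable_sq.const_mul _)).div_const 2
  have hbint : Integrable (fun ω => (n : ℝ)⁻¹ * ((√(n : ℝ) + (√(n : ℝ))⁻¹ * S ω ^ 2) / 2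
      + ∑ i ∈ Finset.range n, (W (iter α γ (init ω) (fun m => Xs m ω) i).1 - χ))) P :=
    (hSint.add hsumint).const_mul _
  have hmeas : Measurable (fun ω => |(iter α γ (init ω) (fun m => Xs m ω) n).2 - χ|) := by
    have h := (measurable_iter (init := init) (Xs := Xs) (α := α) (γ := γ) n).mono
      (hs.past_le n) le_rfl
    exact (h.snd.sub_const χ).abs
  have hint : Integrable (fun ω => |(iter α γ (init ω) (fun m => Xs m ω) n).2 - χ|) P := by
    refine hbint.mono' hmeas.aestronglyMeasurable (ae_of_all _ fun ω => ?_)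
    rw [Real.norm_of_nonneg (abs_nonneg _)]
    exact hbound ω
  refine ⟨hint, (integral_mono hint hbint hbound).trans ?_⟩
  rw [integral_const_mul, integral_add hSint hsumint, integral_div,
    integral_add (integrable_const _) (hSm.integrable_sq.const_mul _), integral_const_mul,
    integral_finsetSum _ fun i _ => (hU i).1]
  simp only [integral_const, probReal_univ, smul_eq_mul, one_mul]
  have h1 : ∑ i ∈ Finset.range n, ∫ ω, (W (iter α γ (init ω) (fun m => Xs m ω) i).1 - χ) ∂P
      ≤ U * (2 * n * (n : ℝ) ^ (-b)) := by
    refine (Finset.sum_le_sum fun i _ => (hU i).2).trans ?_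
    rw [← Finset.mul_sum]
    exact mul_le_mul_of_nonneg_left (sum_rpow_neg_le hb hn) hU0
  have h2 : (√(n : ℝ))⁻¹ * ∫ ω, S ω ^ 2 ∂P ≤ √(n : ℝ) * noiseVar α s := by
    rw [inv_mul_le_iff₀ hsq, ← mul_assoc, hsq2]
    exact hS2
  have hvar : 0 ≤ noiseVar α s := by
    have : 0 ≤ (n : ℝ) * noiseVar α s := (integral_nonneg fun _ => sq_nonneg _).trans hS2
    exact (mul_nonneg_iff_of_pos_left hn0).1 this
  have h3 : √(n : ℝ) ≤ n * (n : ℝ) ^ (-b) := by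
    have e : (n : ℝ) * (n : ℝ) ^ (-b) = (n : ℝ) ^ (1 + -b) := by
      rw [Real.rpow_add hn0, Real.rpow_one]
    rw [e, Real.sqrt_eq_rpow]
    exact Real.rpow_le_rpow_of_exponent_le (by exact_mod_cast hn) (by linarith)
  have h4 := mul_le_mul_of_nonneg_right h3 (by positivity : 0 ≤ (1 + noiseVar α s) / 2)
  rw [inv_mul_le_iff₀ hn0]
  linarith

/-- `L²` rate of the averaged iterates. -/
theorem chi_rate_two (hα₁ : α < 1) (hs : IsSample P ν init Xs) {γ : ℕ → ℝ}
    (hWm : Measurable W) (hW : ∀ ξ, ∫ x, valueSample α ξ x ∂ν = W ξ)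
    (hν : MemLp (fun x => x) 2 ν) {s : ℝ} (hνs : ∫ x, x ^ 2 ∂ν ≤ s) {χ : ℝ}
    {U b : ℝ} (hb : b ≤ 1 / 2) (hU0 : 0 ≤ U)
    (hU : ∀ i : ℕ,
      Integrable (fun ω => (W (iter α γ (init ω) (fun m => Xs m ω) i).1 - χ) ^ 2) P ∧
      ∫ ω, (W (iter α γ (init ω) (fun m => Xs m ω) i).1 - χ) ^ 2 ∂P
        ≤ U * (((i : ℝ) + 1) ^ (-b)) ^ 2)
    {n : ℕ} (hn : 1 ≤ n) :
    Integrable (fun ω => ((iter α γ (init ω) (fun m => Xs m ω) n).2 - χ) ^ 2) P ∧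
    ∫ ω, ((iter α γ (init ω) (fun m => Xs m ω) n).2 - χ) ^ 2 ∂P
      ≤ (2 * noiseVar α s + 8 * U) * ((n : ℝ) ^ (-b)) ^ 2 := by
  have hn0 : (0 : ℝ) < n := by exact_mod_cast hn
  have hSm := memLp_noiseSum (γ := γ) hα₁ hs hWm hW hν n
  have hS2 := integral_sq_noiseSum_le (γ := γ) hα₁ hs hWm hW hν hνs n
  obtain ⟨S, hS⟩ : ∃ S, S = noiseSum α γ W init Xs n := ⟨_, rfl⟩
  rw [← hS] at hSm hS2
  obtain ⟨w, hw⟩ : ∃ w : ℕ → ℝ, w = fun i : ℕ => ((i : ℝ) + 1) ^ (-b) := ⟨_, rfl⟩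
  have hw0 : ∀ i, 0 < w i := fun i => by
    rw [hw]
    exact Real.rpow_pos_of_pos (by positivity) _
  obtain ⟨T, hT⟩ : ∃ T, T = ∑ i ∈ Finset.range n, w i := ⟨_, rfl⟩
  have hT0 : 0 ≤ T := hT ▸ Finset.sum_nonneg fun i _ => (hw0 i).le
  have hTn : T ≤ 2 * n * (n : ℝ) ^ (-b) := by
    rw [hT, hw]
    exact sum_rpow_neg_le hb hn
  have hbound : ∀ ω, ((iter α γ (init ω) (fun m => Xs m ω) n).2 - χ) ^ 2
      ≤ ((n : ℝ) ^ 2)⁻¹ * (2 * S ω ^ 2 + 2 * (T * ∑ i ∈ Finset.range n,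
        (w i)⁻¹ * (W (iter α γ (init ω) (fun m => Xs m ω) i).1 - χ) ^ 2)) := fun ω => by
    have h1 := mul_chi_sub_eq (init := init) (Xs := Xs) α γ W χ n ω
    rw [← hS] at h1
    -- Cauchy-Schwarz with weights `w i = (i+1)^{-b}`, the expected size of the `i`-th excess. After
    -- taking means the last sum is at most `U T`.
    have h2 : (∑ i ∈ Finset.range n, (W (iter α γ (init ω) (fun m => Xs m ω) i).1 - χ)) ^ 2
        ≤ T * ∑ i ∈ Finset.range n,
          (w i)⁻¹ * (W (iter α γ (init ω) (fun m => Xs m ω) i).1 - χ) ^ 2 := by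
      rw [hT]
      refine Finset.sum_sq_le_sum_mul_sum_of_sq_le_mul _ (fun i _ => (hw0 i).le)
        (fun i _ => mul_nonneg (inv_nonneg.2 (hw0 i).le) (sq_nonneg _)) fun i _ => ?_
      rw [← mul_assoc, mul_inv_cancel₀ (hw0 i).ne', one_mul]
    rw [le_inv_mul_iff₀ (by positivity), ← mul_pow, h1]
    nlinarith [sq_nonneg (S ω
      - ∑ i ∈ Finset.range n, (W (iter α γ (init ω) (fun m => Xs m ω) i).1 - χ))]
  have hsumint : Integrable (fun ω => ∑ i ∈ Finset.range n,
      (w i)⁻¹ * (W (iter α γ (init ω) (fun m => Xs m ω) i).1 - χ) ^ 2) P :=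
    integrable_finsetSum _ fun i _ => (hU i).1.const_mul _
  have hi1 : Integrable (fun ω => 2 * S ω ^ 2) P := hSm.integrable_sq.const_mul 2
  have hi2 : Integrable (fun ω => 2 * (T * ∑ i ∈ Finset.range n,
      (w i)⁻¹ * (W (iter α γ (init ω) (fun m => Xs m ω) i).1 - χ) ^ 2)) P :=
    (hsumint.const_mul T).const_mul 2
  have hbint : Integrable (fun ω => ((n : ℝ) ^ 2)⁻¹ * (2 * S ω ^ 2
      + 2 * (T * ∑ i ∈ Finset.range n,
        (w i)⁻¹ * (W (iter α γ (init ω) (fun m => Xs m ω) i).1 - χ) ^ 2))) P :=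
    (hi1.add hi2).const_mul _
  have hmeas : Measurable (fun ω => ((iter α γ (init ω) (fun m => Xs m ω) n).2 - χ) ^ 2) := by
    have h := (measurable_iter (init := init) (Xs := Xs) (α := α) (γ := γ) n).mono
      (hs.past_le n) le_rfl
    exact (h.snd.sub_const χ).pow_const 2
  have hint : Integrable (fun ω => ((iter α γ (init ω) (fun m => Xs m ω) n).2 - χ) ^ 2) P := by
    refine hbint.mono' hmeas.aestronglyMeasurable (ae_of_all _ fun ω => ?_)
    rw [Real.norm_of_nonneg (sq_nonneg _)]
    exact hbound ω
  refine ⟨hint, (integral_mono hint hbint hbound).trans ?_⟩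
  rw [integral_const_mul, integral_add hi1 hi2, integral_const_mul, integral_const_mul,
    integral_const_mul, integral_finsetSum _ fun i _ => (hU i).1.const_mul _]
  simp only [integral_const_mul]
  have h1 : ∑ i ∈ Finset.range n,
      (w i)⁻¹ * ∫ ω, (W (iter α γ (init ω) (fun m => Xs m ω) i).1 - χ) ^ 2 ∂P ≤ U * T := by
    rw [hT, Finset.mul_sum]
    refine Finset.sum_le_sum fun i _ => ?_
    rw [inv_mul_le_iff₀ (hw0 i)]
    have := (hU i).2
    rw [show ((i : ℝ) + 1) ^ (-b) = w i by rw [hw]] at this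
    linarith
  have h2 := mul_le_mul_of_nonneg_left h1 hT0
  have h3 : T * T ≤ (2 * n * (n : ℝ) ^ (-b)) * (2 * n * (n : ℝ) ^ (-b)) :=
    mul_le_mul hTn hTn hT0 (hT0.trans hTn)
  have h4 := mul_le_mul_of_nonneg_left h3 hU0
  have hvar : 0 ≤ noiseVar α s := by
    have : 0 ≤ (n : ℝ) * noiseVar α s := (integral_nonneg fun _ => sq_nonneg _).trans hS2
    exact (mul_nonneg_iff_of_pos_left hn0).1 this
  have h5 : (n : ℝ) ≤ (n : ℝ) ^ 2 * ((n : ℝ) ^ (-b)) ^ 2 := by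
    have e : (n : ℝ) ^ 2 * ((n : ℝ) ^ (-b)) ^ 2 = (n : ℝ) ^ (2 + -b + -b) := by
      rw [Real.rpow_add hn0, Real.rpow_add hn0, Real.rpow_two]
      ring
    rw [e]
    conv_lhs => rw [← Real.rpow_one (n : ℝ)]
    exact Real.rpow_le_rpow_of_exponent_le (by exact_mod_cast hn) (by linarith)
  have h6 := mul_le_mul_of_nonneg_right h5 hvar
  rw [inv_mul_le_iff₀ (by positivity)]
  linarith

end Noise

end Averaging

/-! ### Second moments of the nested losses. -/

section ModelMoments

variable {Ω E F : Type*} [MeasurableSpace Ω] [MeasurableSpace E] [MeasurableSpace F]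
  {P : Measure Ω} [IsProbabilityMeasure P] {φ : E × F → ℝ} {Y : Ω → E} {Z : Ω → F}
  {Zs : ℕ → Ω → F}

lemma IsModel.identDistrib (hm : IsModel P φ Y Z Zs) (k : ℕ) :
    IdentDistrib (fun ω => φ (Y ω, Zs k ω)) (fun ω => φ (Y ω, Z ω)) P P := by
  have h1 : IndepFun Y (Zs k) P := hm.indep_Y_Zs.comp measurable_id (measurable_pi_apply k)
  have h2 : IdentDistrib (fun ω => (Y ω, Zs k ω)) (fun ω => (Y ω, Z ω)) P P :=
    (IdentDistrib.refl hm.measurable_Y.aemeasurable).prodMk (hm.copies_Zs k) h1 hm.indep_Y_Z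
  exact h2.comp hm.measurable_φ

/-- The square of an average is at most the average of the squares, and each `φ(Y, Z^{(k)})` has the
law of `φ(Y, Z)`; hence a bound uniform in `K`. -/
lemma IsModel.memLp_loss (hm : IsModel P φ Y Z Zs)
    (hL2 : MemLp (fun ω => φ (Y ω, Z ω)) 2 P) {K : ℕ} (hK : 1 ≤ K) :
    MemLp (loss P φ Y Z Zs K) 2 P ∧
      ∫ ω, loss P φ Y Z Zs K ω ^ 2 ∂P ≤ ∫ ω, φ (Y ω, Z ω) ^ 2 ∂P := by
  obtain ⟨J, rfl⟩ : ∃ J, K = J + 1 := ⟨K - 1, by omega⟩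
  have hk : ∀ k, MemLp (fun ω => φ (Y ω, Zs k ω)) 2 P := fun k =>
    (hm.identDistrib k).memLp_iff.2 hL2
  have hk2 : ∀ k, ∫ ω, φ (Y ω, Zs k ω) ^ 2 ∂P = ∫ ω, φ (Y ω, Z ω) ^ 2 ∂P := fun k =>
    ((hm.identDistrib k).comp (measurable_id.pow_const 2)).integral_eq
  have hX : MemLp (loss P φ Y Z Zs (J + 1)) 2 P :=
    (memLp_finsetSum (Finset.range (J + 1)) fun k _ => hk k).const_mul _
  have hJ : (0 : ℝ) < ((J + 1 : ℕ) : ℝ) := by positivity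
  refine ⟨hX, ?_⟩
  have hint : Integrable (fun ω => 1 / ((J + 1 : ℕ) : ℝ)
      * ∑ k ∈ Finset.range (J + 1), φ (Y ω, Zs k ω) ^ 2) P :=
    (integrable_finsetSum _ fun k _ => (hk k).integrable_sq).const_mul _
  refine (integral_mono hX.integrable_sq hint fun ω => ?_).trans (le_of_eq ?_)
  · simp only [loss, mcLoss]
    have := sq_sum_le_card_mul_sum_sq (s := Finset.range (J + 1)) (f := fun k => φ (Y ω, Zs k ω))
    rw [Finset.card_range] at this
    rw [mul_pow, one_div, inv_pow, inv_mul_le_iff₀ (by positivity)]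
    refine this.trans (le_of_eq ?_)
    field_simp
  · rw [integral_const_mul, integral_finsetSum _ fun k _ => (hk k).integrable_sq]
    simp only [hk2, Finset.sum_const, Finset.card_range, nsmul_eq_mul]
    field_simp

lemma IsModel.integrable_loss (hm : IsModel P φ Y Z Zs)
    (hL2 : MemLp (fun ω => φ (Y ω, Z ω)) 2 P) (K : ℕ) : Integrable (loss P φ Y Z Zs K) P := by
  cases K with
  | zero => exact integrable_condExp
  | succ K => exact (hm.memLp_loss hL2 (Nat.succ_pos K)).1.integrable (by norm_num)

end ModelMoments

/-! ### Constants uniform in the bias parameter. -/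

section Uniform

variable {Ω : Type*} [MeasurableSpace Ω] {P : Measure Ω}
  {α : ℝ} {X : ℕ → Ω → ℝ} {ξstar : ℕ → ℝ} {f : ℕ → ℝ → ℝ}

/-- Bounds on the family of problems that are uniform in the bias parameter. -/
structure UniformProblem (P : Measure Ω) (α : ℝ) (X : ℕ → Ω → ℝ) (ξstar : ℕ → ℝ)
    (f : ℕ → ℝ → ℝ) (M a l R : ℝ) : Prop where
  integrable : ∀ K, Integrable (X K) P
  pdfs : HasPdfs P X f
  argmin : ∀ K, ξstar K ∈ argminV P α (X K)
  le_M : ∀ K x, f K x ≤ M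
  a_pos : 0 < a
  a_le : ∀ K, a ≤ f K (ξstar K)
  l_pos : 0 < l
  lip : ∀ K x y, |f K x - f K y| ≤ l * |x - y|
  abs_argmin_le : ∀ K, |ξstar K| ≤ R

namespace UniformProblem

variable {M a l R : ℝ}

lemma M_pos (hu : UniformProblem P α X ξstar f M a l R) : 0 < M :=
  hu.a_pos.trans_le ((hu.a_le 0).trans (hu.le_M 0 _))

lemma lip_second (hu : UniformProblem P α X ξstar f M a l R) (hα₁ : α < 1) (K : ℕ) (x y : ℝ) :
    |f K x / (1 - α) - f K y / (1 - α)| ≤ l / (1 - α) * |x - y| := by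
  have h1 : 0 < 1 - α := by linarith
  rw [← sub_div, abs_div, abs_of_pos h1, div_mul_eq_mul_div]
  exact div_le_div_of_nonneg_right (hu.lip K x y) h1.le

end UniformProblem

lemma IsSampling.isSample {ξ₀ χ₀ : ℕ → Ω → ℝ} {Xs : ℕ → ℕ → Ω → ℝ}
    (hXs : IsSampling P X ξ₀ χ₀ Xs) {K : ℕ} (hK : 1 ≤ K) :
    IsSample P (P.map (X K)) (fun ω => (ξ₀ K ω, χ₀ K ω)) (Xs K) where
  measurable_init := (hXs.measurable_ξ₀ K).prodMk (hXs.measurable_χ₀ K)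
  measurable_Xs := hXs.measurable_Xs K hK
  iIndep_Xs := hXs.iIndep_Xs K hK
  law_Xs n := (hXs.copies_Xs K hK n).map_eq
  indep_init := hXs.indep_init K hK

/-- The Lyapunov function of the problem with bias index `K`, with the weight
`q² M / (1 - α)` in the exponent. -/
def levelLyap (P : Measure Ω) (α : ℝ) (X : ℕ → Ω → ℝ) (ξstar : ℕ → ℝ) (M : ℝ) (q K : ℕ) : ℝ → ℝ :=
  lyap (fun x => V P α (X K) x - V P α (X K) (ξstar K)) q (q ^ 2 * (M / (1 - α)))

/-- Since `v ≤ k |x - c|`, `exp(μ v)` is controlled by `exp(b |x|)`. The split at `|x| = 1` raises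
the power `q` to `2 q`, to match the moment assumed of the initial value. -/
lemma lyap_initial_le {v g h : ℝ → ℝ} {c B k μ b R x : ℝ} (hp : IsProfile v g h c B k) (q : ℕ)
    (hμ : 0 ≤ μ) (hb : μ * k ≤ b) (hc : |c| ≤ R) :
    lyap v q μ x ≤ (k * (1 + R)) ^ q * Real.exp (b * R)
      * (Real.exp b + |x| ^ (2 * q) * Real.exp (b * |x|)) := by
  have hk := hp.k_nonneg
  have hv := hp.v_nonneg x
  have hR : 0 ≤ R := (abs_nonneg c).trans hc
  have hb0 : 0 ≤ b := (mul_nonneg hμ hk).trans hb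
  have h1 : v x ≤ k * (|x| + R) := by
    refine (hp.v_le x).trans (mul_le_mul_of_nonneg_left ?_ hk)
    exact (abs_sub x c).trans (by linarith)
  have h2 : μ * v x ≤ b * R + b * |x| := by
    have e1 := mul_le_mul_of_nonneg_left h1 hμ
    have e2 := mul_le_mul_of_nonneg_right hb (add_nonneg (abs_nonneg x) hR)
    linarith
  have h3 : lyap v q μ x ≤ (k * (|x| + R)) ^ q * (Real.exp (b * R) * Real.exp (b * |x|)) := by
    rw [← Real.exp_add]
    exact mul_le_mul (pow_le_pow_left₀ hv h1 q) (Real.exp_le_exp.2 h2) (Real.exp_pos _).le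
      (by positivity)
  refine h3.trans ?_
  have h4 : (k * (|x| + R)) ^ q * Real.exp (b * |x|) ≤ (k * (1 + R)) ^ q
      * (Real.exp b + |x| ^ (2 * q) * Real.exp (b * |x|)) := by
    rcases le_total |x| 1 with hx | hx
    · have e1 : (k * (|x| + R)) ^ q ≤ (k * (1 + R)) ^ q := by gcongr
      have e2 : Real.exp (b * |x|) ≤ Real.exp b :=
        Real.exp_le_exp.2 (mul_le_of_le_one_right hb0 hx)
      refine (mul_le_mul e1 e2 (Real.exp_pos _).le (by positivity)).trans ?_
      apply mul_le_mul_of_nonneg_left _ (by positivity)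
      have : 0 ≤ |x| ^ (2 * q) * Real.exp (b * |x|) := by positivity
      linarith
    · have e1 : (k * (|x| + R)) ^ q ≤ (k * (1 + R)) ^ q * |x| ^ (2 * q) := by
        rw [pow_mul, ← mul_pow]
        apply pow_le_pow_left₀ (by positivity)
        rw [mul_assoc]
        apply mul_le_mul_of_nonneg_left _ hk
        nlinarith [mul_nonneg hR (sub_nonneg.2 (one_le_pow₀ hx : (1 : ℝ) ≤ |x| ^ 2))]
      have e2 := mul_le_mul_of_nonneg_right e1 (Real.exp_pos (b * |x|)).le
      have e3 : 0 ≤ (k * (1 + R)) ^ q * Real.exp b := by positivity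
      linarith
  have := mul_le_mul_of_nonneg_left h4 (Real.exp_pos (b * R)).le
  linarith

variable [IsProbabilityMeasure P]

lemma cdf_argmin {K : ℕ} (hint : Integrable (X K) P) (hf : HasPdfs P X f) (hα₁ : α < 1)
    (hξ : ξstar K ∈ argminV P α (X K)) : cdf (P.map (X K)) (ξstar K) = α := by
  have h := derivV_argmin (hf.law K) hint hα₁ hξ
  unfold derivV at h
  rcases div_eq_zero_iff.1 h with h | h <;> linarith

/-- The minimizers stay in a bounded set. -/
lemma exists_abs_argmin_sub_lt (hint : ∀ K, Integrable (X K) P) (hf : HasPdfs P X f)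
    (hα₁ : α < 1) (hξ : ∀ K, ξstar K ∈ argminV P α (X K)) (hcdf : CdfExpansion P α X)
    (hreg : PdfRegularity f (ξstar 0)) : ∃ R > 0, ∀ K, |ξstar K - ξstar 0| < R := by
  obtain ⟨v, w, hexp, hlim⟩ := hcdf
  obtain ⟨-, hw, -⟩ := hlim _ (hξ 0)
  obtain ⟨c, hc, hlow⟩ := hreg.lower 1 one_pos
  have hz : Tendsto (fun K : ℕ => v (ξstar 0) * (1 / (K : ℝ)) + w (ξstar 0) K * (1 / (K : ℝ)))
      atTop (𝓝 0) := by
    have h1 := tendsto_one_div_atTop_nhds_zero_nat (𝕜 := ℝ)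
    simpa using (h1.const_mul (v (ξstar 0))).add (hw.mul h1)
  have hc2 : 0 < c / 2 := by positivity
  have hev : ∀ᶠ K : ℕ in atTop, |ξstar K - ξstar 0| < 1 := by
    filter_upwards [hz.eventually (Metric.ball_mem_nhds 0 hc2), eventually_ge_atTop 1] with K hK hK1
    rw [Real.dist_eq, sub_zero, abs_lt] at hK
    rw [← hexp K hK1, cdf_argmin (hint 0) hf hα₁ (hξ 0)] at hK
    have hα := cdf_argmin (hint K) hf hα₁ (hξ K)
    have hmono := monotone_cdf (P.map (X K))
    -- A density at least `c` on the unit ball makes the cdf vary by at least `c / 2` over half a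
    -- unit. As `F_h(ξstar 0)` is within `c / 2` of `α = F_h(ξstar K)`, the minimizer cannot leave
    -- the ball.
    have hinc : ∀ a b, ξstar 0 - 1 < a → b < ξstar 0 + 1 → a ≤ b →
        c * (b - a) ≤ cdf (P.map (X K)) b - cdf (P.map (X K)) a := fun a b ha hb hab => by
      rw [cdf_sub_eq_integral_pdf (hf.law K) (hint K).1.aemeasurable (hf.continuous K)
        (hf.nonneg K)]
      have := intervalIntegral.integral_mono_on hab (intervalIntegrable_const (μ := volume) (c := c))
        ((hf.continuous K).intervalIntegrable a b) fun x hx => hlow K x (by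
          rw [Real.ball_eq_Ioo]
          exact ⟨by linarith [hx.1], by linarith [hx.2]⟩)
      rw [intervalIntegral.integral_const, smul_eq_mul] at this
      linarith
    rw [abs_lt]
    constructor
    · by_contra hcon
      have h1 := hinc (ξstar 0 - 1 / 2) (ξstar 0) (by linarith) (by linarith) (by linarith)
      have h2 : cdf (P.map (X K)) (ξstar K) ≤ cdf (P.map (X K)) (ξstar 0 - 1 / 2) :=
        hmono (by linarith)
      linarith [hK.2]
    · by_contra hcon
      have h1 := hinc (ξstar 0) (ξstar 0 + 1 / 2) (by linarith) (by linarith) (by linarith)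
      have h2 : cdf (P.map (X K)) (ξstar 0 + 1 / 2) ≤ cdf (P.map (X K)) (ξstar K) :=
        hmono (by linarith)
      linarith [hK.1]
  obtain ⟨N, hN⟩ := eventually_atTop.1 hev
  have hsum : 0 ≤ ∑ J ∈ Finset.range N, |ξstar J - ξstar 0| :=
    Finset.sum_nonneg fun _ _ => abs_nonneg _
  -- The sum takes care of the finitely many indices before `N`.
  refine ⟨1 + ∑ J ∈ Finset.range N, |ξstar J - ξstar 0|, by linarith, fun K => ?_⟩
  rcases Nat.lt_or_ge K N with h | h
  · have := Finset.single_le_sum (f := fun J => |ξstar J - ξstar 0|) (fun _ _ => abs_nonneg _)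
      (Finset.mem_range.2 h)
    beta_reduce at this
    linarith
  · linarith [hN K h]

lemma abs_le_iSup_supNorm {C : ℝ} (hC : ∀ K x, |f K x| ≤ C) (K : ℕ) (x : ℝ) :
    |f K x| ≤ ⨆ J, supNorm (f J) := by
  have h1 : ∀ J, supNorm (f J) ≤ C := fun J => ciSup_le fun x => hC J x
  have h2 : |f K x| ≤ supNorm (f K) :=
    le_ciSup (f := fun x => |f K x|) ⟨C, by rintro _ ⟨y, rfl⟩; exact hC K y⟩ x
  exact h2.trans (le_ciSup (f := fun J => supNorm (f J)) ⟨C, by rintro _ ⟨J, rfl⟩; exact h1 J⟩ K)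

theorem exists_uniformProblem (hint : ∀ K, Integrable (X K) P) (hf : HasPdfs P X f)
    (hα₁ : α < 1) (hξ : ∀ K, ξstar K ∈ argminV P α (X K)) (hcdf : CdfExpansion P α X)
    (hreg : PdfRegularity f (ξstar 0)) :
    ∃ a l R, UniformProblem P α X ξstar f (⨆ J, supNorm (f J)) a l R := by
  obtain ⟨R, hR, hRlt⟩ := exists_abs_argmin_sub_lt hint hf hα₁ hξ hcdf hreg
  obtain ⟨a, ha, hlow⟩ := hreg.lower R hR
  obtain ⟨C, hC⟩ := hreg.upper
  refine ⟨a, max C 1, |ξstar 0| + R, ⟨hint, hf, hξ, fun K x => ?_, ha, fun K => ?_, ?_,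
    fun K x y => ?_, fun K => ?_⟩⟩
  · exact (le_abs_self _).trans (abs_le_iSup_supNorm (fun K x => (hC K).1 x) K x)
  · exact hlow K _ (by rw [Metric.mem_ball, Real.dist_eq]; exact hRlt K)
  · exact lt_max_of_lt_right one_pos
  · exact ((hC K).2 x y).trans (mul_le_mul_of_nonneg_right (le_max_left _ _) (abs_nonneg _))
  · have := abs_sub_abs_le_abs_sub (ξstar K) (ξstar 0)
    linarith [hRlt K]

namespace UniformProblem

variable {M a l R : ℝ}

lemma isProfile (hu : UniformProblem P α X ξstar f M a l R) (hα₁ : α < 1) (K : ℕ) :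
    IsProfile (fun x => V P α (X K) x - V P α (X K) (ξstar K)) (derivV (P.map (X K)) α)
      (fun x => f K x / (1 - α)) (ξstar K) (M / (1 - α)) (kConst α) :=
  isProfile_V (hu.pdfs.law K) (hu.integrable K) (hu.pdfs.continuous K) (hu.pdfs.nonneg K) hα₁
    (hu.argmin K) (hu.le_M K)

lemma drift_of_le (hu : UniformProblem P α X ξstar f M a l R) (hα₁ : α < 1) {q : ℕ} {lam l' : ℝ}
    {K : ℕ} (hl' : 0 < l')
    (hlip : ∀ x, |f K x / (1 - α) - f K (ξstar K) / (1 - α)| ≤ l' * |x - ξstar K|)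
    (h1 : lam ≤ 3 / 8 * q * (f K (ξstar K) / (1 - α)))
    (h2 : lam ≤ q ^ 2 * (M / (1 - α)) * ((f K (ξstar K) / (1 - α)) ^ 4 / (4 * l' ^ 2))) (x : ℝ) :
    lam * (V P α (X K) x - V P α (X K) (ξstar K)) ≤ derivV (P.map (X K)) α x ^ 2
      * (q + q ^ 2 * (M / (1 - α)) * (V P α (X K) x - V P α (X K) (ξstar K))) := by
  have hα : 0 < 1 - α := by linarith
  have hM := hu.M_pos
  exact (hu.isProfile hα₁ K).drift rfl (div_pos (hu.a_pos.trans_le (hu.a_le K)) hα) hl' hlip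
    q.cast_nonneg (by positivity) h1 h2 x

/-- Serves `β < 1`, where the value of `lam` is irrelevant and only positivity uniform in `K`
matters. -/
lemma exists_drift (hu : UniformProblem P α X ξstar f M a l R) (hα₁ : α < 1) {q : ℕ}
    (hq : 1 ≤ q) : ∃ lam > 0, ∀ K x,
      lam * (V P α (X K) x - V P α (X K) (ξstar K)) ≤ derivV (P.map (X K)) α x ^ 2
      * (q + q ^ 2 * (M / (1 - α)) * (V P α (X K) x - V P α (X K) (ξstar K))) := by
  have hα : 0 < 1 - α := by linarith
  have hM := hu.M_pos
  have ha := hu.a_pos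
  have hl := hu.l_pos
  have hq0 : (0 : ℝ) < q := by exact_mod_cast hq
  refine ⟨min (3 / 8 * q * (a / (1 - α)))
    (q ^ 2 * (M / (1 - α)) * ((a / (1 - α)) ^ 4 / (4 * (l / (1 - α)) ^ 2))),
    lt_min (by positivity) (by positivity), fun K x => ?_⟩
  have hK := hu.a_le K
  refine hu.drift_of_le hα₁ (div_pos hl hα) (fun x => hu.lip_second hα₁ K _ _)
    ((min_le_left _ _).trans ?_) ((min_le_right _ _).trans ?_) x <;> gcongr

lemma lamBar_drift (hu : UniformProblem P α X ξstar f M a l R) (hα₁ : α < 1) {q : ℕ}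
    (hlam : 0 < lamBar P α X ξstar q) (K : ℕ) (x : ℝ) :
    lamBar P α X ξstar q * (V P α (X K) x - V P α (X K) (ξstar K))
      ≤ derivV (P.map (X K)) α x ^ 2
      * (q + q ^ 2 * (M / (1 - α)) * (V P α (X K) x - V P α (X K) (ξstar K))) := by
  have hα : 0 < 1 - α := by linarith
  -- An infimum over a set unbounded below is `0` by convention, which positivity of `lamBar`
  -- excludes.
  have hbdd : BddBelow (Set.range fun K => lamBarAt P α (X K) (ξstar K) q) := by
    by_contra h
    unfold lamBar at hlam
    rw [Real.iInf_of_not_bddBelow h] at hlam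
    exact lt_irrefl _ hlam
  have hle : lamBar P α X ξstar q ≤ lamBarAt P α (X K) (ξstar K) q := ciInf_le hbdd K
  have hV := V''_eq (hu.pdfs.law K) (hu.integrable K) (hu.pdfs.continuous K) (hu.pdfs.nonneg K) hα₁
  unfold lamBarAt at hle
  rw [hV] at hle
  have hle1 := hle.trans (min_le_left _ _)
  have hle2 := hle.trans (min_le_right _ _)
  obtain ⟨l', hl'⟩ : ∃ l', l' = lipConst (fun x => f K x / (1 - α)) := ⟨_, rfl⟩
  rw [← hl'] at hle2
  -- If the Lipschitz constant were `0`, division by zero would make the second term of the minimum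
  -- `0`, against positivity of `lamBar`.
  have hl'0 : 0 < l' := by
    have h0 : 0 ≤ l' := hl' ▸ Real.iSup_nonneg fun p => by positivity
    refine lt_of_le_of_ne h0 fun h => ?_
    rw [← h] at hle2
    simp only [ne_eq, OfNat.ofNat_ne_zero, not_false_eq_true, zero_pow, mul_zero, div_zero] at hle2
    linarith
  have hlip : ∀ x y, |f K x / (1 - α) - f K y / (1 - α)| ≤ l' * |x - y| := fun x y => by
    have hb : BddAbove (Set.range fun p : ℝ × ℝ =>
        |f K p.1 / (1 - α) - f K p.2 / (1 - α)| / |p.1 - p.2|) := by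
      refine ⟨l / (1 - α), ?_⟩
      rintro _ ⟨p, rfl⟩
      exact div_le_of_le_mul₀ (abs_nonneg _) (div_pos hu.l_pos hα).le (hu.lip_second hα₁ K _ _)
    have h1 := le_ciSup hb (x, y)
    rcases eq_or_ne x y with rfl | hne
    · simp
    · rw [hl', ← div_le_iff₀ (abs_pos.2 (sub_ne_zero.2 hne))]
      exact h1
  -- The weight built from `M`, common to all `K`, dominates the weight `q² ‖V_h''‖_∞` appearing in
  -- `lamBarAt`.
  have hsup : supNorm (fun x => f K x / (1 - α)) ≤ M / (1 - α) := ciSup_le fun x => by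
    rw [abs_of_nonneg (div_nonneg (hu.pdfs.nonneg K x) hα.le)]
    exact div_le_div_of_nonneg_right (hu.le_M K x) hα.le
  have hf0 := hu.pdfs.nonneg K (ξstar K)
  refine hu.drift_of_le hα₁ hl'0 (fun x => hlip _ _) hle1 (hle2.trans ?_) x
  gcongr

lemma sq_le (hu : UniformProblem P α X ξstar f M a l R) (hα₁ : α < 1) (K : ℕ) (x : ℝ) :
    (x - ξstar K) ^ 2 ≤ 3 / (a / (1 - α)) * (V P α (X K) x - V P α (X K) (ξstar K))
      + (3 * (l / (1 - α)) / (a / (1 - α)) ^ 2 * (V P α (X K) x - V P α (X K) (ξstar K))) ^ 2 := by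
  have hα : 0 < 1 - α := by linarith
  have ha := hu.a_pos
  have hl := hu.l_pos
  have hK := hu.a_le K
  have hv : 0 ≤ V P α (X K) x - V P α (X K) (ξstar K) := (hu.isProfile hα₁ K).v_nonneg x
  refine ((hu.isProfile hα₁ K).sq_le rfl (div_pos (ha.trans_le hK) hα) (div_pos hl hα)
    (fun x => hu.lip_second hα₁ K _ _) x).trans ?_
  gcongr

end UniformProblem

theorem levelLyap_rate {M a l R : ℝ} (hu : UniformProblem P α X ξstar f M a l R)
    (hα₀ : 0 < α) (hα₁ : α < 1) {ξ₀ χ₀ : ℕ → Ω → ℝ} {Xs : ℕ → ℕ → Ω → ℝ}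
    (hXs : IsSampling P X ξ₀ χ₀ Xs) {γ₁ β b : ℝ} (hγ₁ : 0 < γ₁) (hβ₀ : 0 < β) (hβ₁ : β ≤ 1)
    {q : ℕ} (hq : q = 1 ∨ q = 2) (hb : q ^ 2 * (M / (1 - α)) * kConst α ≤ b)
    (hξ₀ : UnifFiniteMean P (fun K ω => |ξ₀ K ω| ^ (2 * q) * Real.exp (b * |ξ₀ K ω|)))
    (hlam : β = 1 → (q : ℝ) < lamBar P α X ξstar q * γ₁) :
    ∃ U, 0 ≤ U ∧ ∀ K, 1 ≤ K → ∀ n,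
      Integrable (fun ω => levelLyap P α X ξstar M q K (xiIter α (step γ₁ β) ξ₀ χ₀ Xs K n ω)) P ∧
      ∫ ω, levelLyap P α X ξstar M q K (xiIter α (step γ₁ β) ξ₀ χ₀ Xs K n ω) ∂P
        ≤ U * step γ₁ β (n + 1) ^ q := by
  have hα : 0 < 1 - α := by linarith
  have hM := hu.M_pos
  have hq1 : 1 ≤ q := by omega
  have hμ : 0 ≤ (q : ℝ) ^ 2 * (M / (1 - α)) := by positivity
  have hR : 0 ≤ R := (abs_nonneg _).trans (hu.abs_argmin_le 0)
  have hk := (hu.isProfile hα₁ 0).k_nonneg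
  obtain ⟨lam, hlam0, hlamq, hdrift⟩ : ∃ lam > 0, (β = 1 → (q : ℝ) < lam * γ₁) ∧ ∀ K x,
      lam * (V P α (X K) x - V P α (X K) (ξstar K)) ≤ derivV (P.map (X K)) α x ^ 2
      * (q + q ^ 2 * (M / (1 - α)) * (V P α (X K) x - V P α (X K) (ξstar K))) := by
    by_cases hβ : β = 1
    · have h1 : 0 < lamBar P α X ξstar q := by
        have : 0 < lamBar P α X ξstar q * γ₁ := lt_of_le_of_lt q.cast_nonneg (hlam hβ)
        exact (mul_pos_iff_of_pos_right hγ₁).1 this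
      exact ⟨_, h1, hlam, fun K x => hu.lamBar_drift hα₁ h1 K x⟩
    · obtain ⟨lam, h0, h1⟩ := hu.exists_drift hα₁ hq1
      exact ⟨lam, h0, fun h => absurd h hβ, h1⟩
  obtain ⟨C, hC⟩ := hξ₀
  have hinit : ∀ K, Integrable (fun ω => levelLyap P α X ξstar M q K (ξ₀ K ω)) P ∧
      ∫ ω, levelLyap P α X ξstar M q K (ξ₀ K ω) ∂P
        ≤ (kConst α * (1 + R)) ^ q * Real.exp (b * R) * (Real.exp b + C) := fun K => by
    have hp := hu.isProfile hα₁ K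
    have hbi : Integrable (fun ω => (kConst α * (1 + R)) ^ q * Real.exp (b * R)
        * (Real.exp b + |ξ₀ K ω| ^ (2 * q) * Real.exp (b * |ξ₀ K ω|))) P :=
      ((integrable_const _).add (hC K).1).const_mul _
    have hle : ∀ ω, levelLyap P α X ξstar M q K (ξ₀ K ω) ≤ (kConst α * (1 + R)) ^ q
        * Real.exp (b * R) * (Real.exp b + |ξ₀ K ω| ^ (2 * q) * Real.exp (b * |ξ₀ K ω|)) :=
      fun ω => lyap_initial_le hp q hμ hb (hu.abs_argmin_le K)
    have hi : Integrable (fun ω => levelLyap P α X ξstar M q K (ξ₀ K ω)) P := by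
      refine hbi.mono' ((hp.measurable_lyap q _).comp
        (hXs.measurable_ξ₀ K)).aestronglyMeasurable (ae_of_all _ fun ω => ?_)
      refine (Real.norm_of_nonneg (hp.lyap_nonneg _ _ _)).trans_le ?_
      exact hle ω
    refine ⟨hi, (integral_mono hi hbi hle).trans ?_⟩
    rw [integral_const_mul, integral_add (integrable_const _) (hC K).1]
    simp only [integral_const, probReal_univ, smul_eq_mul, one_mul]
    have := (hC K).2
    gcongr
  have hA : 0 ≤ (kConst α * (1 + R)) ^ q * Real.exp (b * R) * (Real.exp b + C) :=
    (integral_nonneg fun ω => (hu.isProfile hα₁ 0).lyap_nonneg _ _ _).trans (hinit 0).2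
  obtain ⟨U, hU, hrate⟩ := lyap_rate P hα₀ hα₁ hγ₁ hβ₀ hβ₁ hq (div_pos hM hα) hμ hlam0 hlamq hA
  refine ⟨U, hU, fun K hK n => ?_⟩
  have : IsProbabilityMeasure (P.map (X K)) :=
    Measure.isProbabilityMeasure_map (hu.integrable K).1.aemeasurable
  have := nullSingletonClass_of_pdf (hu.pdfs.law K)
  exact hrate _ _ _ _ (P.map (X K)) _ _ (hu.isProfile hα₁ K)
    (fun ξ => integral_H₁ _ hα₁ ξ) (hXs.isSample hK) (hdrift K) (hinit K).1 (hinit K).2 n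

end Uniform

/-! ### From the Lyapunov function back to powers of the error. -/

section Rates

lemma step_succ_le {γ₁ β : ℝ} (hγ₁ : 0 < γ₁) (hβ : 0 < β) {n : ℕ} (hn : 1 ≤ n) :
    step γ₁ β (n + 1) ≤ step γ₁ β n := by
  have hn0 : (0 : ℝ) < n := by exact_mod_cast hn
  refine mul_le_mul_of_nonneg_left ?_ hγ₁.le
  exact Real.rpow_le_rpow_of_nonpos hn0 (by push_cast; linarith) (by linarith)

lemma step_succ_le_rpow {γ₁ β b : ℝ} (hγ₁ : 0 < γ₁) (hb : b ≤ β) (n : ℕ) :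
    step γ₁ β (n + 1) ≤ γ₁ * ((n : ℝ) + 1) ^ (-b) := by
  refine mul_le_mul_of_nonneg_left ?_ hγ₁.le
  push_cast
  exact Real.rpow_le_rpow_of_exponent_le (by linarith [n.cast_nonneg (α := ℝ)]) (by linarith)

lemma IsProfile.pow_le_lyap {v g h : ℝ → ℝ} {c B k μ : ℝ} (hp : IsProfile v g h c B k)
    (hμ : 0 ≤ μ) (q : ℕ) (x : ℝ) :
    v x ^ q ≤ lyap v q μ x :=
  le_mul_of_one_le_right (pow_nonneg (hp.v_nonneg x) q) (Real.one_le_exp (mul_nonneg hμ (hp.v_nonneg x)))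

/-- The exponential supplies the missing power of `v`, through `y ≤ exp y`. -/
lemma IsProfile.sq_le_lyap_one {v g h : ℝ → ℝ} {c B k μ : ℝ} (hp : IsProfile v g h c B k)
    (hμ : 0 < μ) (x : ℝ) :
    v x ^ 2 ≤ lyap v 1 μ x / μ := by
  have hv := hp.v_nonneg x
  rw [le_div_iff₀ hμ]
  have h1 : μ * v x ≤ Real.exp (μ * v x) := by linarith [Real.add_one_le_exp (μ * v x)]
  have := mul_le_mul_of_nonneg_left h1 hv
  unfold lyap
  linarith

/-- Here two powers of `v` are missing, and `y² / 2 ≤ exp y` supplies them. -/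
lemma IsProfile.pow_four_le_lyap_two {v g h : ℝ → ℝ} {c B k μ : ℝ} (hp : IsProfile v g h c B k)
    (hμ : 0 < μ) (x : ℝ) :
    v x ^ 4 ≤ 2 / μ ^ 2 * lyap v 2 μ x := by
  have hv := hp.v_nonneg x
  rw [div_mul_eq_mul_div, le_div_iff₀ (by positivity)]
  have h0 : 0 ≤ μ * v x := mul_nonneg hμ.le hv
  have h1 : (μ * v x) ^ 2 ≤ 2 * Real.exp (μ * v x) := by
    linarith [Real.quadratic_le_exp_of_nonneg h0]
  have := mul_le_mul_of_nonneg_left h1 (sq_nonneg (v x))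
  unfold lyap
  linarith

lemma unifRate_const {Ω : Type*} [MeasurableSpace Ω] {P : Measure Ω} {W : ℕ → ℕ → Ω → ℝ}
    {r : ℕ → ℝ} (C : ℝ) (h : ∀ K, 1 ≤ K → ∀ n, 1 ≤ n →
      Integrable (W K n) P ∧ ∫ ω, W K n ω ∂P ≤ C * r n) : UnifRate P W r :=
  ⟨fun _ => C, ⟨C, by rintro _ ⟨_, _, rfl⟩; exact le_rfl⟩, h⟩

lemma integrable_and_integral_le {Ω : Type*} [MeasurableSpace Ω] {P : Measure Ω} {W L : Ω → ℝ}
    {C r : ℝ} (hW : Measurable W) (hW0 : ∀ ω, 0 ≤ W ω) (hC : 0 ≤ C)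
    (hWL : ∀ ω, W ω ≤ C * L ω) (hL : Integrable L P) (hLr : ∫ ω, L ω ∂P ≤ r) :
    Integrable W P ∧ ∫ ω, W ω ∂P ≤ C * r := by
  have hi : Integrable W P := (hL.const_mul C).mono' hW.aestronglyMeasurable
    (ae_of_all _ fun ω => by rw [Real.norm_of_nonneg (hW0 ω)]; exact hWL ω)
  refine ⟨hi, (integral_mono hi (hL.const_mul C) hWL).trans ?_⟩
  rw [integral_const_mul]
  exact mul_le_mul_of_nonneg_left hLr hC

variable {Ω : Type*} [MeasurableSpace Ω] {P : Measure Ω} {α : ℝ} {X : ℕ → Ω → ℝ}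

lemma measurable_xiIter {ξ₀ χ₀ : ℕ → Ω → ℝ} {Xs : ℕ → ℕ → Ω → ℝ}
    (hXs : IsSampling P X ξ₀ χ₀ Xs) (γ : ℕ → ℝ) {K : ℕ} (hK : 1 ≤ K) (n : ℕ) :
    Measurable (xiIter α γ ξ₀ χ₀ Xs K n) :=
  ((measurable_iter (init := fun ω => (ξ₀ K ω, χ₀ K ω)) (Xs := Xs K) n).mono
    ((hXs.isSample hK).past_le n) le_rfl).fst

variable [IsProbabilityMeasure P] {ξstar : ℕ → ℝ} {f : ℕ → ℝ → ℝ} {M a l R : ℝ}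

lemma integral_valueSample {Z : Ω → ℝ} (hZ : Integrable Z P) (ξ : ℝ) :
    ∫ x, valueSample α ξ x ∂(P.map Z) = V P α Z ξ := by
  have hm : Measurable (valueSample α ξ) := (measurable_valueSample α).comp measurable_prodMk_left
  rw [integral_map hZ.1.aemeasurable hm.aestronglyMeasurable]
  unfold valueSample V
  rw [integral_add (integrable_const _) ((integrable_posPart hZ ξ).const_mul _),
    integral_const_mul]
  simp

lemma UniformProblem.sq_le_levelLyap (hu : UniformProblem P α X ξstar f M a l R) (hα₁ : α < 1) :
    ∃ C, 0 ≤ C ∧ ∀ K x, (x - ξstar K) ^ 2 ≤ C * levelLyap P α X ξstar M 1 K x := by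
  have hα : 0 < 1 - α := by linarith
  have ha := hu.a_pos
  have hl := hu.l_pos
  have hM := hu.M_pos
  have hμ : 0 < ((1 : ℕ) : ℝ) ^ 2 * (M / (1 - α)) := by positivity
  obtain ⟨A, hA⟩ : ∃ A, A = 3 / (a / (1 - α)) := ⟨_, rfl⟩
  obtain ⟨D, hD⟩ : ∃ D, D = 3 * (l / (1 - α)) / (a / (1 - α)) ^ 2 := ⟨_, rfl⟩
  have hA0 : 0 ≤ A := by rw [hA]; positivity
  refine ⟨A + D ^ 2 * (((1 : ℕ) : ℝ) ^ 2 * (M / (1 - α)))⁻¹, by positivity, fun K x => ?_⟩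
  have h := hu.sq_le hα₁ K x
  have hp := hu.isProfile hα₁ K
  have h1 := hp.pow_le_lyap hμ.le 1 x
  have h2 := hp.sq_le_lyap_one hμ x
  rw [← hA, ← hD, mul_pow] at h
  rw [pow_one] at h1
  rw [div_eq_mul_inv] at h2
  have h3 := mul_le_mul_of_nonneg_left h1 hA0
  have h4 := mul_le_mul_of_nonneg_left h2 (sq_nonneg D)
  unfold levelLyap
  linarith

lemma UniformProblem.pow_four_le_levelLyap (hu : UniformProblem P α X ξstar f M a l R)
    (hα₁ : α < 1) :
    ∃ C, 0 ≤ C ∧ ∀ K x, (x - ξstar K) ^ 4 ≤ C * levelLyap P α X ξstar M 2 K x := by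
  have hα : 0 < 1 - α := by linarith
  have ha := hu.a_pos
  have hl := hu.l_pos
  have hM := hu.M_pos
  have hμ : 0 < ((2 : ℕ) : ℝ) ^ 2 * (M / (1 - α)) := by positivity
  obtain ⟨A, hA⟩ : ∃ A, A = 3 / (a / (1 - α)) := ⟨_, rfl⟩
  obtain ⟨D, hD⟩ : ∃ D, D = 3 * (l / (1 - α)) / (a / (1 - α)) ^ 2 := ⟨_, rfl⟩
  refine ⟨2 * A ^ 2 + 2 * D ^ 4 * (2 / (((2 : ℕ) : ℝ) ^ 2 * (M / (1 - α))) ^ 2), by positivity,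
    fun K x => ?_⟩
  have h := hu.sq_le hα₁ K x
  have hp := hu.isProfile hα₁ K
  have h1 := hp.pow_le_lyap hμ.le 2 x
  have h2 := hp.pow_four_le_lyap_two hμ x
  rw [← hA, ← hD] at h
  have h3 := mul_le_mul_of_nonneg_left h1 (sq_nonneg A)
  have h4 := mul_le_mul_of_nonneg_left h2 (by positivity : 0 ≤ D ^ 4)
  have h5 := pow_le_pow_left₀ (sq_nonneg _) h 2
  have h6 : ∀ s t : ℝ, (s + t) ^ 2 ≤ 2 * s ^ 2 + 2 * t ^ 2 := fun s t => by
    linarith [sq_nonneg (s - t)]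
  have h7 := h5.trans (h6 _ _)
  unfold levelLyap
  linarith

end Rates

end NestedSA

end

/-! ### Assembly of the two regimes `q = 1` and `q = 2`. -/

theorem mainTheorem3 {Ω : Type*} [MeasurableSpace Ω] (P : Measure Ω) [IsProbabilityMeasure P]
    {d q : ℕ}
    (φ : EuclideanSpace ℝ (Fin d) × EuclideanSpace ℝ (Fin q) → ℝ)
    (Y : Ω → EuclideanSpace ℝ (Fin d)) (Z : Ω → EuclideanSpace ℝ (Fin q))
    (Zs : ℕ → Ω → EuclideanSpace ℝ (Fin q))
    (hmodel : IsModel P φ Y Z Zs)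
    (hL2 : MemLp (fun ω => φ (Y ω, Z ω)) 2 P)
    (X : ℕ → Ω → ℝ) (hX : X = loss P φ Y Z Zs)
    (α : ℝ) (hα₀ : 0 < α) (hα₁ : α < 1)
    (ξstar : ℕ → ℝ) (hξstar : ∀ K, ξstar K ∈ argminV P α (X K))
    (χstar : ℕ → ℝ) (hχstar : ∀ K, χstar K = V P α (X K) (ξstar K))
    (hcdf : CdfExpansion P α X)
    (f : ℕ → ℝ → ℝ) (hf : HasPdfs P X f) (hreg : PdfRegularity f (ξstar 0))
    (ξ₀ χ₀ : ℕ → Ω → ℝ) (Xs : ℕ → ℕ → Ω → ℝ) (hXs : IsSampling P X ξ₀ χ₀ Xs)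
    (hξ₀ : UnifFiniteMean P (fun K ω =>
      |ξ₀ K ω| ^ 2 * Real.exp (4 / (1 - α) * kConst α * (⨆ J, supNorm (f J)) * |ξ₀ K ω|)))
    (hχ₀ : UnifFiniteMean P (fun K ω => |χ₀ K ω|))
    (γ₁ β : ℝ) (hγ₁ : 0 < γ₁) (hβ₀ : 0 < β) (hβ₁ : β ≤ 1) :
    ((β = 1 → 1 < lamBar P α X ξstar 1 * γ₁) →
      UnifRate P (fun K n ω => (xiIter α (step γ₁ β) ξ₀ χ₀ Xs K n ω - ξstar K) ^ 2)
        (fun n => step γ₁ β n) ∧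
      UnifRate P (fun K n ω => |chiIter α (step γ₁ β) ξ₀ χ₀ Xs K n ω - χstar K|)
        (fun n => 1 / (n : ℝ) ^ (min (1 / 2) β))) ∧
    (UnifFiniteMean P (fun K ω =>
        |ξ₀ K ω| ^ 4 * Real.exp (16 / (1 - α) * kConst α * (⨆ J, supNorm (f J)) * |ξ₀ K ω|)) →
      UnifFiniteMean P (fun K ω => (χ₀ K ω) ^ 2) →
      (β = 1 → 2 < lamBar P α X ξstar 2 * γ₁) →
      UnifRate P (fun K n ω => (xiIter α (step γ₁ β) ξ₀ χ₀ Xs K n ω - ξstar K) ^ 4)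
        (fun n => step γ₁ β n ^ 2) ∧
      UnifRate P (fun K n ω => (chiIter α (step γ₁ β) ξ₀ χ₀ Xs K n ω - χstar K) ^ 2)
        (fun n => 1 / (n : ℝ) ^ (min 1 (2 * β)))) := by
  subst hX
  have hint := hmodel.integrable_loss hL2
  have hα : 0 < 1 - α := by linarith
  obtain ⟨a, l, R, hu⟩ := exists_uniformProblem hint hf hα₁ hξstar hcdf hreg
  have hM := hu.M_pos
  have hk : 0 ≤ kConst α := zero_le_one.trans (le_max_left _ _)
  obtain ⟨M, hMdef⟩ : ∃ M, M = ⨆ J, supNorm (f J) := ⟨_, rfl⟩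
  rw [← hMdef] at hu hM hξ₀ ⊢
  have hmeas := fun K hK n => measurable_xiIter (α := α) hXs (step γ₁ β) (K := K) hK n
  have hb : min (1 / 2) β ≤ 1 / 2 := min_le_left _ _
  have hsecond := fun K hK => hmodel.memLp_loss hL2 (K := K) hK
  have hν : ∀ K, 1 ≤ K → MemLp (fun x : ℝ => x) 2 (P.map (loss P φ Y Z Zs K)) := fun K hK =>
    (memLp_map_measure_iff (g := fun x : ℝ => x) (by fun_prop) (hint K).1.aemeasurable).2
      (hsecond K hK).1
  have hνs : ∀ K, 1 ≤ K →
      ∫ x, x ^ 2 ∂(P.map (loss P φ Y Z Zs K)) ≤ ∫ ω, φ (Y ω, Z ω) ^ 2 ∂P := fun K hK => by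
    rw [integral_map (f := fun x : ℝ => x ^ 2) (hint K).1.aemeasurable (by fun_prop)]
    exact (hsecond K hK).2
  have hprob : ∀ K, IsProbabilityMeasure (P.map (loss P φ Y Z Zs K)) := fun K =>
    Measure.isProbabilityMeasure_map (hint K).1.aemeasurable
  have hVm : ∀ K, Measurable (V P α (loss P φ Y Z Zs K)) := fun K => by
    have := (hu.isProfile hα₁ K).continuous_v.measurable.add_const
      (V P α (loss P φ Y Z Zs K) (ξstar K))
    simpa using this
  refine ⟨fun hlam => ?_, fun hξ₀' _ hlam => ?_⟩
  · obtain ⟨U, hU, hrate⟩ := levelLyap_rate hu hα₀ hα₁ hXs hγ₁ hβ₀ hβ₁ (q := 1) (Or.inl rfl)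
      -- The Lyapunov function requires only `q² k_α M / (1 - α)` in the exponent; the assumed
      -- moment has four times that, and likewise for `q = 2`.
      (b := 4 / (1 - α) * kConst α * M) (by
        have : 0 ≤ M / (1 - α) * kConst α := by positivity
        have e : 4 / (1 - α) * kConst α * M = 4 * (M / (1 - α) * kConst α) := by ring
        rw [e]
        push_cast
        linarith) (by simpa using hξ₀) (by simpa using hlam)
    obtain ⟨C, hC, hsq⟩ := hu.sq_le_levelLyap hα₁
    constructor
    · refine unifRate_const (C * U) fun K hK n hn => ?_
      have h := integrable_and_integral_le (((hmeas K hK n).sub_const (ξstar K)).pow_const 2)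
        (fun ω => sq_nonneg _) hC (fun ω => hsq K _) (hrate K hK n).1 (hrate K hK n).2
      refine ⟨h.1, h.2.trans ?_⟩
      rw [pow_one, mul_assoc]
      exact mul_le_mul_of_nonneg_left
        (mul_le_mul_of_nonneg_left (step_succ_le hγ₁ hβ₀ hn) hU) hC
    · refine unifRate_const ((1 + noiseVar α (∫ ω, φ (Y ω, Z ω) ^ 2 ∂P)) / 2 + 2 * (U * γ₁))
        fun K hK n hn => ?_
      have hv : ∀ i : ℕ, Integrable (fun ω => V P α (loss P φ Y Z Zs K)
            (xiIter α (step γ₁ β) ξ₀ χ₀ Xs K i ω) - χstar K) P ∧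
          ∫ ω, (V P α (loss P φ Y Z Zs K) (xiIter α (step γ₁ β) ξ₀ χ₀ Xs K i ω) - χstar K) ∂P
            ≤ U * γ₁ * ((i : ℝ) + 1) ^ (-min (1 / 2) β) := fun i => by
        have hp := hu.isProfile hα₁ K
        have h := integrable_and_integral_le (C := 1)
          (((hVm K).comp (hmeas K hK i)).sub_const (χstar K))
          (fun ω => by rw [hχstar K]; exact hp.v_nonneg _) zero_le_one
          (fun ω => by
            rw [hχstar K, one_mul]
            exact (pow_one _).symm.le.trans (hp.pow_le_lyap (by positivity) 1 _))
          (hrate K hK i).1 (hrate K hK i).2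
        refine ⟨h.1, h.2.trans ?_⟩
        rw [one_mul, pow_one, mul_assoc]
        exact mul_le_mul_of_nonneg_left (step_succ_le_rpow hγ₁ (min_le_right _ _) i) hU
      have h := chi_rate_one hα₁ (hXs.isSample hK) (hVm K)
        (integral_valueSample (hint K)) (hν K hK) (hνs K hK)
        (fun ξ => by rw [hχstar K]; exact hξstar K ξ) hb (by positivity) hv hn
      refine ⟨h.1, h.2.trans (le_of_eq ?_)⟩
      rw [Real.rpow_neg (Nat.cast_nonneg n), ← one_div]
  · obtain ⟨U, hU, hrate⟩ := levelLyap_rate hu hα₀ hα₁ hXs hγ₁ hβ₀ hβ₁ (q := 2) (Or.inr rfl)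
      (b := 16 / (1 - α) * kConst α * M) (by
        have : 0 ≤ M / (1 - α) * kConst α := by positivity
        have e : 16 / (1 - α) * kConst α * M = 16 * (M / (1 - α) * kConst α) := by ring
        rw [e]
        push_cast
        linarith) (by simpa [hMdef] using hξ₀') (by simpa using hlam)
    obtain ⟨C, hC, hsq⟩ := hu.pow_four_le_levelLyap hα₁
    constructor
    · refine unifRate_const (C * U) fun K hK n hn => ?_
      have h := integrable_and_integral_le (((hmeas K hK n).sub_const (ξstar K)).pow_const 4)
        (fun ω => by positivity) hC (fun ω => hsq K _) (hrate K hK n).1 (hrate K hK n).2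
      refine ⟨h.1, h.2.trans ?_⟩
      rw [mul_assoc]
      exact mul_le_mul_of_nonneg_left (mul_le_mul_of_nonneg_left
        (pow_le_pow_left₀ (step_pos hγ₁ (by omega)).le (step_succ_le hγ₁ hβ₀ hn) 2) hU) hC
    · refine unifRate_const (2 * noiseVar α (∫ ω, φ (Y ω, Z ω) ^ 2 ∂P) + 8 * (U * γ₁ ^ 2))
        fun K hK n hn => ?_
      have hv : ∀ i : ℕ, Integrable (fun ω => (V P α (loss P φ Y Z Zs K)
            (xiIter α (step γ₁ β) ξ₀ χ₀ Xs K i ω) - χstar K) ^ 2) P ∧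
          ∫ ω, (V P α (loss P φ Y Z Zs K)
            (xiIter α (step γ₁ β) ξ₀ χ₀ Xs K i ω) - χstar K) ^ 2 ∂P
            ≤ U * γ₁ ^ 2 * (((i : ℝ) + 1) ^ (-min (1 / 2) β)) ^ 2 := fun i => by
        have hp := hu.isProfile hα₁ K
        have h := integrable_and_integral_le (C := 1)
          ((((hVm K).comp (hmeas K hK i)).sub_const (χstar K)).pow_const 2)
          (fun ω => sq_nonneg _) zero_le_one
          (fun ω => by
            rw [hχstar K, one_mul]
            exact hp.pow_le_lyap (by positivity) 2 _)
          (hrate K hK i).1 (hrate K hK i).2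
        refine ⟨h.1, h.2.trans ?_⟩
        rw [one_mul, mul_assoc, ← mul_pow]
        exact mul_le_mul_of_nonneg_left (pow_le_pow_left₀ (step_pos hγ₁ (by omega)).le
          (step_succ_le_rpow hγ₁ (min_le_right _ _) i) 2) hU
      have h := chi_rate_two hα₁ (hXs.isSample hK) (hVm K)
        (integral_valueSample (hint K)) (hν K hK) (hνs K hK) hb (by positivity) hv hn
      refine ⟨h.1, h.2.trans (le_of_eq ?_)⟩
      -- The `L²` rate is the square of the `L¹` rate `n^{-b}`, `b = min (1/2) β`.
      have hmin : min 1 (2 * β) = 2 * min (1 / 2) β := by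
        rw [mul_min_of_nonneg _ _ (by norm_num : (0 : ℝ) ≤ 2)]
        norm_num
      rw [hmin, Real.rpow_neg (Nat.cast_nonneg n), mul_comm 2 (min (1 / 2) β),
        Real.rpow_mul (Nat.cast_nonneg n), Real.rpow_two, inv_pow, ← one_div]
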